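/- A graded poset is a finite partially ordered set with minimum $\hat 0$, maximum $\hat 1$ and a rank function $\rho$ satisfying $\rho(\hat 0)=0$ and $\rho(y)=\rho(x)+1$ whenever $y$ covers $x$; its rank is $\rho(\hat 1)$. For a graded poset $P$ of rank $n+1$ and $S\subseteq[1,n]$, $f_S=f_S(P)$ is the number of chains of $P$ whose set of ranks is $S$ (we write $f_{135}$ for $f_{\{1,3,5\}}$, etc.), and $(f_S(P))_{S\subseteq[1,n]}\in\mathbb R^{2^n}$ is the flag vector of $P$. For $k>0$ its flag $L^k$-vector is $L^k_S(P)=(-1)^{n-|S|}\sum_{T\supseteq[1,n]\setminus S}\left(-\frac1{2k}\right)^{|T|}f_T(P)$. $P$ is Eulerian if its Möbius function satisfies $\mu([x,y])=(-1)^{\rho(y)-\rho(x)}$ for all $x\le y$. It is half-Eulerian if the poset $D^2P$, obtained by replacing every $x\ne\hat 0,\hat 1$ by two elements $x_1,x_2$ with $x_i<y_j$ iff $x<y$, is Eulerian. It is $k$-Eulerian if $\mu_k([x,y])=(-1)^{\rho(y)-\rho(x)}$ for all $x\le y$, where $\mu_k([x,x])=1$ and $\mu_k([x,y])=-1-\frac1k\sum_{x<z<y}\mu_k([x,z])$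 for $x<y$. The convolution of linear forms in flag numbers is the bilinear extension of $f_S*f_T=f_{S\cup\{m+1\}\cup(T+m+1)}$, where $f_S$ is taken in rank $m+1$, $f_T$ in rank $n+1$ and the result in rank $m+n+2$. The two basic families of inequalities in rank $n+1$ ($n\ge0$) are: (a) $\sum_{R\subseteq T}(-1)^{|T\setminus R|}f_{S\cup R}\ge0$, for disjoint $S,T\subseteq[1,n]$ such that every maximal interval of $[1,n]\setminus S$ contains at most one element of $T$; (b) $f_{\{i,\ell\}}-f_{\{i\}}-f_{\{\ell\}}+f_{\{j\}}\ge0$, for $1\le i<j<\ell\le n$. **Proposition.** (1) Every half-Eulerian poset $P$ of rank $8$ satisfies $$F(P):=f_{1356}-f_{135}-f_{356}+f_{15}-f_{16}+f_{35}+f_{36}-f_3\ \ge\ 0 .$$ In $L^{1/2}$-vector form: $F(P)=-\Lambda_{1/2}(P)$, so that $\Lambda_{1/2}(P)\le0$, where $$\Lambda_k=L^k_{45}+L^k_{2345}+L^k_{56}+L^k_{1256}-L^k_{2367}-L^k_{3467}+L^k_{4567}+L^k_{124567}.$$ (2) The inequality $F\ge0$ determines a facet of the smallest closed convex cone containing the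 flag vectors of all half-Eulerian posets of rank $8$: it is valid on the cone, and the face where equality holds has dimension one less than the cone. (3) The inequality does not follow from the basic families: the form $F$ cannot be obtained from the forms in (a) and (b) (of all ranks) by repeatedly taking convolutions and nonnegative linear combinations and adding linear forms that vanish on the flag vectors of all half-Eulerian posets of the rank in question. (4) Let $k=j/2$ with $j$ a positive integer. Then (1)–(3) remain true if "half-Eulerian" is replaced by "$k$-Eulerian" and, in $F$ and in (a), (b), each $f_S$ (in rank $n+1$) is replaced by $(2k)^{n-|S|}f_S$; the $L$-vector form in (1) becomes $F(P)=-(2k)^7\Lambda_k(P)$, so that $\Lambda_k(P)\le 0$. -/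

import Mathlib

namespace EulerianFlag

/-! A graded poset is a finite bounded partial order with `GradeMinOrder ℕ P`: then `grade ℕ` is
its rank function, which vanishes at `⊥` and increases by exactly one along covers. The rank of `P`
is `grade ℕ (⊤ : P)`. -/

/-! ### Flag numbers -/

/-- `f_S(P)`: the number of chains of `P` whose set of ranks is `S`. -/
noncomputable def flagNumber (P : Type*) [PartialOrder P] [GradeMinOrder ℕ P] (S : Finset ℕ) : ℕ :=
  Set.ncard {C : Set P | IsChain (· ≤ ·) C ∧ grade ℕ '' C = (S : Set ℕ)}

/-- The subsets `S` of `[1,n]`. -/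
abbrev RankSet (n : ℕ) := ↥(Finset.Icc 1 n).powerset

/-- The real vector space of dimension `2^n` in which the flag vectors of rank `n + 1` lie. -/
abbrev FlagVector (n : ℕ) := RankSet n → ℝ

/-- The flag vector `(f_S(P) : S ⊆ [1,n])` of a graded poset of rank `n + 1`. -/
noncomputable def flagVector (n : ℕ) (P : Type*) [PartialOrder P] [GradeMinOrder ℕ P] :
    FlagVector n :=
  fun S => (flagNumber P (S : Finset ℕ) : ℝ)

/-- The flag `L^k`-vector of a graded poset of rank `n + 1`:
`L_S = (-1)^(n-|S|) ∑_{T ⊇ [1,n] \ S} (-1/(2k))^|T| f_T`, for `S ⊆ [1,n]`. -/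
noncomputable def flagL (k : ℝ) (n : ℕ) (P : Type*) [PartialOrder P] [GradeMinOrder ℕ P]
    (S : Finset ℕ) : ℝ :=
  (-1) ^ (n - S.card) *
    ∑ T ∈ (Finset.Icc 1 n).powerset with Finset.Icc 1 n \ S ⊆ T,
      (-(1 / (2 * k))) ^ T.card * (flagNumber P T : ℝ)

/-! ### Eulerian, half-Eulerian and `k`-Eulerian posets -/

/-- A graded poset is Eulerian if `μ(x,y) = (-1)^(ρ(y)-ρ(x))` for all `x ≤ y`. -/
def IsEulerian (P : Type*) [PartialOrder P] [Finite P] [GradeMinOrder ℕ P] : Prop :=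
  letI : DecidableEq P := Classical.decEq P
  letI : DecidableLE P := Classical.decRel _
  letI : DecidableLT P := Classical.decRel _
  letI : Fintype P := Fintype.ofFinite P
  letI : LocallyFiniteOrder P := Fintype.toLocallyFiniteOrder
  ∀ x y : P, x ≤ y → IncidenceAlgebra.mu ℤ x y = (-1) ^ (grade ℕ y - grade ℕ x)

open Classical in
/-- The `k`-Möbius function on the intervals `[x,y]`, `x ≤ y`:
`μ_k([x,x]) = 1` and `μ_k([x,y]) = -1 - (1/k) ∑_{x<z<y} μ_k([x,z])` otherwise. -/
noncomputable def kMobius {P : Type*} [PartialOrder P] [Fintype P] (k : ℝ) (x y : P) : ℝ :=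
  if x = y then 1
  else -1 - (1 / k) * ∑ z : {z : P // x < z ∧ z < y}, kMobius k x z.1
termination_by (Finset.univ.filter (· < y)).card
decreasing_by
  refine Finset.card_lt_card (Finset.ssubset_iff_of_subset ?_ |>.2 ⟨z.1, ?_, ?_⟩)
  · intro w hw
    simp only [Finset.mem_filter, Finset.mem_univ, true_and] at hw ⊢
    exact hw.trans z.2.2
  · simpa using z.2.2
  · simp

/-- A graded poset is `k`-Eulerian if `μ_k([x,y]) = (-1)^(ρ(y)-ρ(x))` for all `x ≤ y`. -/
def IsKEulerian (k : ℝ) (P : Type*) [PartialOrder P] [Finite P] [GradeMinOrder ℕ P] : Prop :=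
  letI : Fintype P := Fintype.ofFinite P
  ∀ x y : P, x ≤ y → kMobius k x y = (-1) ^ (grade ℕ y - grade ℕ x)

/-- The thickening `D^r P`: every element other than `⊥`, `⊤` is replaced by `r` copies. -/
@[ext] structure Thicken (P : Type*) [PartialOrder P] [BoundedOrder P] (r : ℕ) where
  elt : P
  idx : Fin r
  idx_eq_zero : elt = ⊥ ∨ elt = ⊤ → (idx : ℕ) = 0

namespace Thicken

variable {P : Type*} [PartialOrder P] [BoundedOrder P] {r : ℕ}

/-- Copies satisfy `x_i < y_j` if and only if `x < y` in `P`. -/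
instance : PartialOrder (Thicken P r) where
  le p q := p = q ∨ p.elt < q.elt
  le_refl p := Or.inl rfl
  le_trans p q s := by
    rintro (rfl | h) (rfl | h')
    · exact Or.inl rfl
    · exact Or.inr h'
    · exact Or.inr h
    · exact Or.inr (h.trans h')
  le_antisymm p q := by
    rintro (rfl | h) (h' | h')
    · rfl
    · rfl
    · exact h'.symm
    · exact absurd (h.trans h') (lt_irrefl _)

theorem le_iff (p q : Thicken P r) : p ≤ q ↔ p = q ∨ p.elt < q.elt := Iff.rfl

theorem lt_iff (p q : Thicken P r) : p < q ↔ p.elt < q.elt := by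
  rw [lt_iff_le_and_ne, le_iff]
  constructor
  · rintro ⟨h | h, h'⟩
    · exact absurd h h'
    · exact h
  · intro h
    exact ⟨Or.inr h, fun e => absurd h (by rw [e]; exact lt_irrefl _)⟩

instance [NeZero r] : BoundedOrder (Thicken P r) where
  bot := ⟨⊥, 0, fun _ => rfl⟩
  top := ⟨⊤, 0, fun _ => rfl⟩
  bot_le p := by
    rw [le_iff]
    by_cases h : p.elt = ⊥
    · left
      ext
      · exact h.symm
      · exact (p.idx_eq_zero (Or.inl h)).symm
    · exact Or.inr (bot_lt_iff_ne_bot.2 h)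
  le_top p := by
    rw [le_iff]
    by_cases h : p.elt = ⊤
    · left
      ext
      · exact h
      · exact p.idx_eq_zero (Or.inr h)
    · exact Or.inr (lt_top_iff_ne_top.2 h)

instance [Finite P] : Finite (Thicken P r) :=
  Finite.of_injective (fun p : Thicken P r => (p.elt, p.idx)) (by
    intro p q h
    simp only [Prod.mk.injEq] at h
    ext
    · exact h.1
    · rw [h.2])

/-- The copies of `x` have the rank of `x`. -/
instance [NeZero r] [GradeMinOrder ℕ P] : GradeMinOrder ℕ (Thicken P r) where
  grade p := grade ℕ p.elt
  grade_strictMono p q h := grade_strictMono ((lt_iff p q).1 h)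
  covBy_grade p q h := by
    have h1 : p.elt < q.elt := (lt_iff p q).1 h.1
    refine CovBy.grade ℕ ⟨h1, fun c hc hc' => ?_⟩
    exact h.2 (c := ⟨c, 0, fun _ => rfl⟩) ((lt_iff _ _).2 hc) ((lt_iff _ _).2 hc')
  isMin_grade p h := by
    have h1 : p = ⊥ := isMin_iff_eq_bot.1 h
    subst h1
    exact IsMin.grade ℕ (isMin_bot : IsMin (⊥ : P))

end Thicken

/-- A graded poset `P` is half-Eulerian if `D^2 P` is Eulerian. -/
def IsHalfEulerian (P : Type*) [PartialOrder P] [BoundedOrder P] [Finite P]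
    [GradeMinOrder ℕ P] : Prop :=
  IsEulerian (Thicken P 2)

/-- The flag vectors of all half-Eulerian posets of rank `n + 1`. -/
def halfEulerianFlagVectors (n : ℕ) : Set (FlagVector n) :=
  {v | ∃ (P : Type) (_ : PartialOrder P) (_ : BoundedOrder P) (_ : Finite P)
      (_ : GradeMinOrder ℕ P),
      grade ℕ (⊤ : P) = n + 1 ∧ IsHalfEulerian P ∧ flagVector n P = v}

/-- The flag vectors of all `k`-Eulerian posets of rank `n + 1`. -/
def kEulerianFlagVectors (k : ℝ) (n : ℕ) : Set (FlagVector n) :=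
  {v | ∃ (P : Type) (_ : PartialOrder P) (_ : BoundedOrder P) (_ : Finite P)
      (_ : GradeMinOrder ℕ P),
      grade ℕ (⊤ : P) = n + 1 ∧ IsKEulerian k P ∧ flagVector n P = v}

/-! ### Linear forms in the flag numbers, cones and facets -/

/-- A linear form `∑_S a_S f_S` in the flag numbers of rank `n + 1`, given by its coefficients. -/
abbrev FlagForm (n : ℕ) := RankSet n → ℝ

/-- The value of the form `∑_S a_S f_S` at a vector. -/
def evalForm {n : ℕ} (a : FlagForm n) (x : FlagVector n) : ℝ := ∑ S, a S * x S

/-- The form `f_S` in rank `n + 1`, for `S ⊆ [1,n]`. -/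
def flagForm (n : ℕ) (S : Finset ℕ) : FlagForm n := fun T => if (T : Finset ℕ) = S then 1 else 0

/-- The form obtained by replacing each `f_S` by `r^(n-|S|) f_S`. -/
def rescale (r : ℝ) {n : ℕ} (a : FlagForm n) : FlagForm n :=
  fun S => r ^ (n - (S : Finset ℕ).card) * a S

/-- The smallest closed convex cone (with apex `0`) containing a set of vectors. -/
noncomputable def closedCone {n : ℕ} (V : Set (FlagVector n)) : PointedCone ℝ (FlagVector n) :=
  (PointedCone.hull ℝ V).closure

/-- The inequality `a ≥ 0` determines a facet of the cone `C`: it is valid on `C`, and the face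
of `C` on which it holds with equality has dimension one less than the dimension of `C`. -/
def DefinesFacet {n : ℕ} (a : FlagForm n) (C : PointedCone ℝ (FlagVector n)) : Prop :=
  (∀ x ∈ C, 0 ≤ evalForm a x) ∧
    Module.finrank ℝ (Submodule.span ℝ {x : FlagVector n | x ∈ C ∧ evalForm a x = 0}) + 1 =
      Module.finrank ℝ (Submodule.span ℝ (C : Set (FlagVector n)))

/-! ### Inequalities generated by convolution from the two basic families -/

/-- The convolution of a form in rank `m + 1` and a form in rank `n + 1`, the bilinear extension of
`f_S * f_T = f_{S ∪ {m+1} ∪ (T+m+1)}`, a form in rank `m + n + 2`. -/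
def convolution {m n : ℕ} (p : FlagForm m) (q : FlagForm n) : FlagForm (m + n + 1) :=
  ∑ S : RankSet m, ∑ T : RankSet n, (p S * q T) •
    flagForm (m + n + 1) ((S : Finset ℕ) ∪ {m + 1} ∪ (T : Finset ℕ).image (· + (m + 1)))

/-- The two basic families of forms. -/
inductive BasicForm : (n : ℕ) → FlagForm n → Prop
  /-- `∑_{R ⊆ T} (-1)^|T \ R| f_{S ∪ R}`, where `S, T ⊆ [1,n]` are disjoint and every interval
  contained in `[1,n] \ S` (equivalently, every maximal one) contains at most one element of `T`. -/
  | first (n : ℕ) (S T : Finset ℕ) (hS : S ⊆ Finset.Icc 1 n) (hT : T ⊆ Finset.Icc 1 n)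
      (hST : Disjoint S T)
      (hmax : ∀ i j : ℕ, Finset.Icc i j ⊆ Finset.Icc 1 n \ S → (T ∩ Finset.Icc i j).card ≤ 1) :
      BasicForm n (∑ R ∈ T.powerset, ((-1 : ℝ) ^ (T \ R).card) • flagForm n (S ∪ R))
  /-- `f_{iℓ} - f_i - f_ℓ + f_j`, where `1 ≤ i < j < ℓ ≤ n`. -/
  | second (n i j l : ℕ) (hi : 1 ≤ i) (hij : i < j) (hjl : j < l) (hl : l ≤ n) :
      BasicForm n (flagForm n {i, l} - flagForm n {i} - flagForm n {l} + flagForm n {j})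

/-- The basic forms in which each `f_S` is replaced by `r^(n-|S|) f_S`. -/
def RescaledBasicForm (r : ℝ) (n : ℕ) (b : FlagForm n) : Prop :=
  ∃ a : FlagForm n, BasicForm n a ∧ b = rescale r a

/-- `Generated B V n a`: the inequality `a ≥ 0` in rank `n + 1` follows from the inequalities
`b ≥ 0`, `b` in the family `B`, by repeatedly taking convolutions and nonnegative linear
combinations, and by using all linear equations that hold for the vectors in `V`. -/
inductive Generated (B : (n : ℕ) → FlagForm n → Prop) (V : (n : ℕ) → Set (FlagVector n)) :
    (n : ℕ) → FlagForm n → Prop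
  | basic (n : ℕ) (b : FlagForm n) (hb : B n b) : Generated B V n b
  | conv (m n : ℕ) (p : FlagForm m) (q : FlagForm n) (hp : Generated B V m p)
      (hq : Generated B V n q) : Generated B V (m + n + 1) (convolution p q)
  | add (n : ℕ) (p q : FlagForm n) (hp : Generated B V n p) (hq : Generated B V n q) :
      Generated B V n (p + q)
  | smul (n : ℕ) (c : ℝ) (p : FlagForm n) (hc : 0 ≤ c) (hp : Generated B V n p) :
      Generated B V n (c • p)
  | equation (n : ℕ) (e : FlagForm n) (he : ∀ x ∈ V n, evalForm e x = 0) : Generated B V n e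

/-- The form `f_{1356} - f_{135} - f_{356} + f_{15} - f_{16} + f_{35} + f_{36} - f_3` in rank 8. -/
def rank8Form : FlagForm 7 :=
  flagForm 7 {1, 3, 5, 6} - flagForm 7 {1, 3, 5} - flagForm 7 {3, 5, 6} + flagForm 7 {1, 5}
    - flagForm 7 {1, 6} + flagForm 7 {3, 5} + flagForm 7 {3, 6} - flagForm 7 {3}

/-- `L_{45} + L_{2345} + L_{56} + L_{1256} - L_{2367} - L_{3467} + L_{4567} + L_{124567}`, where
`L` is the flag `L^k`-vector in rank 8. -/
noncomputable def rank8L (k : ℝ) (P : Type*) [PartialOrder P] [GradeMinOrder ℕ P] : ℝ :=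
  flagL k 7 P {4, 5} + flagL k 7 P {2, 3, 4, 5} + flagL k 7 P {5, 6} + flagL k 7 P {1, 2, 5, 6}
    - flagL k 7 P {2, 3, 6, 7} - flagL k 7 P {3, 4, 6, 7} + flagL k 7 P {4, 5, 6, 7}
    + flagL k 7 P {1, 2, 4, 5, 6, 7}

end EulerianFlag

open EulerianFlag

namespace EulerianFlag

/-! Everything rests on a linear reformulation, `EulerRel`: being `k`-Eulerian means that the
alternating rank sum over each open interval is `-k` times the sum of the signs of its two ends. In
this form `D^r` multiplies the parameter by `r`. Hence half-Eulerian means `1/2`-Eulerian, and `D^r`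
of a half-Eulerian poset is `r/2`-Eulerian with each `f_S` multiplied by `r^|S|`. One argument with
a positive integer `r = 2k` covers all cases, and examples have to be constructed for `r = 1` only.

Validity. Intervals of rank two have exactly `r` inner elements, so every open interval has at least
`r` elements of each intermediate rank (`EulerRel.isThick`). Taking the first `r` of them in a fixed
enumeration gives a selection that is hereditary when the upper end is lowered
(`IsThick.exists_selection`). Each term of `F`, times a power of `r`, then counts chains `a < x < y
< z` of ranks 1, 3, 5, 6 in which the missing elements are selected ones, and the signed sum of
indicators is nonnegative chain by chain (`rank8_nonneg_of_isThick`). The Euler relations make the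
flag `L`-vector vanish outside the 21 sets whose maximal runs are even; the `L`-form of `F` is a
comparison of coefficients at these sets.

Facet. The same vanishing puts the cone into the span of 21 vectors `disjointVector`. Conversely,
points of the cone are produced as limits of flag vectors of explicit posets: every even interval
system yields one (`IsEvenSystem.systemVector_mem_closedCone`). Sixteen of these lie on `F = 0`;
four further points of the face come from the families `typesA` to `typesD`, verified by computing
with polynomials. Together with the limit for the system `{[4,5]}`, where `F` is positive, they span
all 21 dimensions (`disjointVector_mem_sup`), so the face has dimension 20.

Non-generation. `separatorList` describes a vector at which `F` is negative but every generated form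
is nonnegative. The induction (`Generated.nonneg`) also carries nonnegativity at the vectors of all
even systems in all ranks. At those vectors a convolution factorises. Moreover a convolution
involves only sets containing one fixed rank, and on such sets the separating vector agrees with a
sum of three system vectors (`separator_decomposition`). -/

/-! ### The Euler relations -/

open Classical in
/-- The Euler relations with parameter `κ`: `∑_{x<z<y} (-1)^ρ(z) = -κ((-1)^ρ(x) + (-1)^ρ(y))`. -/
def EulerRel (κ : ℝ) (P : Type*) [PartialOrder P] [Fintype P] [GradeMinOrder ℕ P] : Prop :=
  ∀ x y : P, x < y → ∑ z with x < z ∧ z < y, (-1 : ℝ) ^ grade ℕ z =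
    -κ * ((-1) ^ grade ℕ x + (-1) ^ grade ℕ y)

theorem neg_one_pow_sub {m n : ℕ} (h : m ≤ n) :
    (-1 : ℝ) ^ (n - m) = (-1) ^ m * (-1) ^ n := by
  obtain ⟨d, rfl⟩ := Nat.exists_eq_add_of_le h
  rw [Nat.add_sub_cancel_left, pow_add, ← mul_assoc, ← pow_add, ← two_mul, pow_mul]
  norm_num

theorem neg_one_pow_mul_self (m : ℕ) : (-1 : ℝ) ^ m * (-1) ^ m = 1 := by
  rw [← pow_add, ← two_mul, pow_mul]; norm_num

-- Multiplication by the sign of `x` is an involution. The normalised signs are the values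
-- prescribed for the Möbius function of `[x, z]`.
open Classical in
theorem eulerRel_iff {P : Type*} [PartialOrder P] [Fintype P] [GradeMinOrder ℕ P] {κ : ℝ} :
    EulerRel κ P ↔ ∀ x y : P, x < y →
    ∑ z with x < z ∧ z < y, (-1 : ℝ) ^ (grade ℕ z - grade ℕ x) =
      -κ * (1 + (-1) ^ (grade ℕ y - grade ℕ x)) := by
  refine forall_congr' fun x => forall_congr' fun y => forall_congr' fun hxy => ?_
  have h1 : ∑ z with x < z ∧ z < y, (-1 : ℝ) ^ (grade ℕ z - grade ℕ x) =
      (-1) ^ grade ℕ x * ∑ z with x < z ∧ z < y, (-1 : ℝ) ^ grade ℕ z := by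
    rw [Finset.mul_sum]
    refine Finset.sum_congr rfl fun z hz => ?_
    exact neg_one_pow_sub (grade_strictMono (Finset.mem_filter.1 hz).2.1).le
  rw [h1, neg_one_pow_sub (grade_strictMono hxy).le]
  have h2 := neg_one_pow_mul_self (grade ℕ x)
  constructor
  · intro h
    rw [h]
    linear_combination -κ * h2
  · intro h
    have := congrArg (fun t => (-1 : ℝ) ^ grade ℕ x * t) h
    simp only [← mul_assoc, h2, one_mul] at this
    rw [this]
    linear_combination -κ * (-1) ^ grade ℕ y * h2

open Classical in
theorem kMobius_of_lt {P : Type*} [PartialOrder P] [Fintype P] (k : ℝ) {x y : P} (h : x < y) :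
    kMobius k x y = -1 - (1 / k) * ∑ z with x < z ∧ z < y, kMobius k x z := by
  rw [kMobius, if_neg h.ne]
  congr 2
  exact (Finset.sum_subtype (p := fun z => x < z ∧ z < y) _ (by simp) _).symm

theorem kMobius_self {P : Type*} [PartialOrder P] [Fintype P] (k : ℝ) (x : P) : kMobius k x x = 1 :=
    by
  rw [kMobius, if_pos rfl]

/-- If `μ_k` has the prescribed values, its recursion on `[x, y]` is the Euler relation of that
interval. The converse is an induction on `y`, because the recursion determines `μ_k`. -/
theorem isKEulerian_iff_eulerRel {P : Type*} [PartialOrder P] [Fintype P] [GradeMinOrder ℕ P]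
    {k : ℝ} (hk : k ≠ 0) : IsKEulerian k P ↔ EulerRel k P := by
  classical
  rw [eulerRel_iff]
  have hF : Fintype.ofFinite P = ‹Fintype P› := Subsingleton.elim _ _
  unfold IsKEulerian
  rw [hF]
  constructor
  · intro h x y hxy
    have h1 := kMobius_of_lt k hxy
    rw [h x y hxy.le] at h1
    have h2 : ∑ z with x < z ∧ z < y, kMobius k x z =
        ∑ z with x < z ∧ z < y, (-1 : ℝ) ^ (grade ℕ z - grade ℕ x) :=
      Finset.sum_congr rfl fun z hz => h x z (Finset.mem_filter.1 hz).2.1.le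
    rw [h2] at h1
    rw [h1]
    field_simp
    ring
  · intro h x y
    induction y using WellFoundedLT.induction with
    | ind y ih =>
      intro hxy
      rcases hxy.eq_or_lt with rfl | hlt
      · simp [kMobius_self]
      · rw [kMobius_of_lt k hlt, Finset.sum_congr rfl fun z hz =>
          ih z (Finset.mem_filter.1 hz).2.2 (Finset.mem_filter.1 hz).2.1.le, h x y hlt]
        field_simp
        ring

theorem isEulerian_iff_eulerRel {P : Type*} [PartialOrder P] [Fintype P] [GradeMinOrder ℕ P] :
    IsEulerian P ↔ EulerRel 1 P := by
  rw [← isKEulerian_iff_eulerRel one_ne_zero]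
  classical
  have hF : Fintype.ofFinite P = ‹Fintype P› := Subsingleton.elim _ _
  unfold IsKEulerian IsEulerian
  rw [hF]
  let _ : DecidableEq P := Classical.decEq P
  let _ : DecidableLE P := Classical.decRel _
  let _ : DecidableLT P := Classical.decRel _
  let _ : LocallyFiniteOrder P := Fintype.toLocallyFiniteOrder
  have key : ∀ x y : P, x ≤ y → ((IncidenceAlgebra.mu ℤ x y : ℤ) : ℝ) = kMobius 1 x y := by
    intro x y
    induction y using WellFoundedLT.induction with
    | ind y ih =>
      intro hxy
      rcases hxy.eq_or_lt with rfl | hlt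
      · simp [kMobius_self]
      -- The usual recursion sums over `[x, y)`; the term `z = x`, split off here, is the constant
      -- `-1` in `kMobius`.
      · rw [IncidenceAlgebra.mu_eq_neg_sum_Ico_of_ne hlt.ne, kMobius_of_lt 1 hlt,
          ← Finset.Ioo_insert_left hlt, Finset.sum_insert (by simp)]
        push_cast
        rw [IncidenceAlgebra.mu_self]
        have : ∑ z ∈ Finset.Ioo x y, ((IncidenceAlgebra.mu ℤ x z : ℤ) : ℝ) =
            ∑ z with x < z ∧ z < y, kMobius 1 x z := by
          refine Finset.sum_congr (by ext z; simp) fun z hz => ?_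
          have hz' : x < z ∧ z < y := by simpa using hz
          exact ih z hz'.2 hz'.1.le
        rw [this]
        push_cast
        ring
  refine forall_congr' fun x => forall_congr' fun y => forall_congr' fun hxy => ?_
  rw [← key x y hxy]
  constructor
  · intro h
    rw [h]; push_cast; rfl
  · intro h
    exact_mod_cast h

noncomputable instance Thicken.fintype {P : Type*} [PartialOrder P] [BoundedOrder P] [Fintype P]
    {r : ℕ} : Fintype (Thicken P r) := Fintype.ofFinite _

open Classical in
theorem Thicken.sum_filter {P : Type*} [PartialOrder P] [BoundedOrder P] [Fintype P] {r : ℕ}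
    (p : P → Prop) (hp : ∀ z, p z → z ≠ ⊥ ∧ z ≠ ⊤) {M : Type*} [AddCommMonoid M] (f : P → M) :
    ∑ z : Thicken P r with p z.elt, f z.elt = r • ∑ z with p z, f z := by
  rw [Finset.smul_sum]
  have h1 : ∀ z ∈ Finset.univ.filter (fun z : Thicken P r => p z.elt),
      z.elt ∈ Finset.univ.filter p := fun z hz => by simpa using hz
  rw [← Finset.sum_fiberwise_of_maps_to h1]
  refine Finset.sum_congr rfl fun x hx => ?_
  have hx' : p x := by simpa using hx
  rw [Finset.sum_congr rfl (g := fun _ => f x) (by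
    intro z hz; rw [(Finset.mem_filter.1 hz).2]), Finset.sum_const]
  congr 1
  refine Eq.trans ?_ (Finset.card_fin r)
  refine Finset.card_bij' (fun z _ => z.idx)
    (fun i _ => ⟨x, i, fun h => absurd h (by have := hp x hx'; tauto)⟩) ?_ ?_ ?_ ?_
  · simp
  · intro i _
    simp [hx']
  · intro z hz
    ext
    · exact (Finset.mem_filter.1 hz).2.symm
    · rfl
  · intro i _
    rfl

theorem Thicken.grade_elt {P : Type*} [PartialOrder P] [BoundedOrder P] [GradeMinOrder ℕ P] {r : ℕ}
    [NeZero r] (z : Thicken P r) : grade ℕ z = grade ℕ z.elt := rfl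

/-- The first copy of an element. -/
def Thicken.mk0 {P : Type*} [PartialOrder P] [BoundedOrder P] (r : ℕ) [NeZero r] (x : P) :
    Thicken P r := ⟨x, 0, fun _ => rfl⟩

/-- The open interval between copies of `x` and `y` consists of all `r` copies of each element
strictly between `x` and `y`, none of which is `⊥` or `⊤`. So its alternating sum acquires a factor
`r`. -/
theorem eulerRel_thicken {P : Type*} [PartialOrder P] [BoundedOrder P] [Fintype P]
    [GradeMinOrder ℕ P] {r : ℕ} [NeZero r] {κ : ℝ} :
    EulerRel κ (Thicken P r) ↔ EulerRel (κ / r) P := by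
  classical
  have hr : (r : ℝ) ≠ 0 := by exact_mod_cast NeZero.ne r
  have key : ∀ x y : Thicken P r, ∑ z with x < z ∧ z < y, (-1 : ℝ) ^ grade ℕ z =
      r * ∑ z with x.elt < z ∧ z < y.elt, (-1 : ℝ) ^ grade ℕ z := by
    intro x y
    have h := Thicken.sum_filter (r := r) (fun z => x.elt < z ∧ z < y.elt)
      (fun z hz => ⟨(bot_le.trans_lt hz.1).ne', (hz.2.trans_le le_top).ne⟩)
      (fun z => (-1 : ℝ) ^ grade ℕ z)
    rw [nsmul_eq_mul] at h
    refine Eq.trans (Finset.sum_congr (by ext z; simp [Thicken.lt_iff]) fun z _ => rfl)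
      (h.trans ?_)
    congr 1
    exact Finset.sum_congr (by ext z; simp) fun z _ => rfl
  constructor
  · intro h x y hxy
    have := h (Thicken.mk0 r x) (Thicken.mk0 r y) ((Thicken.lt_iff _ _).2 hxy)
    rw [key] at this
    have h2 : (r : ℝ) * ∑ z with x < z ∧ z < y, (-1 : ℝ) ^ grade ℕ z =
        -κ * ((-1) ^ grade ℕ x + (-1) ^ grade ℕ y) := this
    field_simp
    linarith
  · intro h x y hxy
    rw [key, h _ _ ((Thicken.lt_iff _ _).1 hxy), Thicken.grade_elt, Thicken.grade_elt]
    field_simp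

theorem isHalfEulerian_iff {P : Type*} [PartialOrder P] [BoundedOrder P] [Fintype P]
    [GradeMinOrder ℕ P] : IsHalfEulerian P ↔ IsKEulerian (1 / 2) P := by
  rw [isKEulerian_iff_eulerRel (by norm_num), IsHalfEulerian, isEulerian_iff_eulerRel,
    eulerRel_thicken]
  norm_num

/-! ### Counting chains with prescribed ranks -/

open Classical in
/-- The number of chains above `x` whose successive ranks are the entries of a list. -/
noncomputable def chainCount (P : Type*) [PartialOrder P] [Fintype P] [GradeMinOrder ℕ P] :
    List ℕ → P → ℕ
  | [], _ => 1
  | i :: R, x => ∑ z with x < z ∧ grade ℕ z = i, chainCount P R z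

section

variable {P : Type*} [PartialOrder P] [GradeMinOrder ℕ P]

theorem chain_lt_of_grade_lt {C : Set P} (hC : IsChain (· ≤ ·) C) {a b : P} (ha : a ∈ C)
    (hb : b ∈ C) (h : grade ℕ a < grade ℕ b) : a < b := by
  rcases hC.total ha hb with h1 | h1
  · exact lt_of_le_of_ne h1 (by rintro rfl; exact lt_irrefl _ h)
  · exact absurd (grade_mono h1) (not_le.2 h)

theorem chain_eq_of_grade_eq {C : Set P} (hC : IsChain (· ≤ ·) C) {a b : P} (ha : a ∈ C)
    (hb : b ∈ C) (h : grade ℕ a = grade ℕ b) : a = b := by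
  by_contra hne
  rcases hC.total ha hb with h1 | h1
  · exact absurd (grade_strictMono (lt_of_le_of_ne h1 hne)) (by rw [h]; exact lt_irrefl _)
  · exact absurd (grade_strictMono (lt_of_le_of_ne h1 (Ne.symm hne))) (by rw [h]; exact lt_irrefl _)

-- The recursion of `chainCount` peels off the lowest element: it is the only one of rank `i`, and
-- the rest is a chain above it.
open Classical in
theorem card_chains_above [Fintype P] (R : List ℕ) (hR : R.Pairwise (· < ·)) (x : P) :
    (Finset.univ.filter fun C : Set P => IsChain (· ≤ ·) C ∧ grade ℕ '' C = {i | i ∈ R} ∧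
      ∀ c ∈ C, x < c).card = chainCount P R x := by
  induction R generalizing x with
  | nil =>
    rw [chainCount, Finset.card_eq_one]
    refine ⟨∅, ?_⟩
    ext C
    simp only [Finset.mem_filter, Finset.mem_univ, true_and, Finset.mem_singleton, List.not_mem_nil,
      Set.ofPred_false, Set.image_eq_empty]
    constructor
    · exact fun h => h.2.1
    · rintro rfl
      exact ⟨IsChain.empty, rfl, by simp⟩
  | cons i R ih =>
    obtain ⟨hi, hR'⟩ := List.pairwise_cons.1 hR
    rw [chainCount, ← Finset.sum_congr rfl fun z _ => ih hR' z]
    have hins : ∀ z : P, grade ℕ z = i → ∀ C ∈ (Finset.univ.filter fun C : Set P =>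
        IsChain (· ≤ ·) C ∧ grade ℕ '' C = {i | i ∈ R} ∧ ∀ c ∈ C, z < c), z ∉ C :=
      fun z _ C hC hz => lt_irrefl _ ((Finset.mem_filter.1 hC).2.2.2 z hz)
    have hun : (Finset.univ.filter fun C : Set P => IsChain (· ≤ ·) C ∧
        grade ℕ '' C = {j | j ∈ i :: R} ∧ ∀ c ∈ C, x < c) =
        (Finset.univ.filter fun z => x < z ∧ grade ℕ z = i).biUnion fun z =>
          (Finset.univ.filter fun C : Set P => IsChain (· ≤ ·) C ∧
            grade ℕ '' C = {i | i ∈ R} ∧ ∀ c ∈ C, z < c).image (insert z) := by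
      ext C
      simp only [Finset.mem_filter, Finset.mem_univ, true_and, Finset.mem_biUnion,
        Finset.mem_image]
      constructor
      · rintro ⟨hC, hg, hx⟩
        obtain ⟨z, hz, hzi⟩ : i ∈ grade ℕ '' C := by rw [hg]; simp
        refine ⟨z, ⟨hx z hz, hzi⟩, C \ {z}, ⟨hC.mono Set.sdiff_subset, ?_, ?_⟩, ?_⟩
        · ext j
          constructor
          · rintro ⟨c, hc, rfl⟩
            have : grade ℕ c ∈ {j | j ∈ i :: R} := hg ▸ ⟨c, hc.1, rfl⟩
            rcases List.mem_cons.1 this with h | h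
            · exact absurd (chain_eq_of_grade_eq hC hc.1 hz (h.trans hzi.symm)) hc.2
            · exact h
          · intro hj
            obtain ⟨c, hc, rfl⟩ : j ∈ grade ℕ '' C := by rw [hg]; exact List.mem_cons_of_mem _ hj
            refine ⟨c, ⟨hc, ?_⟩, rfl⟩
            rintro rfl
            exact absurd (hi _ hj) (by rw [hzi]; exact lt_irrefl _)
        · intro c hc
          refine chain_lt_of_grade_lt hC hz hc.1 ?_
          have : grade ℕ c ∈ {j | j ∈ i :: R} := hg ▸ ⟨c, hc.1, rfl⟩
          rcases List.mem_cons.1 this with h | h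
          · exact absurd (chain_eq_of_grade_eq hC hc.1 hz (h.trans hzi.symm)) hc.2
          · rw [hzi]; exact hi _ h
        · rw [Set.insert_sdiff_singleton, Set.insert_eq_of_mem hz]
      · rintro ⟨z, ⟨hxz, hzi⟩, C, ⟨hC, hg, hz⟩, rfl⟩
        refine ⟨hC.insert fun c hc _ => Or.inl (hz c hc).le, ?_, ?_⟩
        · rw [Set.image_insert_eq, hg, hzi]
          ext j; simp
        · rintro c (rfl | hc)
          · exact hxz
          · exact hxz.trans (hz c hc)
    rw [hun, Finset.card_biUnion]
    · refine Finset.sum_congr rfl fun z hz => Finset.card_image_of_injOn ?_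
      intro C hC D hD h
      have h1 := hins z (Finset.mem_filter.1 hz).2.2 C hC
      have h2 := hins z (Finset.mem_filter.1 hz).2.2 D hD
      have h3 : insert z C = insert z D := h
      rw [← Set.insert_sdiff_self_of_notMem h1, h3, Set.insert_sdiff_self_of_notMem h2]
    -- Equal chains with lowest elements `z ≠ w` would give `z < w`, although both have rank `i`.
    · intro z hz w hw hzw
      rw [Function.onFun, Finset.disjoint_left]
      intro C hC hC'
      obtain ⟨D, hD, rfl⟩ := Finset.mem_image.1 hC
      obtain ⟨D', hD', h⟩ := Finset.mem_image.1 hC'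
      have h1 : w ∈ insert z D := h ▸ Set.mem_insert _ _
      rcases h1 with h1 | h1
      · exact hzw h1.symm
      · have h2 := grade_strictMono (𝕆 := ℕ) ((Finset.mem_filter.1 hD).2.2.2 w h1)
        rw [(Finset.mem_filter.1 hz).2.2, (Finset.mem_filter.1 hw).2.2] at h2
        exact lt_irrefl _ h2

theorem grade_pos_iff [OrderBot P] {z : P} : 0 < grade ℕ z ↔ ⊥ < z := by
  constructor
  · intro h
    refine bot_lt_iff_ne_bot.2 ?_
    rintro rfl
    simp at h
  · intro h
    simpa using grade_strictMono (𝕆 := ℕ) h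

theorem flagNumber_eq_chainCount [OrderBot P] [Fintype P] (R : List ℕ) (hR : R.Pairwise (· < ·))
    (h0 : ∀ i ∈ R, 0 < i) : flagNumber P R.toFinset = chainCount P R ⊥ := by
  classical
  rw [← card_chains_above R hR, flagNumber, Set.ncard_eq_toFinset_card']
  congr 1
  ext C
  simp only [Set.mem_toFinset, Set.mem_ofPred_eq, Finset.mem_filter, Finset.mem_univ, true_and,
    List.coe_toFinset]
  constructor
  · rintro ⟨hC, hg⟩
    refine ⟨hC, hg, fun c hc => grade_pos_iff.1 (h0 _ ?_)⟩
    have : grade ℕ c ∈ {j | j ∈ R} := hg ▸ ⟨c, hc, rfl⟩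
    exact this
  · exact fun h => ⟨h.1, h.2.1⟩

end

/-! ### Thick posets and the inequality -/

open Classical in
/-- Every nonempty open interval has at least `r` elements of each rank between those of its
endpoints. -/
def IsThick (r : ℕ) (P : Type*) [PartialOrder P] [Fintype P] [GradeMinOrder ℕ P] : Prop :=
  ∀ (x y : P) (i : ℕ), x < y → grade ℕ x < i → i < grade ℕ y →
    r ≤ (Finset.univ.filter fun z => x < z ∧ z < y ∧ grade ℕ z = i).card

/-- The position of an element of `s` in the order given by `e` maps `s` bijectively onto `0, …, |s|
- 1`, so exactly `r` positions are below `r`. -/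
theorem card_filter_rank_lt {α : Type*} [DecidableEq α] (e : α → ℕ) (he : Function.Injective e)
    (s : Finset α) {r : ℕ} (hr : r ≤ s.card) :
    (s.filter fun z => (s.filter fun w => e w < e z).card < r).card = r := by
  set g : α → ℕ := fun z => (s.filter fun w => e w < e z).card with hg
  have hmono : ∀ z ∈ s, ∀ w, e z < e w → g z < g w := by
    intro z hz w h
    refine Finset.card_lt_card ((Finset.ssubset_iff_of_subset ?_).2 ⟨z, ?_, ?_⟩)
    · intro v hv
      rw [Finset.mem_filter] at hv ⊢
      exact ⟨hv.1, hv.2.trans h⟩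
    · exact Finset.mem_filter.2 ⟨hz, h⟩
    · simp
  have hinj : Set.InjOn g s := by
    intro z hz w hw h
    by_contra hne
    rcases lt_or_gt_of_ne (fun h' => hne (he h')) with h' | h'
    · exact (hmono z hz w h').ne h
    · exact (hmono w hw z h').ne h.symm
  have himg : s.image g = Finset.range s.card := by
    refine Finset.eq_of_subset_of_card_le ?_ ?_
    · intro i hi
      obtain ⟨z, hz, rfl⟩ := Finset.mem_image.1 hi
      refine Finset.mem_range.2 (Finset.card_lt_card ((Finset.ssubset_iff_of_subset
        (Finset.filter_subset _ _)).2 ⟨z, hz, by simp⟩))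
    · rw [Finset.card_range, Finset.card_image_of_injOn hinj]
  have h2 : (s.filter fun z => g z < r).image g = Finset.range r := by
    ext i
    simp only [Finset.mem_image, Finset.mem_filter, Finset.mem_range]
    constructor
    · rintro ⟨z, ⟨_, hz⟩, rfl⟩
      exact hz
    · intro hi
      have : i ∈ s.image g := by rw [himg]; exact Finset.mem_range.2 (hi.trans_le hr)
      obtain ⟨z, hz, rfl⟩ := Finset.mem_image.1 this
      exact ⟨z, ⟨hz, hi⟩, rfl⟩
  rw [← Finset.card_image_of_injOn (hinj.mono (Finset.coe_subset.2 (Finset.filter_subset _ _))), h2,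
    Finset.card_range]

open Classical in
/-- In a thick poset one can select `r` elements of every rank in every open interval such that a
selected element stays selected when the upper end of the interval decreases. -/
theorem IsThick.exists_selection {P : Type*} [PartialOrder P] [Fintype P] [GradeMinOrder ℕ P] {r :
    ℕ}
    (h : IsThick r P) : ∃ R : ℕ → P → P → Finset P,
      (∀ i p q, p < q → grade ℕ p < i → i < grade ℕ q → (R i p q).card = r) ∧
      (∀ i p q z, z ∈ R i p q → p < z ∧ z < q ∧ grade ℕ z = i) ∧
      (∀ i p q q' z, z ∈ R i p q → z < q' → q' ≤ q → z ∈ R i p q') := by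
  -- A single enumeration of the whole poset serves all intervals, which makes selections in
  -- different intervals comparable.
  let e : P → ℕ := fun z => Fintype.equivFin P z
  have he : Function.Injective e := fun a b hab =>
    (Fintype.equivFin P).injective (Fin.ext hab)
  let s : ℕ → P → P → Finset P := fun i p q =>
    Finset.univ.filter fun z => p < z ∧ z < q ∧ grade ℕ z = i
  refine ⟨fun i p q => (s i p q).filter fun z => ((s i p q).filter fun w => e w < e z).card < r,
    fun i p q hpq hp hq => card_filter_rank_lt e he _ (h p q i hpq hp hq), ?_, ?_⟩
  · intro i p q z hz
    simpa [s] using (Finset.mem_filter.1 hz).1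
  · intro i p q q' z hz hzq hq
    obtain ⟨h1, h2⟩ := Finset.mem_filter.1 hz
    have h3 : p < z ∧ z < q ∧ grade ℕ z = i := by simpa [s] using h1
    -- Lowering `q` to `q'` only removes candidates, so the position of `z` cannot increase.
    refine Finset.mem_filter.2 ⟨by simp [s, h3, hzq], lt_of_le_of_lt (Finset.card_le_card ?_) h2⟩
    intro w hw
    simp only [s, Finset.mem_filter, Finset.mem_univ, true_and] at hw ⊢
    exact ⟨⟨hw.1.1, hw.1.2.1.trans_le hq, hw.1.2.2⟩, hw.2⟩

/-- A factor `r` is traded for a sum over one further element, confined to a selected set of `r`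
members. -/
theorem mul_ite_eq_sum {P : Type*} [Fintype P] {r : ℕ} {Q : Prop} [Decidable Q] {t : Finset P}
    [∀ z, Decidable (Q ∧ z ∈ t)] (ht : Q → t.card = r) :
    (r : ℝ) * (if Q then 1 else 0) = ∑ z, if Q ∧ z ∈ t then 1 else 0 := by
  classical
  by_cases h : Q
  · simp [h, ← ht h]
  · simp [h]

theorem exists_grade_eq {P : Type*} [PartialOrder P] [Fintype P] [GradeMinOrder ℕ P] {x y : P}
    (h : x ≤ y) {i : ℕ} (hx : grade ℕ x ≤ i) (hy : i ≤ grade ℕ y) :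
    ∃ z, x ≤ z ∧ z ≤ y ∧ grade ℕ z = i := by
  induction i, hx using Nat.le_induction with
  | base => exact ⟨x, le_rfl, h, rfl⟩
  | succ i hi ih =>
    obtain ⟨z, hxz, hzy, hz⟩ := ih (by omega)
    have hlt : z < y := lt_of_le_of_ne hzy (by rintro rfl; omega)
    obtain ⟨w, hw, hwy⟩ := exists_covBy_le_of_lt hlt
    refine ⟨w, hxz.trans hw.le, hwy, ?_⟩
    have := hw.grade ℕ
    rw [Nat.covBy_iff_add_one_eq] at this
    omega

open Classical in
/-- In a `k`-Eulerian poset every interval of rank two has exactly `2k` inner elements. -/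
theorem EulerRel.isThick {P : Type*} [PartialOrder P] [Fintype P] [GradeMinOrder ℕ P] {r : ℕ}
    (h : EulerRel ((r : ℝ) / 2) P) : IsThick r P := by
  intro x y i hxy hxi hiy
  -- An interval `[p, q]` of rank two around rank `i` is found inside `[x, y]`; the Euler relation
  -- gives it exactly `r` inner elements.
  obtain ⟨p, hxp, hpy, hp⟩ := exists_grade_eq hxy.le (i := i - 1) (by omega) (by omega)
  obtain ⟨q, hpq, hqy, hq⟩ := exists_grade_eq hpy (i := i + 1) (by omega) (by omega)
  have hlt : p < q := lt_of_le_of_ne hpq (by rintro rfl; omega)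
  have hg : ∀ z, p < z → z < q → grade ℕ z = i := by
    intro z h1 h2
    have h3 := grade_strictMono (𝕆 := ℕ) h1
    have h4 := grade_strictMono (𝕆 := ℕ) h2
    omega
  have h1 := h p q hlt
  rw [Finset.sum_congr rfl (g := fun _ => (-1 : ℝ) ^ i) (fun z hz => by
    obtain ⟨h2, h3⟩ : p < z ∧ z < q := by simpa using hz
    rw [hg z h2 h3]), Finset.sum_const, hq, hp, nsmul_eq_mul] at h1
  have h2 : ((Finset.univ.filter fun z : P => p < z ∧ z < q).card : ℝ) = r := by
    have h3 : (-1 : ℝ) ^ i = -(-1) ^ (i - 1) := by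
      obtain ⟨j, rfl⟩ : ∃ j, i = j + 1 := ⟨i - 1, by omega⟩
      simp [pow_succ]
    have h4 : (-1 : ℝ) ^ (i + 1) = (-1) ^ (i - 1) := by rw [pow_succ, h3]; ring
    rw [h4, h3] at h1
    have h5 : (-1 : ℝ) ^ (i - 1) ≠ 0 := pow_ne_zero _ (by norm_num)
    apply mul_right_cancel₀ h5
    have h6 : (((Finset.univ.filter fun z : P => p < z ∧ z < q).card : ℝ)) * -(-1) ^ (i - 1) =
      -((r : ℝ) / 2 * ((-1) ^ (i - 1) + (-1) ^ (i - 1))) := by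
        convert h1 using 2; ring
    linarith
  have h3 : (Finset.univ.filter fun z : P => p < z ∧ z < q).card = r := by exact_mod_cast h2
  rw [← h3]
  refine Finset.card_le_card fun z hz => ?_
  obtain ⟨h4, h5⟩ : p < z ∧ z < q := by simpa using hz
  simp [hxp.trans_lt h4, h5.trans_le hqy, hg z h4 h5]

theorem sum_rotate {P : Type*} [Fintype P] (f : P → P → P → P → ℝ) :
    ∑ x, ∑ y, ∑ z, ∑ a, f a x y z = ∑ a, ∑ x, ∑ y, ∑ z, f a x y z := by
  rw [Finset.sum_comm]
  simp_rw [fun (y x : P) => Finset.sum_comm (s := Finset.univ) (t := Finset.univ) (f := fun z a =>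
      f a x y z)]
  rw [Finset.sum_comm]
  simp_rw [fun (x : P) => Finset.sum_comm (s := Finset.univ) (t := Finset.univ) (f := fun y a =>
      ∑ z, f a x y z)]
  rw [Finset.sum_comm]

-- Write `A = [a ∈ R 1 ⊥ x]`, `Z = [z ∈ R 6 y ⊤]`, `X = [x ∈ R 3 a y]`, `X' = [x ∈ R 3 a z]`, `Y =
-- [y ∈ R 5 x z]`, `Y' = [y ∈ R 5 x ⊤]` for indicators. A chain `a < x < y < z` of ranks 1, 3, 5, 6
-- contributes `(1 - A)(1 - Z) + Z X - X' Y + A Y - A Z Y'`. Heredity of the selection gives `X' ≤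
-- X` and `Y' ≤ Y`, and then each of the four choices of `A` and `Z` yields a nonnegative value.
open Classical in
theorem rank8_nonneg_of_isThick {P : Type*} [PartialOrder P] [BoundedOrder P] [Fintype P]
    [GradeMinOrder ℕ P] (hP : grade ℕ (⊤ : P) = 8) {r : ℕ} (h : IsThick r P) :
    0 ≤ (r : ℝ) ^ 3 * (flagNumber P {1, 3, 5, 6} : ℝ) - (r : ℝ) ^ 4 * flagNumber P {1, 3, 5}
      - (r : ℝ) ^ 4 * flagNumber P {3, 5, 6} + (r : ℝ) ^ 5 * flagNumber P {1, 5}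
      - (r : ℝ) ^ 5 * flagNumber P {1, 6} + (r : ℝ) ^ 5 * flagNumber P {3, 5}
      + (r : ℝ) ^ 5 * flagNumber P {3, 6} - (r : ℝ) ^ 6 * flagNumber P {3} := by
  obtain ⟨R, hcard, hmem, hmono⟩ := h.exists_selection
  have hbot : ∀ z : P, grade ℕ z ≠ 0 → ⊥ < z := fun z hz =>
    grade_pos_iff.1 (Nat.pos_of_ne_zero hz)
  have htop : ∀ z : P, grade ℕ z ≠ 8 → z < ⊤ := fun z hz =>
    lt_top_iff_ne_top.2 (by rintro rfl; exact hz hP)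
  have hf1 : ∀ i, 0 < i → (flagNumber P {i} : ℝ) = ∑ x : P, if grade ℕ x = i then 1 else 0 := by
    intro i hi
    have := flagNumber_eq_chainCount (P := P) [i] (by simp) (by simp; omega)
    rw [show ({i} : Finset ℕ) = [i].toFinset by simp, this]
    simp only [chainCount, Finset.sum_filter, Nat.cast_sum]
    refine Finset.sum_congr rfl fun x _ => ?_
    by_cases hx : grade ℕ x = i
    · simp [hx, hbot x (by omega)]
    · simp [hx]
  have hf2 : ∀ i j, 0 < i → i < j → (flagNumber P {i, j} : ℝ) =
      ∑ x : P, ∑ y : P, if grade ℕ x = i ∧ grade ℕ y = j ∧ x < y then 1 else 0 := by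
    intro i j hi hij
    have := flagNumber_eq_chainCount (P := P) [i, j] (by simp [hij]) (by simp; omega)
    rw [show ({i, j} : Finset ℕ) = [i, j].toFinset by simp, this]
    simp only [chainCount, Finset.sum_filter, Nat.cast_sum]
    refine Finset.sum_congr rfl fun x _ => ?_
    by_cases hx : grade ℕ x = i
    · simp [hx, hbot x (by omega), and_comm]
    · simp [hx]
  have hf3 : ∀ i j l, 0 < i → i < j → j < l → (flagNumber P {i, j, l} : ℝ) =
      ∑ x : P, ∑ y : P, ∑ z : P, if grade ℕ x = i ∧ grade ℕ y = j ∧ grade ℕ z = l ∧ x < y ∧ y < z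
        then 1 else 0 := by
    intro i j l hi hij hjl
    have := flagNumber_eq_chainCount (P := P) [i, j, l] (by simp; omega) (by simp; omega)
    rw [show ({i, j, l} : Finset ℕ) = [i, j, l].toFinset by simp, this]
    simp only [chainCount, Finset.sum_filter, Nat.cast_sum]
    refine Finset.sum_congr rfl fun x _ => ?_
    by_cases hx : grade ℕ x = i
    · simp only [hx, hbot x (by omega), true_and, and_self, if_true, Nat.cast_sum]
      refine Finset.sum_congr rfl fun y _ => ?_
      by_cases hy : grade ℕ y = j ∧ x < y
      · simp [hy, and_comm]
      · rw [and_comm] at hy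
        rw [if_neg hy, Nat.cast_zero]
        exact (Finset.sum_eq_zero fun z _ => if_neg (by tauto)).symm
    · simp [hx]
  have hf4 : (flagNumber P {1, 3, 5, 6} : ℝ) = ∑ a : P, ∑ x : P, ∑ y : P, ∑ z : P,
      if grade ℕ a = 1 ∧ grade ℕ x = 3 ∧ grade ℕ y = 5 ∧ grade ℕ z = 6 ∧ a < x ∧ x < y ∧ y < z
        then 1 else 0 := by
    have := flagNumber_eq_chainCount (P := P) [1, 3, 5, 6] (by simp) (by simp)
    rw [show ({1, 3, 5, 6} : Finset ℕ) = [1, 3, 5, 6].toFinset by simp, this]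
    simp only [chainCount, Finset.sum_filter, Nat.cast_sum]
    refine Finset.sum_congr rfl fun a _ => ?_
    by_cases ha : grade ℕ a = 1
    · simp only [ha, hbot a (by omega), true_and, and_self, if_true, Nat.cast_sum]
      refine Finset.sum_congr rfl fun x _ => ?_
      by_cases hx : a < x ∧ grade ℕ x = 3
      · rw [if_pos hx, Nat.cast_sum]
        refine Finset.sum_congr rfl fun y _ => ?_
        by_cases hy : x < y ∧ grade ℕ y = 5
        · simp [hx, hy, and_comm]
        · rw [if_neg hy, Nat.cast_zero]
          exact (Finset.sum_eq_zero fun z _ => if_neg (by tauto)).symm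
      · rw [if_neg hx, Nat.cast_zero]
        exact (Finset.sum_eq_zero fun y _ => Finset.sum_eq_zero fun z _ => if_neg (by tauto)).symm
    · simp [ha]
  -- From here on every flag number is written, after multiplication by a power of `r`, as a sum
  -- over the same quadruples, with selected elements in the missing places.
  have h135 : r * (flagNumber P {1, 3, 5} : ℝ) = ∑ a : P, ∑ x : P, ∑ y : P, ∑ z : P,
      if (grade ℕ a = 1 ∧ grade ℕ x = 3 ∧ grade ℕ y = 5 ∧ a < x ∧ x < y) ∧ z ∈ R 6 y ⊤
        then 1 else 0 := by
    rw [hf3 1 3 5 (by norm_num) (by norm_num) (by norm_num)]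
    simp only [Finset.mul_sum]
    refine Finset.sum_congr rfl fun a _ => Finset.sum_congr rfl fun x _ =>
      Finset.sum_congr rfl fun y _ => mul_ite_eq_sum fun hQ =>
        hcard 6 y ⊤ (htop y (by omega)) (by omega) (by omega)
  have h356 : r * (flagNumber P {3, 5, 6} : ℝ) = ∑ a : P, ∑ x : P, ∑ y : P, ∑ z : P,
      if (grade ℕ x = 3 ∧ grade ℕ y = 5 ∧ grade ℕ z = 6 ∧ x < y ∧ y < z) ∧ a ∈ R 1 ⊥ x
        then 1 else 0 := by
    rw [hf3 3 5 6 (by norm_num) (by norm_num) (by norm_num), ← sum_rotate]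
    simp only [Finset.mul_sum]
    refine Finset.sum_congr rfl fun x _ => Finset.sum_congr rfl fun y _ =>
      Finset.sum_congr rfl fun z _ => mul_ite_eq_sum fun hQ =>
        hcard 1 ⊥ x (hbot x (by omega)) (by simp) (by omega)
  have h15 : r * (r * (flagNumber P {1, 5} : ℝ)) = ∑ a : P, ∑ x : P, ∑ y : P, ∑ z : P,
      if ((grade ℕ a = 1 ∧ grade ℕ y = 5 ∧ a < y) ∧ x ∈ R 3 a y) ∧ z ∈ R 6 y ⊤
        then 1 else 0 := by
    rw [hf2 1 5 (by norm_num) (by norm_num)]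
    simp only [Finset.mul_sum]
    refine Finset.sum_congr rfl fun a _ => ?_
    rw [Finset.sum_comm]
    refine Finset.sum_congr rfl fun y _ => ?_
    rw [mul_ite_eq_sum fun hQ => hcard 3 a y hQ.2.2 (by omega) (by omega), Finset.mul_sum]
    exact Finset.sum_congr rfl fun x _ => mul_ite_eq_sum fun hQ =>
        hcard 6 y ⊤ (htop y (by omega)) (by omega) (by omega)
  -- Here `x` is selected first, in `(a, z)`, and then `y` in `(x, z)`. So the interval used for `x`
  -- ends at `z`, while it ends at `y` in the term for `{1, 5}`.
  have h16 : r * (r * (flagNumber P {1, 6} : ℝ)) = ∑ a : P, ∑ x : P, ∑ y : P, ∑ z : P,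
      if ((grade ℕ a = 1 ∧ grade ℕ z = 6 ∧ a < z) ∧ x ∈ R 3 a z) ∧ y ∈ R 5 x z
        then 1 else 0 := by
    rw [hf2 1 6 (by norm_num) (by norm_num)]
    simp only [Finset.mul_sum]
    refine Finset.sum_congr rfl fun a _ => ?_
    rw [Finset.sum_congr rfl fun x _ => Finset.sum_comm, Finset.sum_comm]
    refine Finset.sum_congr rfl fun z _ => ?_
    rw [mul_ite_eq_sum fun hQ => hcard 3 a z hQ.2.2 (by omega) (by omega), Finset.mul_sum]
    refine Finset.sum_congr rfl fun x _ => mul_ite_eq_sum fun hQ => ?_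
    have := hmem _ _ _ _ hQ.2
    exact hcard 5 x z this.2.1 (by omega) (by omega)
  have h35 : r * (r * (flagNumber P {3, 5} : ℝ)) = ∑ a : P, ∑ x : P, ∑ y : P, ∑ z : P,
      if ((grade ℕ x = 3 ∧ grade ℕ y = 5 ∧ x < y) ∧ z ∈ R 6 y ⊤) ∧ a ∈ R 1 ⊥ x
        then 1 else 0 := by
    rw [hf2 3 5 (by norm_num) (by norm_num), ← sum_rotate]
    simp only [Finset.mul_sum]
    refine Finset.sum_congr rfl fun x _ => Finset.sum_congr rfl fun y _ => ?_
    rw [mul_ite_eq_sum fun hQ => hcard 6 y ⊤ (htop y (by omega)) (by omega) (by omega),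
      Finset.mul_sum]
    exact Finset.sum_congr rfl fun z _ => mul_ite_eq_sum fun hQ =>
      hcard 1 ⊥ x (hbot x (by omega)) (by simp) (by omega)
  have h36 : r * (r * (flagNumber P {3, 6} : ℝ)) = ∑ a : P, ∑ x : P, ∑ y : P, ∑ z : P,
      if ((grade ℕ x = 3 ∧ grade ℕ z = 6 ∧ x < z) ∧ y ∈ R 5 x z) ∧ a ∈ R 1 ⊥ x
        then 1 else 0 := by
    rw [hf2 3 6 (by norm_num) (by norm_num), ← sum_rotate]
    simp only [Finset.mul_sum]
    refine Finset.sum_congr rfl fun x _ => ?_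
    rw [Finset.sum_comm]
    refine Finset.sum_congr rfl fun z _ => ?_
    rw [mul_ite_eq_sum fun hQ => hcard 5 x z hQ.2.2 (by omega) (by omega), Finset.mul_sum]
    exact Finset.sum_congr rfl fun y _ => mul_ite_eq_sum fun hQ =>
      hcard 1 ⊥ x (hbot x (by omega)) (by simp) (by omega)
  have h3 : r * (r * (r * (flagNumber P {3} : ℝ))) = ∑ a : P, ∑ x : P, ∑ y : P, ∑ z : P,
      if ((grade ℕ x = 3 ∧ y ∈ R 5 x ⊤) ∧ z ∈ R 6 y ⊤) ∧ a ∈ R 1 ⊥ x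
        then 1 else 0 := by
    rw [hf1 3 (by norm_num), ← sum_rotate]
    simp only [Finset.mul_sum]
    refine Finset.sum_congr rfl fun x _ => ?_
    rw [mul_ite_eq_sum fun hQ => hcard 5 x ⊤ (htop x (by omega)) (by omega) (by omega),
      Finset.mul_sum, Finset.mul_sum]
    refine Finset.sum_congr rfl fun y _ => ?_
    rw [mul_ite_eq_sum (t := R 6 y ⊤), Finset.mul_sum]
    · exact Finset.sum_congr rfl fun z _ => mul_ite_eq_sum fun hQ =>
        hcard 1 ⊥ x (hbot x (by omega)) (by simp) (by omega)
    · intro hQ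
      have := hmem _ _ _ _ hQ.2
      exact hcard 6 y ⊤ this.2.1 (by omega) (by omega)
  have key : 0 ≤ (flagNumber P {1, 3, 5, 6} : ℝ) - r * flagNumber P {1, 3, 5}
      - r * flagNumber P {3, 5, 6} + r * (r * flagNumber P {1, 5})
      - r * (r * flagNumber P {1, 6}) + r * (r * flagNumber P {3, 5})
      + r * (r * flagNumber P {3, 6}) - r * (r * (r * flagNumber P {3})) := by
    rw [hf4, h135, h356, h15, h16, h35, h36, h3]
    simp only [← Finset.sum_sub_distrib, ← Finset.sum_add_distrib]
    refine Finset.sum_nonneg fun a _ => Finset.sum_nonneg fun x _ => Finset.sum_nonneg fun y _ =>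
      Finset.sum_nonneg fun z _ => ?_
    by_cases hΩ : grade ℕ a = 1 ∧ grade ℕ x = 3 ∧ grade ℕ y = 5 ∧ grade ℕ z = 6 ∧ a < x ∧ x < y ∧
      y < z
    · obtain ⟨h1, h2, h3, h4, h5, h6, h7⟩ := hΩ
      have e1 : x ∈ R 3 a z → x ∈ R 3 a y := fun h => hmono _ _ _ _ _ h h6 h7.le
      have e2 : y ∈ R 5 x ⊤ → y ∈ R 5 x z := fun h => hmono _ _ _ _ _ h h7 le_top
      simp only [h1, h2, h3, h4, h5, h6, h7, h5.trans h6, h6.trans h7, (h5.trans h6).trans h7,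
        true_and, and_self, if_true]
      by_cases c1 : a ∈ R 1 ⊥ x <;> by_cases c2 : z ∈ R 6 y ⊤ <;> by_cases c3 : x ∈ R 3 a y <;>
        by_cases c4 : y ∈ R 5 x z <;> by_cases c5 : x ∈ R 3 a z <;> by_cases c6 : y ∈ R 5 x ⊤ <;>
        first
        | exact absurd (e1 c5) c3
        | exact absurd (e2 c6) c4
        | simp [c1, c2, c3, c4, c5, c6]
    -- Away from the chains of ranks 1, 3, 5, 6 every term is zero, since membership in a selection
    -- forces the missing rank and order conditions.
    · rw [if_neg hΩ, if_neg, if_neg, if_neg, if_neg, if_neg, if_neg, if_neg]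
      · norm_num
      all_goals
        intro hh
        apply hΩ
      · have := hmem _ _ _ _ hh.2
        have := hmem _ _ _ _ hh.1.2
        have := hmem _ _ _ _ hh.1.1.2
        tauto
      · have := hmem _ _ _ _ hh.2
        have := hmem _ _ _ _ hh.1.2
        tauto
      · have := hmem _ _ _ _ hh.2
        have := hmem _ _ _ _ hh.1.2
        tauto
      · have := hmem _ _ _ _ hh.2
        have := hmem _ _ _ _ hh.1.2
        tauto
      · have := hmem _ _ _ _ hh.2
        have := hmem _ _ _ _ hh.1.2
        tauto
      · have := hmem _ _ _ _ hh.2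
        tauto
      · have := hmem _ _ _ _ hh.2
        tauto
  -- The common factor `r ^ 3` brings the exponents to `7 - |S|`.
  calc (0 : ℝ) ≤ (r : ℝ) ^ 3 * _ := mul_nonneg (by positivity) key
    _ = _ := by ring

/-! ### The generalized Dehn–Sommerville relations -/

section

variable {P : Type*} [PartialOrder P] [Fintype P] [GradeMinOrder ℕ P]

theorem chainCount_cons_cast (i : ℕ) (R : List ℕ) (x : P) [DecidablePred fun z : P =>
    x < z ∧ grade ℕ z = i] :
    (chainCount P (i :: R) x : ℝ) = ∑ z with x < z ∧ grade ℕ z = i, (chainCount P R z : ℝ) := by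
  rw [chainCount, Nat.cast_sum]
  exact Finset.sum_congr (by ext z; simp) fun _ _ => rfl

/-- Appending the rank of `⊤` lets the last gap of a rank set end at an entry of the list, like
every other gap. -/
theorem chainCount_append_top [OrderTop P] (R : List ℕ) (x : P) (hx : grade ℕ x < grade ℕ (⊤ : P))
    (hR : ∀ i ∈ R, i < grade ℕ (⊤ : P)) :
    chainCount P (R ++ [grade ℕ (⊤ : P)]) x = chainCount P R x := by
  classical
  induction R generalizing x with
  | nil =>
    simp only [List.nil_append, chainCount, Finset.sum_const, smul_eq_mul, mul_one]
    rw [Finset.card_eq_one]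
    refine ⟨⊤, ?_⟩
    ext z
    simp only [Finset.mem_filter, Finset.mem_univ, true_and, Finset.mem_singleton]
    constructor
    · rintro ⟨_, h⟩
      by_contra hz
      exact absurd (grade_strictMono (𝕆 := ℕ) (lt_top_iff_ne_top.2 hz))
        (by rw [h]; exact lt_irrefl _)
    · rintro rfl
      exact ⟨lt_top_iff_ne_top.2 (by rintro rfl; exact lt_irrefl _ hx), rfl⟩
  | cons i R ih =>
    rw [List.cons_append, chainCount, chainCount]
    refine Finset.sum_congr rfl fun z hz => ih z ?_ fun j hj => hR j (List.mem_cons_of_mem _ hj)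
    rw [(Finset.mem_filter.1 hz).2.2]
    exact hR i List.mem_cons_self

/-- For each `w > x` of rank `q`, the elements of intermediate rank below `w` fill the open interval
`(x, w)`, where the Euler relation applies; the number of chains above `w` is a common factor. -/
theorem EulerRel.sum_chainCount {κ : ℝ} (h : EulerRel κ P) (q : ℕ) (R : List ℕ) (x : P) :
    ∑ j ∈ Finset.Ioo (grade ℕ x) q, (-1 : ℝ) ^ j * chainCount P (j :: q :: R) x =
      -κ * ((-1) ^ grade ℕ x + (-1) ^ q) * chainCount P (q :: R) x := by
  classical
  simp_rw [chainCount_cons_cast, Finset.mul_sum, Finset.sum_filter]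
  have h1 : ∀ j ∈ Finset.Ioo (grade ℕ x) q, ∀ z : P,
      (if x < z ∧ grade ℕ z = j then ∑ w : P, if z < w ∧ grade ℕ w = q then
        (-1 : ℝ) ^ j * chainCount P R w else 0 else 0) =
      ∑ w : P, if grade ℕ z = j ∧ (x < z ∧ z < w ∧ grade ℕ w = q) then
        (-1 : ℝ) ^ grade ℕ z * chainCount P R w else 0 := by
    intro j _ z
    by_cases hz : x < z ∧ grade ℕ z = j
    · simp [hz]
    · rw [if_neg hz]
      exact (Finset.sum_eq_zero fun w _ => if_neg (by tauto)).symm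
  rw [Finset.sum_congr rfl fun j hj => Finset.sum_congr rfl fun z _ => h1 j hj z]
  rw [Finset.sum_comm]
  simp_rw [Finset.sum_comm (s := Finset.Ioo (grade ℕ x) q)]
  rw [Finset.sum_comm]
  refine Finset.sum_congr rfl fun w _ => ?_
  by_cases hw : x < w ∧ grade ℕ w = q
  · rw [if_pos hw, ← hw.2, ← h x w hw.1, Finset.sum_mul, Finset.sum_filter]
    refine Finset.sum_congr (Finset.ext fun _ => by simp) fun z _ => ?_
    by_cases hz : x < z ∧ z < w
    · rw [if_pos hz, Finset.sum_eq_single (grade ℕ z)]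
      · simp [hz]
      · intro j _ hj
        exact if_neg fun h => hj h.1.symm
      · intro hj
        exact absurd (Finset.mem_Ioo.2 ⟨grade_strictMono hz.1, grade_strictMono hz.2⟩) hj
    · rw [if_neg hz]
      exact Finset.sum_eq_zero fun j _ => if_neg (by tauto)
  · rw [if_neg hw]
    refine Finset.sum_eq_zero fun z _ => Finset.sum_eq_zero fun j _ => if_neg ?_
    rintro ⟨_, h1, h2, h3⟩
    exact hw ⟨h1.trans h2, h3⟩

/-- A linear relation that holds above every element of rank `p` survives prefixing a common lower
part, since that part is merely summed over. -/
theorem chainCount_append_linear {ι : Type*} (s : Finset ι) (c : ι → ℝ) (M : ι → List ℕ) (d : ℝ)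
    (M' : List ℕ) (p : ℕ) (h : ∀ y : P, grade ℕ y = p → ∑ j ∈ s, c j * chainCount P (M j) y =
      d * chainCount P M' y) (A : List ℕ) (x : P) :
    ∑ j ∈ s, c j * chainCount P (A ++ p :: M j) x = d * chainCount P (A ++ p :: M') x := by
  classical
  induction A generalizing x with
  | nil =>
    simp_rw [List.nil_append, chainCount_cons_cast, Finset.mul_sum]
    rw [Finset.sum_comm]
    exact Finset.sum_congr rfl fun y hy => h y (Finset.mem_filter.1 hy).2.2
  | cons i A ih =>
    simp_rw [List.cons_append, chainCount_cons_cast, Finset.mul_sum]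
    rw [Finset.sum_comm]
    exact Finset.sum_congr rfl fun y hy => ih y

end

theorem exists_sorted_list (T : Finset ℕ) : ∃ L : List ℕ, L.Pairwise (· < ·) ∧ L.toFinset = T :=
  ⟨T.sort (· ≤ ·), T.sortedLT_sort.pairwise, by simp⟩

/-- The relations satisfied by the numbers `f_T / (2k)^|T|` of a `k`-Eulerian poset of
rank `n + 1`. -/
def GapRel (n : ℕ) (g : Finset ℕ → ℝ) : Prop :=
  ∀ T ⊆ Finset.Icc 1 n, ∀ p q : ℕ, p < q → (p = 0 ∨ p ∈ T) → (q = n + 1 ∨ q ∈ T) →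
    Disjoint T (Finset.Ioo p q) →
    ∑ j ∈ Finset.Ioo p q, (-1 : ℝ) ^ j * g (insert j T) = -(1 / 2) * ((-1) ^ p + (-1) ^ q) * g T

/-- The sorted rank set is cut at the gap into `L`, ending at `p`, and a list starting at `q`. The
Euler relation is applied above the elements of rank `p`, or above `⊥` when `p = 0`. -/
theorem EulerRel.gapRel {P : Type*} [PartialOrder P] [BoundedOrder P] [Fintype P]
    [GradeMinOrder ℕ P] {n : ℕ} (hP : grade ℕ (⊤ : P) = n + 1) {r : ℝ} (hr : r ≠ 0)
    (h : EulerRel (r / 2) P) : GapRel n fun T => (flagNumber P T : ℝ) / r ^ T.card := by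
  intro T hT p q hpq hp hq hd
  have hfl : ∀ R : List ℕ, R.Pairwise (· < ·) → (∀ i ∈ R, 0 < i) → (∀ i ∈ R, i < n + 1) →
      flagNumber P R.toFinset = chainCount P (R ++ [n + 1]) ⊥ := by
    intro R h1 h2 h3
    rw [flagNumber_eq_chainCount R h1 h2, ← hP, chainCount_append_top]
    · simp [hP]
    · simpa [hP] using h3
  have hT' : ∀ i ∈ T, 0 < i ∧ i < n + 1 := fun i hi => by
    have := Finset.mem_Icc.1 (hT hi); omega
  have hmain : ∀ L M M' : List ℕ, (L = [] ∧ p = 0 ∨ ∃ A, L = A ++ [p]) → (M ++ [n + 1] = q :: M') →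
      ∑ j ∈ Finset.Ioo p q, (-1 : ℝ) ^ j * chainCount P (L ++ j :: (M ++ [n + 1])) ⊥ =
        -(r / 2) * ((-1) ^ p + (-1) ^ q) * chainCount P (L ++ (M ++ [n + 1])) ⊥ := by
    rintro L M M' (⟨rfl, rfl⟩ | ⟨A, rfl⟩) hM
    · rw [hM]
      simpa using h.sum_chainCount q M' ⊥
    · simp only [List.append_assoc, List.singleton_append]
      refine chainCount_append_linear _ _ _ _ _ p (fun y hy => ?_) A ⊥
      rw [hM, ← hy]
      exact h.sum_chainCount q M' y
  obtain ⟨L, hL, hLT, hLp⟩ : ∃ L : List ℕ, L.Pairwise (· < ·) ∧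
      L.toFinset = T.filter (· ≤ p) ∧ (L = [] ∧ p = 0 ∨ ∃ A, L = A ++ [p]) := by
    by_cases hpT : p ∈ T
    · obtain ⟨A, hA, hA'⟩ := exists_sorted_list (T.filter (· < p))
      refine ⟨A ++ [p], ?_, ?_, Or.inr ⟨A, rfl⟩⟩
      · rw [List.pairwise_append]
        refine ⟨hA, by simp, fun i hi j hj => ?_⟩
        have : i ∈ A.toFinset := by simpa using hi
        rw [hA', Finset.mem_filter] at this
        simp only [List.mem_singleton] at hj
        omega
      · ext i
        rw [List.toFinset_append, hA']
        simp only [Finset.mem_union, Finset.mem_filter, List.mem_toFinset, List.mem_singleton]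
        constructor
        · rintro (h | rfl)
          · exact ⟨h.1, h.2.le⟩
          · exact ⟨hpT, le_rfl⟩
        · rintro ⟨h1, h2⟩
          rcases h2.lt_or_eq with h3 | h3
          · exact Or.inl ⟨h1, h3⟩
          · exact Or.inr h3
    · obtain rfl : p = 0 := by tauto
      refine ⟨[], by simp, ?_, Or.inl ⟨rfl, rfl⟩⟩
      ext i
      simp only [List.toFinset_nil, Finset.notMem_empty, Finset.mem_filter, false_iff]
      rintro ⟨h1, h2⟩
      have := hT' i h1
      omega
  obtain ⟨M, M', hM, hMT, hMq⟩ : ∃ M M' : List ℕ, M.Pairwise (· < ·) ∧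
      M.toFinset = T.filter (q ≤ ·) ∧ M ++ [n + 1] = q :: M' := by
    by_cases hqT : q ∈ T
    · obtain ⟨A, hA, hA'⟩ := exists_sorted_list (T.filter (q < ·))
      refine ⟨q :: A, A ++ [n + 1], ?_, ?_, by simp⟩
      · rw [List.pairwise_cons]
        refine ⟨fun i hi => ?_, hA⟩
        have : i ∈ A.toFinset := by simpa using hi
        rw [hA', Finset.mem_filter] at this
        exact this.2
      · ext i
        rw [List.toFinset_cons, hA']
        simp only [Finset.mem_insert, Finset.mem_filter]
        constructor
        · rintro (rfl | h)
          · exact ⟨hqT, le_rfl⟩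
          · exact ⟨h.1, h.2.le⟩
        · rintro ⟨h1, h2⟩
          rcases h2.lt_or_eq with h3 | h3
          · exact Or.inr ⟨h1, h3⟩
          · exact Or.inl h3.symm
    · obtain rfl : q = n + 1 := by tauto
      refine ⟨[], [], by simp, ?_, by simp⟩
      ext i
      simp only [List.toFinset_nil, Finset.notMem_empty, Finset.mem_filter, false_iff]
      rintro ⟨h1, h2⟩
      have := hT' i h1
      omega
  have hLm : ∀ i, i ∈ L ↔ i ∈ T ∧ i ≤ p := fun i => by rw [← List.mem_toFinset, hLT,
      Finset.mem_filter]
  have hMm : ∀ i, i ∈ M ↔ i ∈ T ∧ q ≤ i := fun i => by rw [← List.mem_toFinset, hMT,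
      Finset.mem_filter]
  have hsplit : ∀ i ∈ T, i ≤ p ∨ q ≤ i := by
    intro i hi
    by_contra hcon
    exact Finset.disjoint_left.1 hd hi (Finset.mem_Ioo.2 (by omega))
  have e0 : (L ++ M).toFinset = T := by
    ext i
    simp only [List.mem_toFinset, List.mem_append, hLm, hMm]
    constructor
    · tauto
    · intro hi
      rcases hsplit i hi with h | h <;> tauto
  have f0 : flagNumber P T = chainCount P (L ++ (M ++ [n + 1])) ⊥ := by
    rw [← e0, hfl, List.append_assoc]
    · rw [List.pairwise_append]
      refine ⟨hL, hM, fun i hi j hj => ?_⟩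
      rw [hLm] at hi
      rw [hMm] at hj
      omega
    · intro i hi
      exact (hT' i (e0 ▸ List.mem_toFinset.2 hi)).1
    · intro i hi
      exact (hT' i (e0 ▸ List.mem_toFinset.2 hi)).2
  have f1 : ∀ j ∈ Finset.Ioo p q,
      flagNumber P (insert j T) = chainCount P (L ++ j :: (M ++ [n + 1])) ⊥ := by
    intro j hj
    rw [Finset.mem_Ioo] at hj
    have hjn : 0 < j ∧ j < n + 1 := by
      refine ⟨by omega, ?_⟩
      rcases hq with rfl | hq
      · exact hj.2
      · exact hj.2.trans (hT' q hq).2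
    have e1 : (L ++ j :: M).toFinset = insert j T := by
      rw [← e0]; ext i; simp
    have hall : ∀ i ∈ L ++ j :: M, 0 < i ∧ i < n + 1 := by
      intro i hi
      have h1 : i ∈ insert j T := e1 ▸ List.mem_toFinset.2 hi
      rcases Finset.mem_insert.1 h1 with rfl | h1
      · exact hjn
      · exact hT' i h1
    rw [← e1, hfl, List.append_assoc, List.cons_append]
    · rw [List.pairwise_append, List.pairwise_cons]
      refine ⟨hL, ⟨fun i hi => ?_, hM⟩, fun i hi k hk => ?_⟩
      · rw [hMm] at hi
        omega
      · rw [hLm] at hi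
        rcases List.mem_cons.1 hk with rfl | hk
        · omega
        · rw [hMm] at hk
          omega
    · exact fun i hi => (hall i hi).1
    · exact fun i hi => (hall i hi).2
  have h3 := hmain L M M' hLp hMq
  rw [← f0, Finset.sum_congr rfl fun j hj => by rw [← f1 j hj]] at h3
  have hjT : ∀ j ∈ Finset.Ioo p q, (insert j T).card = T.card + 1 := fun j hj =>
    Finset.card_insert_of_notMem fun hjT => Finset.disjoint_left.1 hd hjT hj
  beta_reduce
  rw [Finset.sum_congr rfl fun j hj => by rw [hjT j hj]]
  -- Inserting `j` adds one factor `r` to the denominator, which turns the constant `r / 2` into `1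
  -- / 2`.
  have h4 : ∑ j ∈ Finset.Ioo p q, (-1 : ℝ) ^ j * (↑(flagNumber P (insert j T)) / r ^ (T.card + 1)) =
      (∑ j ∈ Finset.Ioo p q, (-1 : ℝ) ^ j * ↑(flagNumber P (insert j T))) / r ^ (T.card + 1) := by
    rw [Finset.sum_div]
    exact Finset.sum_congr rfl fun j _ => by ring
  rw [h4, h3, pow_succ]
  field_simp

/-- Elements of `T` inside `(p, q)` cut it into gaps. At a cut `t` the term `(-1)^t g(T)`
compensates the two halves `-(1/2)(-1)^t` contributed by the adjacent gaps. -/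
theorem GapRel.sum_sdiff {n : ℕ} {g : Finset ℕ → ℝ} (h : GapRel n g) {T : Finset ℕ}
    (hT : T ⊆ Finset.Icc 1 n) (p q : ℕ) (hpq : p < q) (hp : p = 0 ∨ p ∈ T)
    (hq : q = n + 1 ∨ q ∈ T) :
    ∑ j ∈ Finset.Ioo p q, (-1 : ℝ) ^ j * g (insert j T) = -(1 / 2) * ((-1) ^ p + (-1) ^ q) * g T :=
        by
  induction hd : q - p using Nat.strong_induction_on generalizing p q with
  | _ d ih =>
    by_cases hdis : Disjoint T (Finset.Ioo p q)
    · exact h T hT p q hpq hp hq hdis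
    · obtain ⟨t, ht, htI⟩ := Finset.not_disjoint_iff.1 hdis
      rw [Finset.mem_Ioo] at htI
      have h1 := ih (t - p) (by omega) p t htI.1 hp (Or.inr ht) rfl
      have h2 := ih (q - t) (by omega) t q htI.2 (Or.inr ht) hq rfl
      have h3 : Finset.Ioo p q = insert t (Finset.Ioo p t ∪ Finset.Ioo t q) := by
        ext i; simp only [Finset.mem_Ioo, Finset.mem_insert, Finset.mem_union]; omega
      rw [h3, Finset.sum_insert (by simp), Finset.sum_union, h1, h2, Finset.insert_eq_of_mem ht]
      · ring
      · rw [Finset.disjoint_left]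
        intro i hi hi'
        rw [Finset.mem_Ioo] at hi hi'
        omega

/-- The alternating sum defining the flag `L`-vector vanishes at sets with a maximal run of odd
length. -/
theorem GapRel.sum_eq_zero {n : ℕ} {g : Finset ℕ → ℝ} (h : GapRel n g) {S : Finset ℕ} {p q : ℕ}
    (hpq : p < q) (hp : p = 0 ∨ p ∈ Finset.Icc 1 n \ S) (hq : q = n + 1 ∨ q ∈ Finset.Icc 1 n \ S)
    (hS : Finset.Ioo p q ⊆ S) (hev : Even (p + q)) :
    ∑ T ∈ (Finset.Icc 1 n).powerset with Finset.Icc 1 n \ S ⊆ T, (-1) ^ T.card * g T = 0 := by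
  set F := (Finset.Icc 1 n).powerset.filter fun T => Finset.Icc 1 n \ S ⊆ T with hF
  have hpm : (-1 : ℝ) ^ q = (-1) ^ p := by
    have := neg_one_pow_mul_self p
    have h1 : (-1 : ℝ) ^ (p + q) = 1 := hev.neg_one_pow
    rw [pow_add] at h1
    linear_combination (-1) ^ p * h1 - (-1) ^ q * this
  have hIn : Finset.Ioo p q ⊆ Finset.Icc 1 n := by
    intro j hj
    rw [Finset.mem_Ioo] at hj
    rw [Finset.mem_Icc]
    rcases hq with rfl | hq
    · omega
    · have := Finset.mem_Icc.1 (Finset.mem_sdiff.1 hq).1; omega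
  have hmem : ∀ T, T ∈ F ↔ T ⊆ Finset.Icc 1 n ∧ Finset.Icc 1 n \ S ⊆ T := by
    intro T; rw [hF, Finset.mem_filter, Finset.mem_powerset]
  -- Sum the gap relations over all `T` with signs. As `p` and `q` have equal parity, the right-hand
  -- side is a nonzero multiple of the sum in question.
  have h1 : ∑ T ∈ F, (-1 : ℝ) ^ T.card * ∑ j ∈ Finset.Ioo p q, (-1 : ℝ) ^ j * g (insert j T) =
      -(-1) ^ p * ∑ T ∈ F, (-1 : ℝ) ^ T.card * g T := by
    rw [Finset.mul_sum]
    refine Finset.sum_congr rfl fun T hT => ?_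
    rw [hmem] at hT
    rw [h.sum_sdiff hT.1 p q hpq (hp.imp_right fun h => hT.2 h) (hq.imp_right fun h => hT.2 h), hpm]
    ring
  -- The left-hand side cancels in pairs: toggling `j` in `T` changes the sign but not `insert j T`.
  have h2 : ∑ T ∈ F, (-1 : ℝ) ^ T.card * ∑ j ∈ Finset.Ioo p q, (-1 : ℝ) ^ j * g (insert j T) = 0 :=
      by
    simp_rw [Finset.mul_sum]
    rw [Finset.sum_comm]
    refine Finset.sum_eq_zero fun j hj => ?_
    rw [← Finset.sum_filter_add_sum_filter_not F (j ∈ ·)]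
    rw [add_eq_zero_iff_eq_neg, ← Finset.sum_neg_distrib]
    refine Finset.sum_bij' (fun T _ => T.erase j) (fun T _ => insert j T) ?_ ?_ ?_ ?_ ?_
    · intro T hT
      rw [Finset.mem_filter, hmem] at hT
      rw [Finset.mem_filter, hmem]
      refine ⟨⟨(Finset.erase_subset _ _).trans hT.1.1, fun i hi => ?_⟩, by simp⟩
      refine Finset.mem_erase.2 ⟨?_, hT.1.2 hi⟩
      rintro rfl
      exact (Finset.mem_sdiff.1 hi).2 (hS hj)
    · intro T hT
      rw [Finset.mem_filter, hmem] at hT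
      rw [Finset.mem_filter, hmem]
      refine ⟨⟨?_, hT.1.2.trans (Finset.subset_insert _ _)⟩, by simp⟩
      exact Finset.insert_subset (hIn hj) hT.1.1
    · intro T hT
      exact Finset.insert_erase (Finset.mem_filter.1 hT).2
    · intro T hT
      exact Finset.erase_insert (Finset.mem_filter.1 hT).2
    · intro T hT
      have hjT := (Finset.mem_filter.1 hT).2
      rw [Finset.insert_erase hjT, Finset.insert_eq_of_mem hjT, ← Finset.card_erase_add_one hjT,
        pow_succ]
      ring
  rw [h2] at h1
  have h3 : (-1 : ℝ) ^ p ≠ 0 := pow_ne_zero _ (by norm_num)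
  rcases mul_eq_zero.1 h1.symm with h4 | h4
  · exact absurd (neg_eq_zero.1 h4) h3
  · exact h4

/-- The Boolean interval from `U` to `V` is the power set of `V \ U`, shifted by `U`. -/
theorem sum_interval_neg_one_pow {U V : Finset ℕ} (h : U ⊆ V) :
    ∑ T ∈ V.powerset with U ⊆ T, (-1 : ℝ) ^ T.card = if U = V then (-1) ^ U.card else 0 := by
  have h1 : V.powerset.filter (U ⊆ ·) = (V \ U).powerset.image (U ∪ ·) := by
    ext T
    simp only [Finset.mem_filter, Finset.mem_powerset, Finset.mem_image]
    constructor
    · rintro ⟨h1, h2⟩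
      exact ⟨T \ U, Finset.sdiff_subset_sdiff h1 le_rfl, Finset.union_sdiff_of_subset h2⟩
    · rintro ⟨W, hW, rfl⟩
      exact ⟨Finset.union_subset h (hW.trans Finset.sdiff_subset), Finset.subset_union_left⟩
  have hdis : ∀ W ∈ (V \ U).powerset, Disjoint U W := fun W hW =>
    Finset.disjoint_sdiff.mono_right (Finset.mem_powerset.1 hW)
  rw [h1, Finset.sum_image]
  · rw [Finset.sum_congr rfl fun W hW => by
      rw [Finset.card_union_of_disjoint (hdis W hW), pow_add], ← Finset.mul_sum]
    have h2 := Finset.sum_powerset_neg_one_pow_card (x := V \ U)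
    have h3 : ∑ W ∈ (V \ U).powerset, (-1 : ℝ) ^ W.card = if V \ U = ∅ then 1 else 0 := by
      exact_mod_cast h2
    rw [h3]
    by_cases hUV : U = V
    · simp [hUV]
    · rw [if_neg hUV, if_neg, mul_zero]
      exact fun h4 => hUV (h.antisymm (Finset.sdiff_eq_empty_iff_subset.1 h4))
  · intro W hW W' hW' he
    have h4 : U ∪ W = U ∪ W' := he
    rw [← Finset.union_sdiff_cancel_left (hdis W hW), h4,
      Finset.union_sdiff_cancel_left (hdis W' hW')]

theorem flagL_eq_sum {P : Type*} [PartialOrder P] [GradeMinOrder ℕ P] {n : ℕ} {k r : ℝ}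
    (hk : 2 * k = r) (S : Finset ℕ) :
    flagL k n P S = (-1) ^ (n - S.card) *
      ∑ T ∈ (Finset.Icc 1 n).powerset with Finset.Icc 1 n \ S ⊆ T,
        (-1) ^ T.card * ((flagNumber P T : ℝ) / r ^ T.card) := by
  rw [flagL, hk]
  congr 1
  refine Finset.sum_congr rfl fun T _ => ?_
  rw [neg_pow, one_div, inv_pow]
  ring

/-- The flag numbers in terms of the flag `L`-vector. -/
theorem flagNumber_eq_sum_flagL {P : Type*} [PartialOrder P] [GradeMinOrder ℕ P] {n : ℕ} {k r : ℝ}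
    (hk : 2 * k = r) (hr : r ≠ 0) {U : Finset ℕ} (hU : U ⊆ Finset.Icc 1 n) :
    (flagNumber P U : ℝ) = r ^ U.card * ∑ S ∈ (Finset.Icc 1 n).powerset with Disjoint S U,
      flagL k n P S := by
  have hsum : ∑ S ∈ (Finset.Icc 1 n).powerset with Disjoint S U, flagL k n P S =
      (flagNumber P U : ℝ) / r ^ U.card := by
    simp_rw [flagL_eq_sum hk]
    have h1 : ∀ S ∈ (Finset.Icc 1 n).powerset.filter (Disjoint · U),
        (-1 : ℝ) ^ (n - S.card) * ∑ T ∈ (Finset.Icc 1 n).powerset with Finset.Icc 1 n \ S ⊆ T,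
          (-1) ^ T.card * ((flagNumber P T : ℝ) / r ^ T.card) =
        ∑ T ∈ (Finset.Icc 1 n).powerset with U ⊆ T, if Finset.Icc 1 n \ S ⊆ T then
          (-1 : ℝ) ^ (Finset.Icc 1 n \ S).card * ((-1) ^ T.card * ((flagNumber P T : ℝ) / r ^
              T.card))
          else 0 := by
      intro S hS
      simp only [Finset.mem_filter, Finset.mem_powerset] at hS
      rw [← Finset.sum_filter, Finset.filter_filter, ← Finset.mul_sum,
        Finset.card_sdiff_of_subset hS.1, Nat.card_Icc, Nat.add_sub_cancel]
      congr 1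
      refine Finset.sum_congr ?_ fun _ _ => rfl
      ext T
      simp only [Finset.mem_filter, Finset.mem_powerset]
      refine and_congr_right fun _ => ⟨fun h => ⟨?_, h⟩, And.right⟩
      exact fun i hi => h (Finset.mem_sdiff.2 ⟨hU hi, fun h' => Finset.disjoint_left.1 hS.2 h' hi⟩)
    rw [Finset.sum_congr rfl h1, Finset.sum_comm]
    have h2 : ∀ T ∈ (Finset.Icc 1 n).powerset.filter (U ⊆ ·),
        ∑ S ∈ (Finset.Icc 1 n).powerset with Disjoint S U, (if Finset.Icc 1 n \ S ⊆ T then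
          (-1 : ℝ) ^ (Finset.Icc 1 n \ S).card * ((-1) ^ T.card * ((flagNumber P T : ℝ) / r ^
              T.card))
          else 0) =
        if U = T then (flagNumber P T : ℝ) / r ^ T.card else 0 := by
      intro T hT
      simp only [Finset.mem_filter, Finset.mem_powerset] at hT
      rw [← Finset.sum_filter, Finset.filter_filter, ← Finset.sum_mul]
      -- Möbius inversion: complementation turns the sum over `S` into one over the Boolean interval
      -- from `U` to `T`, which vanishes unless `T = U`.
      have h3 : ∑ S ∈ (Finset.Icc 1 n).powerset with Disjoint S U ∧ Finset.Icc 1 n \ S ⊆ T,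
          (-1 : ℝ) ^ (Finset.Icc 1 n \ S).card = ∑ V ∈ T.powerset with U ⊆ V, (-1 : ℝ) ^ V.card :=
              by
        refine Finset.sum_bij' (fun S _ => Finset.Icc 1 n \ S) (fun V _ => Finset.Icc 1 n \ V)
          ?_ ?_ ?_ ?_ fun _ _ => rfl
        · intro S hS
          simp only [Finset.mem_filter, Finset.mem_powerset] at hS ⊢
          exact ⟨hS.2.2, fun i hi => Finset.mem_sdiff.2 ⟨hU hi, fun h' =>
            Finset.disjoint_left.1 hS.2.1 h' hi⟩⟩
        · intro V hV
          simp only [Finset.mem_filter, Finset.mem_powerset] at hV ⊢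
          refine ⟨Finset.sdiff_subset, Finset.sdiff_disjoint.mono_right hV.2, ?_⟩
          rw [Finset.sdiff_sdiff_eq_self (hV.1.trans hT.1)]
          exact hV.1
        · intro S hS
          simp only [Finset.mem_filter, Finset.mem_powerset] at hS
          exact Finset.sdiff_sdiff_eq_self hS.1
        · intro V hV
          simp only [Finset.mem_filter, Finset.mem_powerset] at hV
          exact Finset.sdiff_sdiff_eq_self (hV.1.trans hT.1)
      rw [h3, sum_interval_neg_one_pow hT.2]
      by_cases hUT : U = T
      · rw [if_pos hUT, if_pos hUT, ← mul_assoc, hUT, neg_one_pow_mul_self, one_mul]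
      · rw [if_neg hUT, if_neg hUT, zero_mul]
    rw [Finset.sum_congr rfl h2, Finset.sum_ite_eq, if_pos]
    simp [hU]
  rw [hsum]
  field_simp

theorem EulerRel.flagL_eq_zero {P : Type*} [PartialOrder P] [BoundedOrder P] [Fintype P]
    [GradeMinOrder ℕ P] {n : ℕ} (hP : grade ℕ (⊤ : P) = n + 1) {k : ℝ} (hk : k ≠ 0)
    (h : EulerRel k P) {S : Finset ℕ} {p q : ℕ}
    (hpq : p < q) (hp : p = 0 ∨ p ∈ Finset.Icc 1 n \ S) (hq : q = n + 1 ∨ q ∈ Finset.Icc 1 n \ S)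
    (hS : Finset.Ioo p q ⊆ S) (hev : Even (p + q)) : flagL k n P S = 0 := by
  have h1 : EulerRel (2 * k / 2) P := by rwa [mul_div_cancel_left₀ _ two_ne_zero]
  rw [flagL_eq_sum rfl, (h1.gapRel hP (by positivity)).sum_eq_zero hpq hp hq hS hev, mul_zero]

/-- The subsets of `[1,7]` all of whose maximal runs have even length. -/
def evenSets7 : Finset (Finset ℕ) :=
  {∅, {1, 2}, {2, 3}, {3, 4}, {4, 5}, {5, 6}, {6, 7}, {1, 2, 3, 4}, {1, 2, 4, 5}, {1, 2, 5, 6},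
    {1, 2, 6, 7}, {2, 3, 4, 5}, {2, 3, 5, 6}, {2, 3, 6, 7}, {3, 4, 5, 6}, {3, 4, 6, 7},
    {4, 5, 6, 7}, {1, 2, 3, 4, 5, 6}, {1, 2, 3, 4, 6, 7}, {1, 2, 4, 5, 6, 7}, {2, 3, 4, 5, 6, 7}}

/-- Suitable `p` and `q` are the neighbours of a maximal run of odd length, with 0 and 8 as
sentinels. All 128 subsets are checked. -/
theorem mem_evenSets7_or : ∀ S ∈ (Finset.Icc 1 7).powerset, S ∈ evenSets7 ∨
    ∃ p ∈ Finset.range 9, ∃ q ∈ Finset.range 9, p < q ∧ (p = 0 ∨ p ∈ Finset.Icc 1 7 \ S) ∧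
      (q = 8 ∨ q ∈ Finset.Icc 1 7 \ S) ∧ Finset.Ioo p q ⊆ S ∧ (p + q) % 2 = 0 := by
  decide +kernel

/-- After inversion only the 21 sets with even runs contribute. This gives the upper bound 21 for
the dimension of the cone. -/
theorem EulerRel.flagNumber_eq_sum_evenSets {P : Type*} [PartialOrder P] [BoundedOrder P]
    [Fintype P]
    [GradeMinOrder ℕ P] (hP : grade ℕ (⊤ : P) = 8) {k : ℝ} (hk : k ≠ 0)
    (h : EulerRel k P) {U : Finset ℕ} (hU : U ⊆ Finset.Icc 1 7) :
    (flagNumber P U : ℝ) = ∑ S ∈ evenSets7, flagL k 7 P S *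
      ((2 * k) ^ U.card * if Disjoint S U then 1 else 0) := by
  rw [flagNumber_eq_sum_flagL (k := k) rfl (by positivity) hU, Finset.mul_sum, Finset.sum_filter]
  have hsub : evenSets7 ⊆ (Finset.Icc 1 7).powerset := by decide +kernel
  rw [← Finset.sum_subset hsub]
  · refine Finset.sum_congr rfl fun S _ => ?_
    split_ifs <;> ring
  · intro S hS hS'
    obtain ⟨p, _, q, _, h1, h2, h3, h4, h5⟩ := (mem_evenSets7_or S hS).resolve_left hS'
    rw [h.flagL_eq_zero hP hk h1 h2 h3 h4 (Nat.even_iff.2 h5), mul_zero, ite_self]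

theorem sum_evenSets7 {M : Type*} [AddCommMonoid M] (f : Finset ℕ → M) :
    ∑ S ∈ evenSets7, f S = (([∅, {1, 2}, {2, 3}, {3, 4}, {4, 5}, {5, 6}, {6, 7}, {1, 2, 3, 4},
      {1, 2, 4, 5}, {1, 2, 5, 6}, {1, 2, 6, 7}, {2, 3, 4, 5}, {2, 3, 5, 6}, {2, 3, 6, 7},
      {3, 4, 5, 6}, {3, 4, 6, 7}, {4, 5, 6, 7}, {1, 2, 3, 4, 5, 6}, {1, 2, 3, 4, 6, 7},
      {1, 2, 4, 5, 6, 7}, {2, 3, 4, 5, 6, 7}] : List (Finset ℕ)).map f).sum := by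
  rw [← List.sum_toFinset]
  · congr 1
  · decide +kernel

/-- Both sides are linear in the 21 surviving values of `flagL`, so the identity is a comparison of
coefficients. -/
theorem EulerRel.rank8_eq_neg_rank8L {P : Type*} [PartialOrder P] [BoundedOrder P] [Fintype P]
    [GradeMinOrder ℕ P] (hP : grade ℕ (⊤ : P) = 8) {k : ℝ} (hk : k ≠ 0)
    (h : EulerRel k P) :
    (2 * k) ^ 3 * (flagNumber P {1, 3, 5, 6} : ℝ) - (2 * k) ^ 4 * flagNumber P {1, 3, 5}
      - (2 * k) ^ 4 * flagNumber P {3, 5, 6} + (2 * k) ^ 5 * flagNumber P {1, 5}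
      - (2 * k) ^ 5 * flagNumber P {1, 6} + (2 * k) ^ 5 * flagNumber P {3, 5}
      + (2 * k) ^ 5 * flagNumber P {3, 6} - (2 * k) ^ 6 * flagNumber P {3}
      = -((2 * k) ^ 7 * rank8L k P) := by
  have hf := fun {U : Finset ℕ} (hU : U ⊆ Finset.Icc 1 7) => h.flagNumber_eq_sum_evenSets hP hk hU
  rw [hf (U := {1, 3, 5, 6}) (by decide), hf (U := {1, 3, 5}) (by decide),
    hf (U := {3, 5, 6}) (by decide), hf (U := {1, 5}) (by decide), hf (U := {1, 6}) (by decide),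
    hf (U := {3, 5}) (by decide), hf (U := {3, 6}) (by decide), hf (U := {3}) (by decide)]
  simp only [sum_evenSets7, List.map_cons, List.map_nil, List.sum_cons, List.sum_nil, rank8L]
  simp +decide only [if_true, if_false]
  norm_num
  ring

/-! ### Posets of labelled types -/

/-- Combinatorial data describing a poset: a graded poset of types, each type `τ` having a finite
set `A τ` of letters. The elements of the poset are the types with a label below `s l` attached to
each of their letters `l`, and `x < y` if the types are so related and the labels of common letters
agree. -/
structure TypePoset (T Λ : Type) where
  rk : T → ℕ
  lt : T → T → Prop
  A : T → Finset Λ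
  s : Λ → ℕ
  bot : T
  top : T
  s_pos : ∀ l, 0 < s l
  rk_lt : ∀ σ τ, lt σ τ → rk σ < rk τ
  trans : ∀ σ τ υ, lt σ τ → lt τ υ → lt σ υ
  contig : ∀ σ τ υ l, lt σ τ → lt τ υ → l ∈ A σ → l ∈ A υ → l ∈ A τ
  graded : ∀ σ τ, lt σ τ → rk σ + 1 < rk τ → ∃ ρ, lt σ ρ ∧ lt ρ τ ∧ rk ρ = rk σ + 1
  rk_bot : rk bot = 0
  bot_lt : ∀ τ, τ ≠ bot → lt bot τ
  lt_top : ∀ τ, τ ≠ top → lt τ top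
  A_bot : A bot = ∅
  A_top : A top = ∅

namespace TypePoset

variable {T Λ : Type} (X : TypePoset T Λ)

/-- The elements of the poset described by `X`. -/
@[ext] structure Elt where
  ty : T
  label : Λ → ℕ
  label_lt : ∀ l, l ∈ X.A ty → label l < X.s l
  label_eq_zero : ∀ l, l ∉ X.A ty → label l = 0

variable {X}

instance : LT X.Elt := ⟨fun x y => X.lt x.ty y.ty ∧ ∀ l, l ∈ X.A x.ty → l ∈ X.A y.ty →
  x.label l = y.label l⟩

theorem Elt.lt_trans {x y z : X.Elt} (h : x < y) (h' : y < z) : x < z := by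
  refine ⟨X.trans _ _ _ h.1 h'.1, fun l h1 h2 => ?_⟩
  have h3 := X.contig _ _ _ l h.1 h'.1 h1 h2
  exact (h.2 l h1 h3).trans (h'.2 l h3 h2)

theorem Elt.lt_irrefl (x : X.Elt) : ¬ x < x := fun h => Nat.lt_irrefl _ (X.rk_lt _ _ h.1)

instance : PartialOrder X.Elt where
  le x y := x = y ∨ x < y
  lt x y := x < y
  le_refl x := Or.inl rfl
  le_trans x y z := by
    rintro (rfl | h) (rfl | h')
    · exact Or.inl rfl
    · exact Or.inr h'
    · exact Or.inr h
    · exact Or.inr (Elt.lt_trans h h')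
  lt_iff_le_not_ge x y := by
    constructor
    · intro h
      refine ⟨Or.inr h, ?_⟩
      rintro (rfl | h')
      · exact Elt.lt_irrefl _ h
      · exact Elt.lt_irrefl _ (Elt.lt_trans h h')
    · rintro ⟨rfl | h, h'⟩
      · exact absurd (Or.inl rfl) h'
      · exact h
  le_antisymm x y := by
    rintro (rfl | h) (h' | h')
    · rfl
    · rfl
    · exact h'.symm
    · exact absurd (Elt.lt_trans h h') (Elt.lt_irrefl _)

theorem Elt.eq_of_ty {x y : X.Elt} (h : x.ty = y.ty) (h0 : X.A x.ty = ∅) : x = y := by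
  ext l
  · exact h
  · rw [x.label_eq_zero l (by simp [h0]), y.label_eq_zero l (by simp [← h, h0])]

instance : BoundedOrder X.Elt where
  bot := ⟨X.bot, fun _ => 0, fun l _ => X.s_pos l, fun _ _ => rfl⟩
  top := ⟨X.top, fun _ => 0, fun l _ => X.s_pos l, fun _ _ => rfl⟩
  bot_le x := by
    by_cases h : x.ty = X.bot
    · exact Or.inl (Elt.eq_of_ty h.symm X.A_bot)
    · exact Or.inr ⟨X.bot_lt _ h, fun l hl => absurd hl (by simp [X.A_bot])⟩
  le_top x := by
    by_cases h : x.ty = X.top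
    · exact Or.inl (Elt.eq_of_ty h (h ▸ X.A_top))
    · exact Or.inr ⟨X.lt_top _ h, fun l _ hl => absurd hl (by simp [X.A_top])⟩

theorem Elt.bot_ty : (⊥ : X.Elt).ty = X.bot := rfl

theorem Elt.top_ty : (⊤ : X.Elt).ty = X.top := rfl

-- Letters shared with `x` or `y` keep the labels they have there, and new letters get the label 0.
-- Hence intermediate types lift to intermediate elements, and gradedness passes from types to
-- elements.
open Classical in
theorem Elt.exists_between {x y : X.Elt} (h : x < y) {ρ : T} (h1 : X.lt x.ty ρ)
    (h2 : X.lt ρ y.ty) : ∃ z : X.Elt, z.ty = ρ ∧ x < z ∧ z < y := by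
  refine ⟨⟨ρ, fun l => if l ∈ X.A ρ then if l ∈ X.A x.ty then x.label l else if l ∈ X.A y.ty then
    y.label l else 0 else 0, ?_, ?_⟩, rfl, ⟨h1, ?_⟩, ⟨h2, ?_⟩⟩
  · intro l hl
    rw [if_pos hl]
    split_ifs with h3 h4
    · exact x.label_lt l h3
    · exact y.label_lt l h4
    · exact X.s_pos l
  · intro l hl
    rw [if_neg hl]
  · intro l hl hl'
    simp only
    rw [if_pos hl', if_pos hl]
  · intro l hl hl'
    simp only
    rw [if_pos hl, if_pos hl']
    split_ifs with h3
    · exact h.2 l h3 hl'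
    · rfl

instance : GradeMinOrder ℕ X.Elt where
  grade x := X.rk x.ty
  grade_strictMono x y h := X.rk_lt _ _ h.1
  covBy_grade x y h := by
    rw [Nat.covBy_iff_add_one_eq]
    by_contra hne
    have h1 := X.rk_lt _ _ h.1.1
    obtain ⟨ρ, h2, h3, _⟩ := X.graded _ _ h.1.1 (by omega)
    obtain ⟨z, _, hz, hz'⟩ := Elt.exists_between h.1 h2 h3
    exact h.2 hz hz'
  isMin_grade x h := by
    have h1 : x = ⊥ := isMin_iff_eq_bot.1 h
    subst h1
    rw [Elt.bot_ty, X.rk_bot]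
    exact isMin_bot

theorem Elt.grade_eq (x : X.Elt) : grade ℕ x = X.rk x.ty := rfl

section

variable [Fintype Λ] [DecidableEq Λ]

/-- The possible labellings of a type. -/
def box (X : TypePoset T Λ) (τ : T) : Finset (Λ → ℕ) :=
  Fintype.piFinset fun l => if l ∈ X.A τ then Finset.range (X.s l) else {0}

theorem mem_box {τ : T} {c : Λ → ℕ} : c ∈ X.box τ ↔
    (∀ l, l ∈ X.A τ → c l < X.s l) ∧ ∀ l, l ∉ X.A τ → c l = 0 := by
  rw [box, Fintype.mem_piFinset, ← forall_and]
  refine forall_congr' fun l => ?_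
  by_cases h : l ∈ X.A τ <;> simp [h]

/-- Elements as pairs of a type and a labelling. -/
def eltEquiv (X : TypePoset T Λ) : X.Elt ≃ Σ τ : T, X.box τ where
  toFun x := ⟨x.ty, x.label, mem_box.2 ⟨x.label_lt, x.label_eq_zero⟩⟩
  invFun p := ⟨p.1, p.2.1, (mem_box.1 p.2.2).1, (mem_box.1 p.2.2).2⟩
  left_inv _ := rfl
  right_inv _ := rfl

noncomputable instance [Fintype T] : Fintype X.Elt := Fintype.ofEquiv _ X.eltEquiv.symm

/-- Labels of letters in `B` are prescribed, the remaining ones are free. -/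
theorem card_box_filter (τ : T) (B : Finset Λ) (d : Λ → ℕ)
    (hd : ∀ l, l ∈ X.A τ → l ∈ B → d l < X.s l) :
    ((X.box τ).filter fun c => ∀ l, l ∈ X.A τ → l ∈ B → c l = d l).card =
      ∏ l ∈ X.A τ \ B, X.s l := by
  have h1 : ((X.box τ).filter fun c => ∀ l, l ∈ X.A τ → l ∈ B → c l = d l) =
      Fintype.piFinset fun l => if l ∈ X.A τ then if l ∈ B then {d l} else Finset.range (X.s l)
        else {0} := by
    ext c
    rw [Finset.mem_filter, box, Fintype.mem_piFinset, Fintype.mem_piFinset, ← forall_and]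
    refine forall_congr' fun l => ?_
    by_cases h : l ∈ X.A τ <;> by_cases h' : l ∈ B
    · simp only [h, h', if_true, Finset.mem_range, Finset.mem_singleton, forall_const]
      exact ⟨And.right, fun h2 => ⟨h2 ▸ hd l h h', h2⟩⟩
    all_goals simp [h, h']
  rw [h1, Fintype.card_piFinset, ← Finset.prod_subset (Finset.subset_univ (X.A τ \ B))]
  · refine Finset.prod_congr rfl fun l hl => ?_
    rw [Finset.mem_sdiff] at hl
    simp [hl.1, hl.2]
  · intro l _ hl
    rw [Finset.mem_sdiff] at hl
    by_cases h : l ∈ X.A τ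
    · have : l ∈ B := by tauto
      simp [h, this]
    · simp [h]

variable [Fintype T]

open Classical in
/-- Summation over the elements by type. -/
theorem sum_elt {M : Type*} [AddCommMonoid M] (f : X.Elt → Prop) (g : T → M) (m : T → ℕ)
    (q : T → Prop) (hm : ∀ τ, q τ → ∃ (B : Finset Λ) (d : Λ → ℕ), (m τ = ∏ l ∈ X.A τ \ B, X.s l) ∧
      (∀ l, l ∈ X.A τ → l ∈ B → d l < X.s l) ∧
      ∀ z : X.Elt, z.ty = τ → (f z ↔ ∀ l, l ∈ X.A τ → l ∈ B → z.label l = d l))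
    (hf : ∀ z : X.Elt, f z → q z.ty) :
    ∑ z with f z, g z.ty = ∑ τ with q τ, m τ • g τ := by
  rw [Finset.sum_filter, ← Equiv.sum_comp X.eltEquiv.symm, Fintype.sum_sigma, Finset.sum_filter]
  refine Finset.sum_congr rfl fun τ _ => ?_
  by_cases hq : q τ
  · rw [if_pos hq]
    obtain ⟨B, d, h1, h2, h3⟩ := hm τ hq
    rw [h1, ← card_box_filter τ B d h2, ← Finset.sum_const, Finset.sum_filter,
      ← Finset.sum_coe_sort (X.box τ)]
    refine Finset.sum_congr rfl fun c _ => ?_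
    exact if_congr (h3 (X.eltEquiv.symm ⟨τ, c⟩) rfl) rfl rfl
  · rw [if_neg hq]
    exact Finset.sum_eq_zero fun c _ => if_neg fun h => hq (hf _ h)

-- An element of type `τ` between `x` and `y` has its labels forced on the letters of either end and
-- free on the others; where both ends prescribe a label they agree because `x < y`. So the Euler
-- relations only involve types.
open Classical in
theorem eulerRel (h : ∀ σ υ, X.lt σ υ → ∑ τ with X.lt σ τ ∧ X.lt τ υ,
    (∏ l ∈ X.A τ \ (X.A σ ∪ X.A υ), (X.s l : ℝ)) * (-1) ^ X.rk τ =
      -(1 / 2) * ((-1) ^ X.rk σ + (-1) ^ X.rk υ)) : EulerRel (1 / 2) X.Elt := by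
  intro x y hxy
  have h1 := h x.ty y.ty hxy.1
  rw [Elt.grade_eq, Elt.grade_eq, ← h1]
  have h5 := (sum_elt (fun z => x < z ∧ z < y) (fun τ => (-1 : ℝ) ^ X.rk τ)
    (fun τ => ∏ l ∈ X.A τ \ (X.A x.ty ∪ X.A y.ty), X.s l)
    (fun τ => X.lt x.ty τ ∧ X.lt τ y.ty) ?_ fun z hz => ⟨hz.1.1, hz.2.1⟩)
  · refine (Finset.sum_congr (Finset.ext fun z => ?_) fun _ _ => rfl).trans
      (h5.trans (Finset.sum_congr (Finset.ext fun z => ?_) fun τ _ => ?_))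
    · simp
    · simp
    · rw [nsmul_eq_mul, Nat.cast_prod]
  rintro τ ⟨h2, h3⟩
  refine ⟨X.A x.ty ∪ X.A y.ty, fun l => if l ∈ X.A x.ty then x.label l else y.label l, rfl, ?_, ?_⟩
  · intro l _ hl
    beta_reduce
    split_ifs with h4
    · exact x.label_lt l h4
    · exact y.label_lt l (by simpa [h4] using hl)
  · rintro z rfl
    constructor
    · rintro ⟨h4, h5⟩ l hl hl'
      beta_reduce
      split_ifs with h6
      · exact (h4.2 l h6 hl).symm
      · exact h5.2 l hl (by simpa [h6] using hl')
    · intro h4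
      refine ⟨⟨h2, fun l hl hl' => ?_⟩, ⟨h3, fun l hl hl' => ?_⟩⟩
      · rw [h4 l hl' (Finset.mem_union_left _ hl)]
        beta_reduce
        rw [if_pos hl]
      · rw [h4 l hl (Finset.mem_union_right _ hl')]
        beta_reduce
        split_ifs with h6
        · exact hxy.2 l h6 hl'
        · rfl

open Classical in
/-- The number of chains with prescribed ranks above an element of a given type. -/
noncomputable def typeCount (X : TypePoset T Λ) : List ℕ → T → ℕ
  | [], _ => 1
  | i :: R, σ => ∑ τ with X.lt σ τ ∧ X.rk τ = i, (∏ l ∈ X.A τ \ X.A σ, X.s l) * typeCount X R τ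

/-- Only the letters of the next type that are absent from the current one have free labels, so the
count depends on `x` through its type alone. -/
theorem chainCount_eq_typeCount (R : List ℕ) (x : X.Elt) :
    chainCount X.Elt R x = X.typeCount R x.ty := by
  classical
  induction R generalizing x with
  | nil => rw [chainCount, typeCount]
  | cons i R ih =>
    rw [chainCount, typeCount]
    simp_rw [ih]
    have h3 := sum_elt (fun z => x < z ∧ grade ℕ z = i) (fun τ => X.typeCount R τ)
      (fun τ => ∏ l ∈ X.A τ \ X.A x.ty, X.s l)
      (fun τ => X.lt x.ty τ ∧ X.rk τ = i) ?_ fun z hz => ⟨hz.1.1, hz.2⟩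
    · simp_rw [smul_eq_mul] at h3
      refine (Finset.sum_congr (Finset.ext fun z => ?_) fun _ _ => rfl).trans
        (h3.trans (Finset.sum_congr (Finset.ext fun z => ?_) fun _ _ => rfl))
      · simp
      · simp
    rintro τ ⟨h1, h2⟩
    refine ⟨X.A x.ty, x.label, rfl, fun l _ hl => x.label_lt l hl, ?_⟩
    rintro z rfl
    exact ⟨fun h l hl hl' => (h.1.2 l hl' hl).symm,
      fun h => ⟨⟨h1, fun l hl hl' => (h l hl' hl).symm⟩, h2⟩⟩

end

end TypePoset

/-- All ranks in `R` are below that of `⊤`, so each member of a chain can be replaced by any of its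
`r` copies. -/
theorem chainCount_thicken {P : Type*} [PartialOrder P] [BoundedOrder P] [Fintype P]
    [GradeMinOrder ℕ P] {r : ℕ} [NeZero r] (R : List ℕ)
    (h1 : ∀ i ∈ R, i < grade ℕ (⊤ : P)) (x : Thicken P r) :
    chainCount (Thicken P r) R x = r ^ R.length * chainCount P R x.elt := by
  classical
  induction R generalizing x with
  | nil => simp [chainCount]
  | cons i R ih =>
    rw [chainCount, chainCount]
    simp_rw [ih fun j hj => h1 j (List.mem_cons_of_mem _ hj)]
    have h2 := Thicken.sum_filter (r := r) (fun z => x.elt < z ∧ grade ℕ z = i) (fun z hz => by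
      refine ⟨(bot_le.trans_lt hz.1).ne', ?_⟩
      rintro rfl
      exact (h1 i List.mem_cons_self).ne hz.2.symm)
      (fun z => r ^ R.length * chainCount P R z)
    rw [← Finset.mul_sum, ← Finset.mul_sum, smul_eq_mul, ← mul_assoc, ← pow_succ'] at h2
    rw [← Finset.mul_sum, List.length_cons]
    refine (congrArg _ (Finset.sum_congr (Finset.ext fun z => ?_) fun _ _ => rfl)).trans
      (h2.trans (congrArg _ (Finset.sum_congr (Finset.ext fun z => ?_) fun _ _ => rfl)))
    · simp [Thicken.lt_iff, Thicken.grade_elt]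
    · simp

namespace TypePoset

variable {T Λ : Type} [Fintype T] [Fintype Λ] [DecidableEq Λ] {X : TypePoset T Λ}

/-- Thickening turns the parameter `1/2` into `r/2` and scales `f_S` by `r^|S|`, so each
construction is needed only in the half-Eulerian case. -/
theorem mem_kEulerianFlagVectors {n : ℕ} (hX : X.rk X.top = n + 1) (h : EulerRel (1 / 2) X.Elt)
    {r : ℕ} (hr : r ≠ 0) : (fun S : RankSet n => (r : ℝ) ^ (S : Finset ℕ).card *
      (X.typeCount ((S : Finset ℕ).sort (· ≤ ·)) X.bot : ℝ)) ∈
        kEulerianFlagVectors ((r : ℝ) / 2) n := by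
  have : NeZero r := ⟨hr⟩
  have hr' : (r : ℝ) ≠ 0 := by exact_mod_cast hr
  refine ⟨Thicken X.Elt r, inferInstance, inferInstance, inferInstance, inferInstance, hX, ?_, ?_⟩
  · rw [isKEulerian_iff_eulerRel (by positivity), eulerRel_thicken]
    convert h using 1
    field_simp
  · funext S
    have hS : ∀ i ∈ (S : Finset ℕ).sort (· ≤ ·), 0 < i ∧ i < n + 1 := by
      intro i hi
      have h1 : i ∈ (S : Finset ℕ) := by simpa using hi
      have h2 := Finset.mem_Icc.1 (Finset.mem_powerset.1 S.2 h1)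
      omega
    have h1 := flagNumber_eq_chainCount (P := Thicken X.Elt r) ((S : Finset ℕ).sort (· ≤ ·))
      (S : Finset ℕ).sortedLT_sort.pairwise fun i hi => (hS i hi).1
    rw [Finset.sort_toFinset,
      chainCount_thicken _ (fun i hi => by rw [Elt.grade_eq, Elt.top_ty, hX]; exact (hS i hi).2),
      chainCount_eq_typeCount, Finset.length_sort] at h1
    rw [flagVector, h1]
    push_cast
    rfl

end TypePoset

/-! ### The closed cone -/

theorem evalForm_add_right {n : ℕ} (a : FlagForm n) (x y : FlagVector n) :
    evalForm a (x + y) = evalForm a x + evalForm a y := by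
  simp [evalForm, mul_add, Finset.sum_add_distrib]

theorem evalForm_smul_right {n : ℕ} (a : FlagForm n) (c : ℝ) (x : FlagVector n) :
    evalForm a (c • x) = c * evalForm a x := by
  simp only [evalForm, Pi.smul_apply, smul_eq_mul, Finset.mul_sum]
  exact Finset.sum_congr rfl fun _ _ => by ring

theorem evalForm_zero_right {n : ℕ} (a : FlagForm n) : evalForm a 0 = 0 := by
  simp [evalForm]

theorem evalForm_neg_left {n : ℕ} (a : FlagForm n) (x : FlagVector n) :
    evalForm (-a) x = -evalForm a x := by
  simp [evalForm]

theorem evalForm_add_left {n : ℕ} (a b : FlagForm n) (x : FlagVector n) :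
    evalForm (a + b) x = evalForm a x + evalForm b x := by
  simp [evalForm, add_mul, Finset.sum_add_distrib]

theorem evalForm_smul_left {n : ℕ} (c : ℝ) (a : FlagForm n) (x : FlagVector n) :
    evalForm (c • a) x = c * evalForm a x := by
  simp only [evalForm, Pi.smul_apply, smul_eq_mul, Finset.mul_sum]
  exact Finset.sum_congr rfl fun _ _ => by ring

theorem evalForm_flagForm {n : ℕ} {S : Finset ℕ} (hS : S ⊆ Finset.Icc 1 n) (x : FlagVector n) :
    evalForm (flagForm n S) x = x ⟨S, Finset.mem_powerset.2 hS⟩ := by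
  rw [evalForm, Finset.sum_eq_single ⟨S, Finset.mem_powerset.2 hS⟩]
  · simp [flagForm]
  · intro T _ hT
    rw [flagForm, if_neg, zero_mul]
    exact fun h => hT (Subtype.ext h)
  · simp

theorem continuous_evalForm {n : ℕ} (a : FlagForm n) : Continuous (evalForm a) := by
  unfold evalForm
  fun_prop

theorem evalForm_nonneg_of_mem_closedCone {n : ℕ} {a : FlagForm n} {V : Set (FlagVector n)}
    (h : ∀ x ∈ V, 0 ≤ evalForm a x) {x : FlagVector n} (hx : x ∈ closedCone V) :
    0 ≤ evalForm a x := by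
  have h1 : (PointedCone.hull ℝ V : Set (FlagVector n)) ⊆ {x | 0 ≤ evalForm a x} := by
    intro y hy
    refine Submodule.span_induction (p := fun y _ => 0 ≤ evalForm a y) h ?_ ?_ ?_ hy
    · rw [evalForm_zero_right]
    · intro x y _ _ hx hy
      rw [evalForm_add_right]
      exact add_nonneg hx hy
    · intro c x _ hx
      have : c • x = (c : ℝ) • x := rfl
      rw [this, evalForm_smul_right]
      exact mul_nonneg c.2 hx
  have h2 : IsClosed {x : FlagVector n | 0 ≤ evalForm a x} :=
    isClosed_le continuous_const (continuous_evalForm a)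
  have h3 : x ∈ closure (PointedCone.hull ℝ V : Set (FlagVector n)) := hx
  exact closure_minimal h1 h2 h3

theorem evalForm_eq_zero_of_mem_closedCone {n : ℕ} {a : FlagForm n} {V : Set (FlagVector n)}
    (h : ∀ x ∈ V, evalForm a x = 0) {x : FlagVector n} (hx : x ∈ closedCone V) :
    evalForm a x = 0 := by
  refine le_antisymm ?_ (evalForm_nonneg_of_mem_closedCone (fun x hx => (h x hx).ge) hx)
  have := evalForm_nonneg_of_mem_closedCone (a := -a) (V := V)
    (fun x hx => by rw [evalForm_neg_left, h x hx, neg_zero]) hx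
  rw [evalForm_neg_left] at this
  linarith

/-- Membership in `V` is required for positive `N` only, because the label sets in the constructions
below must be nonempty. -/
theorem mem_closedCone_of_tendsto {n : ℕ} {V : Set (FlagVector n)} {f : ℕ → FlagVector n}
    {c : ℕ → ℝ} {v : FlagVector n} (hf : ∀ N, 0 < N → f N ∈ V) (hc : ∀ N, 0 ≤ c N)
    (h : Filter.Tendsto (fun N => c N • f N) Filter.atTop (nhds v)) : v ∈ closedCone V := by
  refine mem_closure_of_tendsto h ?_
  filter_upwards [Filter.eventually_gt_atTop 0] with N hN
  have : c N • f N = (⟨c N, hc N⟩ : {c : ℝ // 0 ≤ c}) • f N := rfl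
  rw [this]
  exact Submodule.smul_mem _ _ (Submodule.subset_span (hf N hN))

/-! ### Even interval systems -/

/-- A system of intervals `[a,b] ⊆ [1,n]`, each given by the pair `(a,b)`, is even if any two of
its members (equal or not) meet in an even number of points. -/
def IsEvenSystem (n : ℕ) (I : Finset (ℕ × ℕ)) : Prop :=
  (∀ p ∈ I, 1 ≤ p.1 ∧ p.2 ≤ n) ∧
    ∀ p ∈ I, ∀ q ∈ I, Even (Finset.Icc (max p.1 q.1) (min p.2 q.2)).card

/-- `S` meets all members of the system. -/
def Blocks (I : Finset (ℕ × ℕ)) (S : Finset ℕ) : Prop := ∀ p ∈ I, ∃ i ∈ S, p.1 ≤ i ∧ i ≤ p.2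

instance (I : Finset (ℕ × ℕ)) (S : Finset ℕ) : Decidable (Blocks I S) :=
  inferInstanceAs (Decidable (∀ p ∈ I, ∃ i ∈ S, p.1 ≤ i ∧ i ≤ p.2))

/-- The limit vector of an even system. -/
noncomputable def systemVector (r : ℝ) (n : ℕ) (I : Finset (ℕ × ℕ)) : FlagVector n :=
  fun S => r ^ (S : Finset ℕ).card * if Blocks I S then 1 else 0

theorem sum_Icc_neg_one_pow {c d : ℕ} (h : Even (Finset.Icc c d).card) :
    ∑ i ∈ Finset.Icc c d, (-1 : ℝ) ^ i = 0 := by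
  rw [Nat.card_Icc] at h
  obtain ⟨m, hm⟩ := h
  rcases Nat.lt_or_ge d c with hdc | hcd
  · rw [Finset.Icc_eq_empty (by omega), Finset.sum_empty]
  · induction m generalizing d with
    | zero => omega
    | succ m ih =>
      rcases Nat.eq_zero_or_pos m with rfl | h
      · obtain rfl : d = c + 1 := by omega
        rw [Finset.sum_Icc_succ_top (by omega)]
        simp [pow_succ]
      · obtain ⟨e, rfl⟩ : ∃ e, d = e + 2 := ⟨d - 2, by omega⟩
        rw [Finset.sum_Icc_succ_top (by omega), Finset.sum_Icc_succ_top (by omega),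
          ih (by omega) (by omega), pow_succ _ (e + 1)]
        ring

theorem sum_Ioo_neg_one_pow {a b : ℕ} (h : a < b) :
    ∑ i ∈ Finset.Ioo a b, (-1 : ℝ) ^ i = -(1 / 2) * ((-1) ^ a + (-1) ^ b) := by
  induction b, h using Nat.le_induction with
  | base =>
    have : Finset.Ioo a (a + 1) = ∅ := by ext i; simp
    rw [Nat.succ_eq_add_one, this, Finset.sum_empty, pow_succ]; ring
  | succ b hb ih =>
    have : Finset.Ioo a (b + 1) = insert b (Finset.Ioo a b) := by
      ext i; simp only [Finset.mem_Ioo, Finset.mem_insert]; omega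
    rw [this, Finset.sum_insert (by simp), ih, pow_succ]
    ring

/-- The intersection of a nonempty subfamily is the intersection of two of its members. -/
theorem exists_inter_eq {J : Finset (ℕ × ℕ)} (hJ : J.Nonempty) : ∃ p ∈ J, ∃ q ∈ J, ∀ i : ℕ,
    (∀ s ∈ J, s.1 ≤ i ∧ i ≤ s.2) ↔ i ∈ Finset.Icc (max p.1 q.1) (min p.2 q.2) := by
  obtain ⟨p, hp, hp'⟩ := Finset.exists_max_image J Prod.fst hJ
  obtain ⟨q, hq, hq'⟩ := Finset.exists_min_image J Prod.snd hJ
  refine ⟨p, hp, q, hq, fun i => ?_⟩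
  rw [Finset.mem_Icc]
  constructor
  · intro h
    have := h p hp
    have := h q hq
    omega
  · intro h s hs
    have := hp' s hs
    have := hq' s hs
    omega

/-- Expand the power of `N` as the sum of `(N - 1)^|J|` over sets `J` of intervals containing `i`. A
nonempty `J` contributes the alternating sum over the common intersection of its members; this is
already the intersection of two of them, so it has even size and the sum is 0. The empty set `J`
leaves the alternating sum over `(a, b)`. -/
theorem IsEvenSystem.sum_neg_one_pow {n : ℕ} {I : Finset (ℕ × ℕ)} (h : IsEvenSystem n I) (N : ℝ)
    {a b : ℕ} (hab : a < b) :
    ∑ i ∈ Finset.Ioo a b, N ^ (I.filter fun p => (a < p.1 ∧ p.2 < b) ∧ p.1 ≤ i ∧ i ≤ p.2).card *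
      (-1) ^ i = -(1 / 2) * ((-1) ^ a + (-1) ^ b) := by
  classical
  set B := I.filter fun p => a < p.1 ∧ p.2 < b with hB
  have h1 : ∀ i, N ^ (I.filter fun p => (a < p.1 ∧ p.2 < b) ∧ p.1 ≤ i ∧ i ≤ p.2).card =
      ∑ J ∈ B.powerset, (N - 1) ^ J.card * if ∀ p ∈ J, p.1 ≤ i ∧ i ≤ p.2 then 1 else 0 := by
    intro i
    rw [← Finset.filter_filter, ← Finset.prod_const, Finset.prod_filter,
      Finset.prod_congr rfl (g := fun p : ℕ × ℕ => 1 + if p.1 ≤ i ∧ i ≤ p.2 then N - 1 else 0)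
        (fun p _ => by split_ifs <;> ring), Finset.prod_one_add]
    refine Finset.sum_congr rfl fun J _ => ?_
    by_cases hJ : ∀ p ∈ J, p.1 ≤ i ∧ i ≤ p.2
    · rw [if_pos hJ, mul_one, ← Finset.prod_const]
      exact Finset.prod_congr rfl fun p hp => if_pos (hJ p hp)
    · rw [if_neg hJ, mul_zero]
      push Not at hJ
      obtain ⟨p, hp, hp'⟩ := hJ
      exact Finset.prod_eq_zero hp (if_neg fun h => absurd (hp' h.1) (not_lt.2 h.2))
  simp_rw [h1, Finset.sum_mul]
  rw [Finset.sum_comm, Finset.sum_eq_single ∅]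
  · simpa using sum_Ioo_neg_one_pow hab
  · intro J hJ hne
    obtain ⟨p, hp, q, hq, hpq⟩ := exists_inter_eq (Finset.nonempty_iff_ne_empty.2 hne)
    have hJB := Finset.mem_powerset.1 hJ
    have hp' := Finset.mem_filter.1 (hJB hp)
    have hq' := Finset.mem_filter.1 (hJB hq)
    have h2 := sum_Icc_neg_one_pow (h.2 p hp'.1 q hq'.1)
    have h3 : Finset.Icc (max p.1 q.1) (min p.2 q.2) =
        (Finset.Ioo a b).filter fun i => ∀ s ∈ J, s.1 ≤ i ∧ i ≤ s.2 := by
      ext i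
      rw [Finset.mem_filter, hpq i, Finset.mem_Icc, Finset.mem_Ioo]
      omega
    rw [h3, Finset.sum_filter] at h2
    have h4 : ∀ i ∈ Finset.Ioo a b, (N - 1) ^ J.card *
        (if ∀ p ∈ J, p.1 ≤ i ∧ i ≤ p.2 then 1 else 0) * (-1) ^ i =
        (N - 1) ^ J.card * if ∀ p ∈ J, p.1 ≤ i ∧ i ≤ p.2 then (-1 : ℝ) ^ i else 0 := by
      intro i _
      split_ifs <;> ring
    rw [Finset.sum_congr rfl h4, ← Finset.mul_sum, h2, mul_zero]
  · simp

/-- The types of the poset of an even system: one for each rank, with the intervals containing the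
rank as letters. -/
def systemTypes {n : ℕ} {I : Finset (ℕ × ℕ)} (h : IsEvenSystem n I) {N : ℕ} (hN : 0 < N) :
    TypePoset (Fin (n + 2)) I where
  rk i := i
  lt i j := i < j
  A i := Finset.univ.filter fun p => p.1.1 ≤ (i : ℕ) ∧ (i : ℕ) ≤ p.1.2
  s _ := N
  bot := 0
  top := Fin.last _
  s_pos _ := hN
  rk_lt _ _ h := h
  trans _ _ _ h h' := h.trans h'
  contig i j k p hij hjk hi hk := by
    simp only [Finset.mem_filter, Finset.mem_univ, true_and] at hi hk ⊢
    have h1 : (i : ℕ) < j := hij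
    have h2 : (j : ℕ) < k := hjk
    omega
  graded i j hij hr := by
    have h1 : (i : ℕ) + 1 < n + 2 := by omega
    exact ⟨⟨i + 1, h1⟩, Fin.lt_def.2 (by simp), Fin.lt_def.2 hr, rfl⟩
  rk_bot := rfl
  bot_lt i hi := Fin.pos_iff_ne_zero.2 hi
  lt_top i hi := Fin.lt_last_iff_ne_last.2 hi
  A_bot := by
    ext p
    have := h.1 p.1 p.2
    simp
    omega
  A_top := by
    ext p
    have := h.1 p.1 p.2
    simp
    omega

section

variable {n : ℕ} {I : Finset (ℕ × ℕ)} (h : IsEvenSystem n I) {N : ℕ} (hN : 0 < N)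

theorem mem_systemTypes_A (i : Fin (n + 2)) (p : I) :
    p ∈ (systemTypes h hN).A i ↔ p.1.1 ≤ (i : ℕ) ∧ (i : ℕ) ≤ p.1.2 := by
  simp [systemTypes]

theorem card_filter_coe (q : ℕ × ℕ → Prop) [DecidablePred q] [DecidablePred fun p : I => q p.1] :
    (Finset.univ.filter fun p : I => q p.1).card = (I.filter q).card := by
  rw [Finset.card_filter, Finset.card_filter, ← Finset.sum_coe_sort I]
  refine Finset.sum_congr rfl fun _ _ => ?_
  congr

/-- A letter of `τ` that is absent from `σ < τ < υ` at both ends is an interval that contains `τ`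
and lies strictly between `σ` and `υ`. -/
theorem systemTypes_eulerRel : EulerRel (1 / 2) (systemTypes h hN).Elt := by
  classical
  refine TypePoset.eulerRel fun σ υ hσ => ?_
  have hσ' : (σ : ℕ) < υ := hσ
  have hmem : ∀ τ, τ ∈ (Finset.univ.filter fun τ => (systemTypes h hN).lt σ τ ∧
      (systemTypes h hN).lt τ υ) ↔ (σ : ℕ) < τ ∧ (τ : ℕ) < υ := fun τ => by
    rw [Finset.mem_filter]
    exact and_iff_right (Finset.mem_univ _)
  refine Eq.trans ?_ (h.sum_neg_one_pow N hσ')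
  refine Finset.sum_bij' (fun τ _ => (τ : ℕ)) (fun i hi => ⟨i, ?_⟩) ?_ ?_ ?_ ?_ ?_
  · exact (Finset.mem_Ioo.1 hi).2.trans υ.2
  · exact fun τ hτ => Finset.mem_Ioo.2 ((hmem τ).1 hτ)
  · exact fun i hi => (hmem _).2 (Finset.mem_Ioo.1 hi)
  · intro _ _; rfl
  · intro _ _; rfl
  · intro τ hτ
    have hτ' := (hmem τ).1 hτ
    have h1 : ∏ l ∈ (systemTypes h hN).A τ \ ((systemTypes h hN).A σ ∪ (systemTypes h hN).A υ),
        ((systemTypes h hN).s l : ℝ) =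
        N ^ ((systemTypes h hN).A τ \ ((systemTypes h hN).A σ ∪ (systemTypes h hN).A υ)).card :=
      Finset.prod_const (N : ℝ)
    rw [h1, ← card_filter_coe]
    refine congrArg₂ _ (congrArg _ (congrArg _ ?_)) rfl
    ext p
    simp only [Finset.mem_sdiff, Finset.mem_union, mem_systemTypes_A, Finset.mem_filter,
      Finset.mem_univ, true_and]
    have e1 : (systemTypes h hN).rk σ = σ := rfl
    have e2 : (systemTypes h hN).rk υ = υ := rfl
    omega

/-- Each interval met by `R` contributes one free label, chosen at the first rank meeting it, unless
it contains the rank of `σ` and so is labelled already. -/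
theorem systemTypes_typeCount (R : List ℕ) (hR : R.Pairwise (· < ·)) (hn : ∀ i ∈ R, i ≤ n)
    (σ : Fin (n + 2)) (hσ : ∀ i ∈ R, (σ : ℕ) < i) :
    (systemTypes h hN).typeCount R σ =
      N ^ (I.filter fun p => (∃ i ∈ R, p.1 ≤ i ∧ i ≤ p.2) ∧ ¬ (p.1 ≤ (σ : ℕ) ∧ (σ : ℕ) ≤
          p.2)).card := by
  classical
  induction R generalizing σ with
  | nil => simp [TypePoset.typeCount]
  | cons i R ih =>
    have hi := hn i List.mem_cons_self
    have hσi := hσ i List.mem_cons_self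
    obtain ⟨hiR, hR'⟩ := List.pairwise_cons.1 hR
    rw [TypePoset.typeCount, Finset.sum_eq_single ⟨i, by omega⟩]
    · rw [ih hR' (fun j hj => hn j (List.mem_cons_of_mem _ hj)) _ hiR]
      have h1 : ∏ l ∈ (systemTypes h hN).A ⟨i, by omega⟩ \ (systemTypes h hN).A σ,
          (systemTypes h hN).s l = N ^ (I.filter fun p => (p.1 ≤ i ∧ i ≤ p.2) ∧
            ¬ (p.1 ≤ (σ : ℕ) ∧ (σ : ℕ) ≤ p.2)).card := by
        rw [← card_filter_coe, ← Finset.prod_const]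
        refine Finset.prod_congr ?_ fun _ _ => rfl
        ext p
        simp only [Finset.mem_sdiff, mem_systemTypes_A, Finset.mem_filter, Finset.mem_univ,
            true_and]
      rw [h1, ← pow_add, ← Finset.card_union_of_disjoint]
      · congr 2
        ext p
        simp only [Finset.mem_union, Finset.mem_filter, ← and_or_left]
        refine and_congr_right fun _ => ?_
        constructor
        · rintro (⟨h2, h3⟩ | ⟨⟨j, hj, h2⟩, h3⟩)
          · exact ⟨⟨i, List.mem_cons_self, h2⟩, h3⟩
          · refine ⟨⟨j, List.mem_cons_of_mem _ hj, h2⟩, fun h4 => h3 ?_⟩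
            have := hiR j hj
            omega
        · rintro ⟨⟨j, hj, h2⟩, h3⟩
          by_cases h4 : p.1 ≤ i ∧ i ≤ p.2
          · exact Or.inl ⟨h4, h3⟩
          · rcases List.mem_cons.1 hj with rfl | hj
            · exact absurd h2 h4
            · exact Or.inr ⟨⟨j, hj, h2⟩, h4⟩
      · rw [Finset.disjoint_left]
        intro p hp hp'
        exact (Finset.mem_filter.1 hp').2.2 (Finset.mem_filter.1 hp).2.1
    · intro τ hτ hne
      have h2 : (systemTypes h hN).rk τ = i := (Finset.mem_filter.1 hτ).2.2
      exact absurd (Fin.ext h2) hne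
    · intro hcon
      refine absurd (Finset.mem_filter.2 ⟨Finset.mem_univ _, ?_, rfl⟩) hcon
      exact Fin.lt_def.2 hσi

end

/-- With `N` labels per interval, `f_S` is `r^|S|` times `N` to the number of intervals met by `S`.
After division by `N^|I|` only the sets meeting all intervals survive in the limit. -/
theorem IsEvenSystem.systemVector_mem_closedCone {n : ℕ} {I : Finset (ℕ × ℕ)}
    (h : IsEvenSystem n I) {r : ℕ} (hr : r ≠ 0) :
    systemVector r n I ∈ closedCone (kEulerianFlagVectors ((r : ℝ) / 2) n) := by
  classical
  let m : RankSet n → ℕ := fun S => (I.filter fun p => ∃ i ∈ (S : Finset ℕ), p.1 ≤ i ∧ i ≤ p.2).card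
  refine mem_closedCone_of_tendsto (f := fun N S => (r : ℝ) ^ (S : Finset ℕ).card * (N : ℝ) ^ m S)
    (c := fun N => ((N : ℝ) ^ I.card)⁻¹) ?_ (fun N => by positivity) ?_
  · intro N hN
    convert TypePoset.mem_kEulerianFlagVectors (X := systemTypes h hN) (n := n) rfl
      (systemTypes_eulerRel h hN) hr using 2 with S
    have hS : ∀ i ∈ (S : Finset ℕ), 1 ≤ i ∧ i ≤ n := fun i hi =>
      Finset.mem_Icc.1 (Finset.mem_powerset.1 S.2 hi)
    rw [systemTypes_typeCount h hN _ (S : Finset ℕ).sortedLT_sort.pairwise]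
    · push_cast
      congr 2
      refine congrArg Finset.card (Finset.filter_congr fun p hp => ?_)
      have := h.1 p hp
      have h0 : (((systemTypes h hN).bot : Fin (n + 2)) : ℕ) = 0 := rfl
      rw [h0]
      simp
      omega
    · intro i hi
      exact (hS i (by simpa using hi)).2
    · intro i hi
      exact (hS i (by simpa using hi)).1
  · rw [tendsto_pi_nhds]
    intro S
    simp only [Pi.smul_apply, smul_eq_mul, systemVector]
    by_cases hS : Blocks I S
    · have h1 : m S = I.card := congrArg Finset.card (Finset.filter_true_of_mem hS)
      rw [if_pos hS]
      refine tendsto_const_nhds.congr' ?_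
      filter_upwards [Filter.eventually_gt_atTop 0] with N hN
      have : (N : ℝ) ≠ 0 := by positivity
      rw [h1]
      field_simp
    · have h1 : m S < I.card := by
        refine Finset.card_lt_card (Finset.filter_ssubset.2 ?_)
        unfold Blocks at hS
        push Not at hS
        obtain ⟨p, hp, hp'⟩ := hS
        exact ⟨p, hp, by rintro ⟨i, hi, h2, h3⟩; exact absurd (hp' i hi h2) (not_lt.2 h3)⟩
      rw [if_neg hS, mul_zero]
      obtain ⟨d, hd⟩ := Nat.exists_eq_add_of_lt h1
      have h2 : Filter.Tendsto (fun N : ℕ => (r : ℝ) ^ (S : Finset ℕ).card * ((N : ℝ) ^ (d + 1))⁻¹)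
          Filter.atTop (nhds ((r : ℝ) ^ (S : Finset ℕ).card * 0)) := by
        refine Filter.Tendsto.const_mul _ (Filter.Tendsto.inv_tendsto_atTop ?_)
        exact (Filter.tendsto_pow_atTop (by omega)).comp tendsto_natCast_atTop_atTop
      rw [mul_zero] at h2
      refine h2.congr' ?_
      filter_upwards [Filter.eventually_gt_atTop 0] with N hN
      have : (N : ℝ) ≠ 0 := by positivity
      rw [hd, add_assoc, pow_add _ (m S)]
      field_simp

/-! ### Polynomials as coefficient lists -/

/-- The value at `N` of the polynomial with a given list of coefficients. -/
def pEval (N : ℕ) : List ℕ → ℕ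
  | [] => 0
  | a :: p => a + N * pEval N p

/-- The sum of two polynomials. -/
def pAdd : List ℕ → List ℕ → List ℕ
  | [], q => q
  | p, [] => p
  | a :: p, b :: q => (a + b) :: pAdd p q

/-- The product of two polynomials. -/
def pMul : List ℕ → List ℕ → List ℕ
  | [], _ => []
  | a :: p, q => pAdd (q.map (a * ·)) (0 :: pMul p q)

/-- Equality of polynomials, disregarding leading zeros. -/
def pEq : List ℕ → List ℕ → Bool
  | [], q => q.all (· == 0)
  | p, [] => p.all (· == 0)
  | a :: p, b :: q => a == b && pEq p q

theorem pEval_pAdd (N : ℕ) : ∀ p q : List ℕ, pEval N (pAdd p q) = pEval N p + pEval N q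
  | [], q => by simp [pAdd, pEval]
  | a :: p, [] => by simp [pAdd, pEval]
  | a :: p, b :: q => by
    simp only [pAdd, pEval, pEval_pAdd N p q]
    ring

theorem pEval_map (N a : ℕ) : ∀ q : List ℕ, pEval N (q.map (a * ·)) = a * pEval N q
  | [] => rfl
  | b :: q => by
    simp only [List.map_cons, pEval, pEval_map N a q]
    ring

theorem pEval_pMul (N : ℕ) : ∀ p q : List ℕ, pEval N (pMul p q) = pEval N p * pEval N q
  | [], q => by simp [pMul, pEval]
  | a :: p, q => by
    simp only [pMul, pEval, pEval_pAdd, pEval_map, pEval_pMul N p q]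
    ring

theorem pEval_eq_zero (N : ℕ) : ∀ p : List ℕ, p.all (· == 0) = true → pEval N p = 0
  | [], _ => rfl
  | a :: p, h => by
    rw [List.all_cons, Bool.and_eq_true, beq_iff_eq] at h
    simp [pEval, h.1, pEval_eq_zero N p h.2]

theorem pEval_eq_of_pEq (N : ℕ) : ∀ p q : List ℕ, pEq p q = true → pEval N p = pEval N q
  | [], q, h => by
    rw [pEq] at h
    rw [pEval_eq_zero N q h]
    rfl
  | a :: p, [], h => (pEval_eq_zero N (a :: p) h).trans rfl
  | a :: p, b :: q, h => by
    rw [pEq, Bool.and_eq_true, beq_iff_eq] at h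
    simp [pEval, h.1, pEval_eq_of_pEq N p q h.2]

theorem pEval_pos {N : ℕ} (hN : 0 < N) : ∀ p : List ℕ, p.all (· == 0) = false → 0 < pEval N p
  | [], h => by simp at h
  | a :: p, h => by
    rw [List.all_cons, Bool.and_eq_false_iff] at h
    rw [pEval]
    rcases h with h | h
    · have : a ≠ 0 := by simpa using h
      omega
    · have := Nat.mul_pos hN (pEval_pos hN p h)
      omega

theorem tendsto_pEval (D : ℕ) : ∀ p : List ℕ, p.length ≤ D + 1 →
    Filter.Tendsto (fun N : ℕ => (pEval N p : ℝ) * ((N : ℝ) ^ D)⁻¹) Filter.atTop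
      (nhds (p.getD D 0 : ℝ)) := by
  induction D with
  | zero =>
    intro p hp
    match p, hp with
    | [], _ => simp [pEval]
    | [a], _ => simp [pEval]
    | a :: b :: p, hp => simp at hp
  | succ D ih =>
    intro p hp
    match p, hp with
    | [], _ => simp [pEval]
    | a :: p, hp =>
      have h1 := ih p (by simpa using hp)
      have h2 : Filter.Tendsto (fun N : ℕ => (a : ℝ) * ((N : ℝ) ^ (D + 1))⁻¹) Filter.atTop
          (nhds ((a : ℝ) * 0)) := by
        refine Filter.Tendsto.const_mul _ (Filter.Tendsto.inv_tendsto_atTop ?_)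
        exact (Filter.tendsto_pow_atTop (by omega)).comp tendsto_natCast_atTop_atTop
      have h3 := h2.add h1
      rw [mul_zero, zero_add] at h3
      rw [List.getD_cons_succ]
      refine h3.congr' ?_
      filter_upwards [Filter.eventually_gt_atTop 0] with N hN
      have : (N : ℝ) ≠ 0 := by positivity
      rw [pEval, pow_succ]
      push_cast
      field_simp

/-! ### Families of posets with polynomially many labels -/

/-- The data of a type poset with types `0, …, m - 1` and letters `0, …, k - 1`, where the number of
labels of each letter is a polynomial in a parameter. Sets of types or letters are encoded by the
binary digits of natural numbers. -/
structure PolyTypes where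
  m : ℕ
  k : ℕ
  ranks : List ℕ
  letters : List ℕ
  above : List ℕ
  sizes : List (List ℕ)

namespace PolyTypes

variable (X : PolyTypes)

/-- The rank of a type. -/
def rk (i : ℕ) : ℕ := X.ranks.getD i 0

/-- The order relation on types. -/
def lt (i j : ℕ) : Bool := (X.above.getD i 0).testBit j

/-- Whether a letter occurs in a type. -/
def has (i l : ℕ) : Bool := (X.letters.getD i 0).testBit l

/-- The size of a letter. -/
def size (l : ℕ) : List ℕ := X.sizes.getD l []

/-- The product of the sizes of the letters satisfying a condition. -/
def prodSize (q : ℕ → Bool) : List ℕ :=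
  ((List.range X.k).filter q).foldr (fun l p => pMul (X.size l) p) [1]

/-- A sum over the types satisfying a condition. -/
def sumTypes (q : ℕ → Bool) (f : ℕ → List ℕ) : List ℕ :=
  ((List.range X.m).filter q).foldr (fun i p => pAdd (f i) p) []

/-- The axioms of a type poset. -/
def isTypes : Bool :=
  (decide (1 < X.m)) && ((List.range X.k).all fun l => !(X.size l).all (· == 0)) &&
  ((List.range X.m).all fun i =>
    ((i == 0) == (X.rk i == 0)) && (i == 0 || X.lt 0 i) && (i == X.m - 1 || X.lt i (X.m - 1)) &&
    (List.range X.m).all fun j => !X.lt i j || (decide (X.rk i < X.rk j) &&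
      ((List.range X.m).all fun t => !X.lt j t || (X.lt i t &&
        (List.range X.k).all fun l => !(X.has i l && X.has t l) || X.has j l)) &&
      (X.rk i + 1 == X.rk j || (List.range X.m).any fun t => X.lt i t && X.lt t j &&
        X.rk t == X.rk i + 1))) &&
  (List.range X.k).all fun l => !X.has 0 l && !X.has (X.m - 1) l

/-- The Euler relations. -/
def isEuler : Bool :=
  (List.range X.m).all fun i => (List.range X.m).all fun j => !X.lt i j ||
    pEq (X.sumTypes (fun t => X.lt i t && X.lt t j && (X.rk i + X.rk t) % 2 == 1)
        fun t => X.prodSize fun l => X.has t l && !(X.has i l || X.has j l))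
      (pAdd [if (X.rk i + X.rk j) % 2 = 0 then 1 else 0]
        (X.sumTypes (fun t => X.lt i t && X.lt t j && (X.rk i + X.rk t) % 2 == 0)
          fun t => X.prodSize fun l => X.has t l && !(X.has i l || X.has j l)))

/-- The flag numbers as polynomials. -/
def count : List ℕ → ℕ → List ℕ
  | [], _ => [1]
  | i :: R, s => X.sumTypes (fun t => X.lt s t && X.rk t == i) fun t =>
      pMul (X.prodSize fun l => X.has t l && !X.has s l) (count R t)

/-- The flag numbers of rank `n + 1` have degree at most `D`, and their coefficients of degree `D`
are the sums of the coefficients of the sets disjoint from the set of ranks. -/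
def hasLimit (n D : ℕ) (c : List (ℤ × List ℕ)) : Bool :=
  (List.range' 1 n).sublists.all fun S => decide ((X.count S 0).length ≤ D + 1) &&
    (((X.count S 0).getD D 0 : ℕ) : ℤ) ==
      (c.map fun p => if p.2.all (fun u => !S.contains u) then p.1 else 0).sum

theorem pEval_prodSize (N : ℕ) (q : ℕ → Bool) :
    pEval N (X.prodSize q) = ∏ l ∈ Finset.univ.filter (fun l : Fin X.k => q l = true),
        pEval N (X.size l) := by
  have h : ∀ L : List ℕ, pEval N (L.foldr (fun l p => pMul (X.size l) p) [1]) =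
      (L.map fun l => pEval N (X.size l)).prod := by
    intro L
    induction L with
    | nil => simp [pEval]
    | cons a L ih => simp [pEval_pMul, ih]
  rw [prodSize, h, Finset.prod_filter, ← Finset.prod_range fun l => if q l = true then pEval N
      (X.size l) else 1,
    ← Finset.prod_filter, ← List.prod_toFinset _ (List.nodup_range.filter _)]
  refine Finset.prod_congr ?_ fun _ _ => rfl
  ext l
  simp

theorem pEval_sumTypes (N : ℕ) (q : ℕ → Bool) (f : ℕ → List ℕ) :
    pEval N (X.sumTypes q f) = ∑ t ∈ Finset.univ.filter (fun t : Fin X.m => q t = true),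
        pEval N (f t) := by
  have h : ∀ L : List ℕ, pEval N (L.foldr (fun l p => pAdd (f l) p) []) =
      (L.map fun l => pEval N (f l)).sum := by
    intro L
    induction L with
    | nil => simp [pEval]
    | cons a L ih => simp [pEval_pAdd, ih]
  rw [sumTypes, h, Finset.sum_filter, ← Finset.sum_range fun l => if q l = true then pEval N (f l)
      else 0,
    ← Finset.sum_filter, ← List.sum_toFinset _ (List.nodup_range.filter _)]
  refine Finset.sum_congr ?_ fun _ _ => rfl
  ext l
  simp

variable {X}

theorem isTypes_spec (h : X.isTypes = true) : 1 < X.m ∧ (∀ l < X.k, (X.size l).all (· == 0) = false)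
    ∧
    (∀ i < X.m, (i = 0 ↔ X.rk i = 0) ∧ (i = 0 ∨ X.lt 0 i = true) ∧
      (i = X.m - 1 ∨ X.lt i (X.m - 1) = true) ∧ ∀ j < X.m, X.lt i j = true → X.rk i < X.rk j ∧
        (∀ t < X.m, X.lt j t = true → X.lt i t = true ∧
          ∀ l < X.k, X.has i l = true → X.has t l = true → X.has j l = true) ∧
        (X.rk i + 1 = X.rk j ∨ ∃ t < X.m, X.lt i t = true ∧ X.lt t j = true ∧
          X.rk t = X.rk i + 1)) ∧
    ∀ l < X.k, X.has 0 l = false ∧ X.has (X.m - 1) l = false := by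
  simp only [isTypes, Bool.and_eq_true, decide_eq_true_eq, List.all_eq_true, List.mem_range,
    Bool.or_eq_true, Bool.not_eq_true', beq_iff_eq, List.any_eq_true] at h
  obtain ⟨⟨⟨h1, h2⟩, h3⟩, h4⟩ := h
  refine ⟨h1, h2, fun i hi => ?_, h4⟩
  obtain ⟨⟨⟨h5, h6⟩, h7⟩, h8⟩ := h3 i hi
  refine ⟨?_, h6, h7, fun j hj hij => ?_⟩
  · rw [← beq_iff_eq (a := i), ← beq_iff_eq (a := X.rk i), h5]
  · obtain ⟨⟨h9, h10⟩, h11⟩ := (h8 j hj).resolve_left (by simp [hij])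
    refine ⟨h9, fun t ht hjt => ?_, ?_⟩
    · obtain ⟨h12, h13⟩ := (h10 t ht).resolve_left (by simp [hjt])
      refine ⟨h12, fun l hl h14 h15 => (h13 l hl).resolve_left (by simp [h14, h15])⟩
    · refine h11.imp_right ?_
      rintro ⟨t, ht, h12, h13⟩
      exact ⟨t, ht, h12.1, h12.2, h13⟩

/-- The type poset for a positive value of the parameter. -/
def toTypePoset (h : X.isTypes = true) {N : ℕ} (hN : 0 < N) :
    TypePoset (Fin X.m) (Fin X.k) where
  rk i := X.rk i
  lt i j := X.lt i j = true
  A i := Finset.univ.filter fun l => X.has i l = true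
  s l := pEval N (X.size l)
  bot := ⟨0, by have := (isTypes_spec h).1; omega⟩
  top := ⟨X.m - 1, by have := (isTypes_spec h).1; omega⟩
  s_pos l := pEval_pos hN _ ((isTypes_spec h).2.1 l l.2)
  rk_lt i j hij := (((isTypes_spec h).2.2.1 i i.2).2.2.2 j j.2 hij).1
  trans i j t hij hjt := ((((isTypes_spec h).2.2.1 i i.2).2.2.2 j j.2 hij).2.1 t t.2 hjt).1
  contig i j t l hij hjt hi ht := by
    simp only [Finset.mem_filter, Finset.mem_univ, true_and] at hi ht ⊢
    exact ((((isTypes_spec h).2.2.1 i i.2).2.2.2 j j.2 hij).2.1 t t.2 hjt).2 l l.2 hi ht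
  graded i j hij hr := by
    rcases (((isTypes_spec h).2.2.1 i i.2).2.2.2 j j.2 hij).2.2 with h1 | ⟨t, ht, h1, h2, h3⟩
    · exact absurd h1 (by omega)
    · exact ⟨⟨t, ht⟩, h1, h2, h3⟩
  rk_bot := by
    have := (isTypes_spec h).1
    exact ((isTypes_spec h).2.2.1 0 (by omega)).1.1 rfl
  bot_lt i hi := (((isTypes_spec h).2.2.1 i i.2).2.1).resolve_left fun h0 => hi (Fin.ext h0)
  lt_top i hi := (((isTypes_spec h).2.2.1 i i.2).2.2.1).resolve_left fun h0 => hi (Fin.ext h0)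
  A_bot := by
    ext l
    simp [((isTypes_spec h).2.2.2 l l.2).1]
  A_top := by
    ext l
    simp [((isTypes_spec h).2.2.2 l l.2).2]

theorem sum_parity {ι : Type*} (s : Finset ι) (f : ι → ℝ) (d : ι → ℕ) (a : ℕ) :
    ∑ t ∈ s, f t * (-1) ^ d t = (-1) ^ a * (∑ t ∈ s with (a + d t) % 2 = 0, f t -
      ∑ t ∈ s with (a + d t) % 2 = 1, f t) := by
  rw [Finset.sum_filter, Finset.sum_filter, ← Finset.sum_sub_distrib, Finset.mul_sum]
  refine Finset.sum_congr rfl fun t _ => ?_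
  have h1 := neg_one_pow_mul_self a
  rcases Nat.mod_two_eq_zero_or_one (a + d t) with h | h
  · have h2 : (-1 : ℝ) ^ (a + d t) = 1 := (Nat.even_iff.2 h).neg_one_pow
    rw [if_pos h, if_neg (by omega)]
    rw [pow_add] at h2
    linear_combination (f t * (-1) ^ a) * h2 - (f t * (-1) ^ d t) * h1
  · have h2 : (-1 : ℝ) ^ (a + d t) = -1 := (Nat.odd_iff.2 h).neg_one_pow
    rw [if_neg (by omega), if_pos h]
    rw [pow_add] at h2
    linear_combination (f t * (-1) ^ a) * h2 - (f t * (-1) ^ d t) * h1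

/-- Up to sign, the Euler relation says that the odd part of the interval sum equals the even part
plus 1 or 0, according to the parity of the rank difference. This is an identity of polynomials with
natural coefficients, valid for every positive `N` once checked on coefficients. -/
theorem eulerRel (h : X.isTypes = true) (he : X.isEuler = true) {N : ℕ} (hN : 0 < N) :
    EulerRel (1 / 2) (toTypePoset h hN).Elt := by
  classical
  refine TypePoset.eulerRel fun i j hij => ?_
  have hij' : X.lt i j = true := hij
  simp only [isEuler, List.all_eq_true, List.mem_range, Bool.or_eq_true, Bool.not_eq_true'] at he
  have h1 := pEval_eq_of_pEq N _ _ ((he i i.2 j j.2).resolve_left (by simp [hij']))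
  rw [pEval_pAdd, pEval_sumTypes, pEval_sumTypes] at h1
  have h2 : ∀ t : Fin X.m, ∏ l ∈ (toTypePoset h hN).A t \
      ((toTypePoset h hN).A i ∪ (toTypePoset h hN).A j), (((toTypePoset h hN).s l : ℕ) : ℝ) =
      ((pEval N (X.prodSize fun l => X.has t l && !(X.has i l || X.has j l)) : ℕ) : ℝ) := by
    intro t
    rw [pEval_prodSize, Nat.cast_prod]
    refine Finset.prod_congr ?_ fun _ _ => rfl
    ext l
    simp [toTypePoset]
  rw [Finset.sum_congr rfl fun t _ => by rw [h2 t], sum_parity _ _ _ (X.rk i)]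
  have h3 := congrArg (Nat.cast : ℕ → ℝ) h1
  push_cast at h3
  have h4 : ∀ e, (Finset.univ.filter fun t : Fin X.m => (toTypePoset h hN).lt i t ∧
      (toTypePoset h hN).lt t j).filter (fun t => (X.rk i + (toTypePoset h hN).rk t) % 2 = e) =
      Finset.univ.filter fun t : Fin X.m =>
        (X.lt i t && X.lt t j && (X.rk i + X.rk t) % 2 == e) = true := by
    intro e
    ext t
    rw [Finset.mem_filter, Finset.mem_filter, Finset.mem_filter]
    simp [toTypePoset, and_assoc]
  rw [h4, h4, h3]
  have h5 : (toTypePoset h hN).rk i = X.rk i := rfl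
  have h6 : (toTypePoset h hN).rk j = X.rk j := rfl
  rw [h5, h6]
  have h7 := neg_one_pow_mul_self (X.rk i)
  by_cases h8 : (X.rk i + X.rk j) % 2 = 0
  · have h9 : (-1 : ℝ) ^ (X.rk i + X.rk j) = 1 := (Nat.even_iff.2 h8).neg_one_pow
    rw [pow_add] at h9
    rw [if_pos h8]
    simp only [pEval]
    push_cast
    linear_combination (1 / 2 * (-1) ^ X.rk i) * h9 - (1 / 2 * (-1) ^ X.rk j) * h7
  · have h9 : (-1 : ℝ) ^ (X.rk i + X.rk j) = -1 := (Nat.odd_iff.2 (by omega)).neg_one_pow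
    rw [pow_add] at h9
    rw [if_neg h8]
    simp only [pEval]
    push_cast
    linear_combination (1 / 2 * (-1) ^ X.rk i) * h9 - (1 / 2 * (-1) ^ X.rk j) * h7

theorem pEval_count (h : X.isTypes = true) {N : ℕ} (hN : 0 < N) (R : List ℕ) (i : Fin X.m) :
    pEval N (X.count R i) = (toTypePoset h hN).typeCount R i := by
  classical
  induction R generalizing i with
  | nil => simp [count, pEval, TypePoset.typeCount]
  | cons a R ih =>
    rw [count, TypePoset.typeCount, pEval_sumTypes]
    refine Finset.sum_congr ?_ fun t _ => ?_
    · ext t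
      rw [Finset.mem_filter, Finset.mem_filter]
      simp [toTypePoset]
    · rw [pEval_pMul, pEval_prodSize, ih t]
      congr 1
      refine Finset.prod_congr ?_ fun _ _ => rfl
      ext l
      simp [toTypePoset]

end PolyTypes

/-- The multiple of `S ↦ r^|S|` supported on the sets disjoint from `U`. -/
noncomputable def disjointVector (r : ℝ) (n : ℕ) (U : Finset ℕ) : FlagVector n :=
  fun S => r ^ (S : Finset ℕ).card * if Disjoint U (S : Finset ℕ) then 1 else 0

theorem sort_mem_sublists {n : ℕ} {S : Finset ℕ} (hS : S ⊆ Finset.Icc 1 n) :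
    S.sort (· ≤ ·) ∈ (List.range' 1 n).sublists := by
  rw [List.mem_sublists]
  have h : S.sort (· ≤ ·) = (List.range' 1 n).filter (· ∈ S) := by
    refine List.Perm.eq_of_pairwise (le := (· < ·)) (fun a b _ _ h h' => absurd h (not_lt.2 h'.le))
      S.sortedLT_sort.pairwise ((List.pairwise_lt_range' (s := 1) (n := n)).filter _) ?_
    rw [List.perm_ext_iff_of_nodup (Finset.sort_nodup _ _)
      ((List.nodup_range' (s := 1) (n := n)).filter _)]
    intro a
    simp only [Finset.mem_sort, List.mem_filter, List.mem_range'_1, decide_eq_true_eq]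
    refine ⟨fun ha => ⟨?_, ha⟩, And.right⟩
    have := Finset.mem_Icc.1 (hS ha)
    omega
  rw [h]
  exact List.filter_sublist

/-- Dividing the flag numbers by `N^D` leaves their coefficients of degree `D`, which `hasLimit` has
compared with the list for every rank set. -/
theorem PolyTypes.limit_mem_closedCone {X : PolyTypes} (h : X.isTypes = true)
    (he : X.isEuler = true) {n D : ℕ} (hn : X.rk (X.m - 1) = n + 1) {c : List (ℤ × List ℕ)}
    (hc : X.hasLimit n D c = true) {r : ℕ} (hr : r ≠ 0) :
    (c.map fun p => (p.1 : ℝ) • disjointVector r n p.2.toFinset).sum ∈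
      closedCone (kEulerianFlagVectors ((r : ℝ) / 2) n) := by
  refine mem_closedCone_of_tendsto (f := fun N S => (r : ℝ) ^ (S : Finset ℕ).card *
    (pEval N (X.count ((S : Finset ℕ).sort (· ≤ ·)) 0) : ℝ))
    (c := fun N => ((N : ℝ) ^ D)⁻¹) ?_ (fun N => by positivity) ?_
  · intro N hN
    convert TypePoset.mem_kEulerianFlagVectors (X := toTypePoset h hN) (n := n) hn
      (eulerRel h he hN) hr using 4 with S
    exact pEval_count h hN _ (toTypePoset h hN).bot
  · rw [tendsto_pi_nhds]
    intro S
    have h1 := List.all_eq_true.1 hc _ (sort_mem_sublists (Finset.mem_powerset.1 S.2))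
    rw [Bool.and_eq_true, decide_eq_true_eq, beq_iff_eq] at h1
    have h2 := (tendsto_pEval D _ h1.1).const_mul ((r : ℝ) ^ (S : Finset ℕ).card)
    have h3 : (c.map fun p => (p.1 : ℝ) • disjointVector r n p.2.toFinset).sum S =
        (r : ℝ) ^ (S : Finset ℕ).card *
          (((X.count ((S : Finset ℕ).sort (· ≤ ·)) 0).getD D 0 : ℕ) : ℝ) := by
      have h4 := congrArg (Int.cast : ℤ → ℝ) h1.2
      rw [Int.cast_natCast] at h4
      rw [h4]
      clear h1 h2 h4 hc
      induction c with
      | nil => simp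
      | cons p c ih =>
        simp only [List.map_cons, List.sum_cons, Pi.add_apply, ih, Int.cast_add, mul_add]
        congr 1
        simp only [Pi.smul_apply, disjointVector, smul_eq_mul]
        have h5 : Disjoint p.2.toFinset (S : Finset ℕ) ↔
            (p.2.all fun u => !((S : Finset ℕ).sort (· ≤ ·)).contains u) = true := by
          simp [Finset.disjoint_left]
        by_cases h6 : Disjoint p.2.toFinset (S : Finset ℕ)
        · rw [if_pos h6, if_pos (h5.1 h6)]; ring
        · rw [if_neg h6, if_neg (fun h7 => h6 (h5.2 h7))]; simp
    rw [h3]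
    refine h2.congr fun N => ?_
    simp only [Pi.smul_apply, smul_eq_mul]
    ring

/-! ### Four families of half-Eulerian posets of rank eight -/

/-- A family of half-Eulerian posets of rank eight, with leading flag numbers `typesALimit`. -/
def typesA : PolyTypes where
  m := 20
  k := 8
  ranks := [0, 1, 2, 2, 2, 3, 3, 3, 4, 4, 4, 4, 5, 5, 5, 6, 6, 6, 7, 8]
  letters := [0, 0, 16, 41, 136, 16, 107, 136, 56, 106, 20, 136, 104, 20, 136, 72, 28, 136, 8, 0]
  above := [1048574, 1048572, 898336, 823872, 936064, 898304, 823808, 935936, 823296, 823296,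
      860160,
    933888, 819200, 851968, 917504, 786432, 786432, 786432, 524288, 0]
  -- Coefficients start with the constant term: `[1, 3]` stands for `1 + 3N`.
  sizes := [[2], [1, 1], [0, 1], [0, 1], [0, 1], [1, 1], [2], [1, 3]]

/-- The leading coefficients of the flag numbers of `typesA`. -/
def typesALimit : List (ℤ × List ℕ) :=
  [(7, []), (-2, [2, 3]), (-4, [3, 4]), (-2, [4, 5]), (2, [2, 3, 4, 5]), (-1, [5, 6]),
    (-1, [6, 7]), (1, [4, 5, 6, 7])]

theorem typesA_isTypes : typesA.isTypes = true := by decide +kernel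

theorem typesA_isEuler : typesA.isEuler = true := by decide +kernel

theorem typesA_hasLimit : typesA.hasLimit 7 3 typesALimit = true := by decide +kernel

/-- A family of half-Eulerian posets of rank eight, with leading flag numbers `typesBLimit`. -/
def typesB : PolyTypes where
  m := 16
  k := 6
  ranks := [0, 1, 2, 3, 3, 4, 4, 4, 5, 5, 5, 6, 6, 6, 7, 8]
  letters := [0, 0, 8, 8, 13, 20, 5, 10, 52, 5, 10, 36, 5, 14, 4, 0]
  above := [65534, 65532, 65528, 60832, 53824, 51456, 53760, 58368, 51200, 53248, 57344, 49152,
      49152,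
    49152, 32768, 0]
  sizes := [[0, 1], [0, 1], [0, 1], [0, 1], [1, 1], [2]]

/-- The leading coefficients of the flag numbers of `typesB`. -/
def typesBLimit : List (ℤ × List ℕ) :=
  [(4, []), (-3, [2, 3]), (-2, [4, 5]), (2, [2, 3, 4, 5]), (-1, [5, 6]), (1, [2, 3, 5, 6]),
    (-1, [3, 4, 5, 6]), (-1, [6, 7]), (1, [4, 5, 6, 7])]

theorem typesB_isTypes : typesB.isTypes = true := by decide +kernel

theorem typesB_isEuler : typesB.isEuler = true := by decide +kernel

theorem typesB_hasLimit : typesB.hasLimit 7 3 typesBLimit = true := by decide +kernel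

/-- A family of half-Eulerian posets of rank eight, with leading flag numbers `typesCLimit`. -/
def typesC : PolyTypes where
  m := 16
  k := 6
  ranks := [0, 1, 2, 3, 3, 3, 4, 4, 4, 5, 5, 5, 6, 6, 7, 8]
  letters := [0, 0, 4, 36, 5, 14, 52, 5, 10, 20, 5, 10, 8, 13, 8, 0]
  above := [65534, 65532, 65528, 53824, 58496, 55552, 53760, 58368, 55296, 53248, 57344, 53248,
      49152,
    49152, 32768, 0]
  sizes := [[0, 1], [0, 1], [0, 1], [0, 1], [1, 1], [2]]

/-- The leading coefficients of the flag numbers of `typesC`. -/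
def typesCLimit : List (ℤ × List ℕ) :=
  [(4, []), (-1, [2, 3]), (-1, [3, 4]), (-2, [4, 5]), (1, [2, 3, 4, 5]),
    (-1, [3, 4, 5, 6]), (-3, [6, 7]), (1, [3, 4, 6, 7]), (2, [4, 5, 6, 7])]

theorem typesC_isTypes : typesC.isTypes = true := by decide +kernel

theorem typesC_isEuler : typesC.isEuler = true := by decide +kernel

theorem typesC_hasLimit : typesC.hasLimit 7 3 typesCLimit = true := by decide +kernel

/-- A family of half-Eulerian posets of rank eight, with leading flag numbers `typesDLimit`. -/
def typesD : PolyTypes where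
  m := 16
  k := 6
  ranks := [0, 1, 1, 2, 2, 2, 3, 3, 3, 4, 4, 5, 5, 6, 7, 8]
  letters := [0, 12, 1, 44, 3, 1, 44, 2, 1, 40, 17, 40, 16, 32, 32, 0]
  above := [65534, 59976, 65456, 59968, 60032, 62720, 59904, 59904, 62464, 59392, 61440, 57344,
      57344,
    49152, 32768, 0]
  sizes := [[2], [1, 1], [0, 1], [1, 1], [0, 0, 1], [0, 1]]

/-- The leading coefficients of the flag numbers of `typesD`. -/
def typesDLimit : List (ℤ × List ℕ) :=
  [(5, []), (-1, [1, 2]), (-2, [2, 3]), (-1, [1, 2, 3, 4]), (-4, [4, 5]),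
    (1, [1, 2, 4, 5]), (2, [2, 3, 4, 5]), (-2, [6, 7]), (1, [1, 2, 3, 4, 6, 7]),
    (2, [4, 5, 6, 7]), (-1, [2, 3, 4, 5, 6, 7])]

theorem typesD_isTypes : typesD.isTypes = true := by decide +kernel

theorem typesD_isEuler : typesD.isEuler = true := by decide +kernel

theorem typesD_hasLimit : typesD.hasLimit 7 3 typesDLimit = true := by decide +kernel

/-! ### The facet -/

/-- The integer combination of the vectors `disjointVector r n U` given by a list. -/
noncomputable def listVector (r : ℝ) (n : ℕ) (c : List (ℤ × List ℕ)) : FlagVector n :=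
  (c.map fun p => (p.1 : ℝ) • disjointVector r n p.2.toFinset).sum

/-- The coordinates of `listVector`, without powers of `r`. -/
def listCoord (c : List (ℤ × List ℕ)) (S : Finset ℕ) : ℤ :=
  (c.map fun p => if Disjoint p.2.toFinset S then p.1 else 0).sum

theorem listVector_apply (r : ℝ) {n : ℕ} (c : List (ℤ × List ℕ)) (S : RankSet n) :
    listVector r n c S = r ^ (S : Finset ℕ).card * (listCoord c S : ℝ) := by
  unfold listVector listCoord
  induction c with
  | nil => simp
  | cons p c ih =>
    simp only [List.map_cons, List.sum_cons, Pi.add_apply, ih, Int.cast_add, mul_add]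
    congr 1
    simp only [Pi.smul_apply, disjointVector, smul_eq_mul]
    split_ifs <;> simp [mul_comm]

/-- The expansion `∏_{p ∈ I} (1 - e_p)` of the limit vector of a list of intervals. -/
def systemList : List (ℕ × ℕ) → List (ℤ × List ℕ)
  | [] => [(1, [])]
  | p :: L => (systemList L) ++
      (systemList L).map fun q => (-q.1, List.range' p.1 (p.2 + 1 - p.1) ++ q.2)

theorem listCoord_append (c d : List (ℤ × List ℕ)) (S : Finset ℕ) :
    listCoord (c ++ d) S = listCoord c S + listCoord d S := by
  simp [listCoord]

/-- The indicator of meeting an interval `p` is `1 - e_p`, where `e_p` indicates disjointness from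
`p`. In the expanded product over the intervals, products of such indicators become indicators of
disjointness from unions. -/
theorem listCoord_systemList (L : List (ℕ × ℕ)) (S : Finset ℕ) :
    listCoord (systemList L) S = if Blocks L.toFinset S then 1 else 0 := by
  induction L with
  | nil => simp [systemList, listCoord, Blocks]
  | cons p L ih =>
    have h1 : listCoord ((systemList L).map fun q => (-q.1, List.range' p.1 (p.2 + 1 - p.1) ++ q.2))
        S =
        if ∃ i ∈ S, p.1 ≤ i ∧ i ≤ p.2 then 0 else -listCoord (systemList L) S := by
      generalize systemList L = c
      have h2 : Disjoint (List.range' p.1 (p.2 + 1 - p.1)).toFinset S ↔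
          ¬ ∃ i ∈ S, p.1 ≤ i ∧ i ≤ p.2 := by
        rw [Finset.disjoint_right]
        push Not
        refine forall_congr' fun i => forall_congr' fun _ => ?_
        rw [List.mem_toFinset, List.mem_range'_1]
        omega
      induction c with
      | nil => simp [listCoord]
      | cons q c ih' =>
        simp only [listCoord, List.map_cons, List.sum_cons] at ih' ⊢
        rw [ih']
        simp only [List.toFinset_append, Finset.disjoint_union_left, h2]
        by_cases h3 : ∃ i ∈ S, p.1 ≤ i ∧ i ≤ p.2 <;> by_cases h4 : Disjoint q.2.toFinset S <;>
          simp [h3, h4, add_comm]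
    have h5 : Blocks (p :: L).toFinset S ↔ (∃ i ∈ S, p.1 ≤ i ∧ i ≤ p.2) ∧ Blocks L.toFinset S := by
      simp [Blocks]
    rw [systemList, listCoord_append, h1, ih, if_congr h5 rfl rfl]
    by_cases h3 : ∃ i ∈ S, p.1 ≤ i ∧ i ≤ p.2 <;> by_cases h4 : Blocks L.toFinset S <;>
      simp [h3, h4]

theorem systemVector_eq_listVector (r : ℝ) (n : ℕ) (L : List (ℕ × ℕ)) :
    systemVector r n L.toFinset = listVector r n (systemList L) := by
  funext S
  rw [listVector_apply, listCoord_systemList, systemVector]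
  split_ifs <;> simp

/-- The weight `r^(n-|S|)` of the form and `r^|S|` of the vector combine to `r^n`. So, for positive
`r`, zeros and signs do not depend on `r`, and for integral coefficients they are decided by integer
arithmetic. -/
theorem evalForm_rescale_listVector (r : ℝ) {n : ℕ} (a : FlagForm n) (c : List (ℤ × List ℕ)) :
    evalForm (rescale r a) (listVector r n c) = r ^ n * ∑ S, a S * listCoord c S := by
  rw [evalForm, Finset.mul_sum]
  refine Finset.sum_congr rfl fun S _ => ?_
  have h1 : (S : Finset ℕ).card ≤ n := by
    simpa using Finset.card_le_card (Finset.mem_powerset.1 S.2)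
  rw [listVector_apply, rescale]
  linear_combination (a S * listCoord c S) * pow_sub_mul_pow r h1

theorem sum_flagForm_mul {n : ℕ} {S : Finset ℕ} (hS : S ⊆ Finset.Icc 1 n) (f : Finset ℕ → ℝ) :
    ∑ T : RankSet n, flagForm n S T * f T = f S := by
  have := evalForm_flagForm hS (fun T : RankSet n => f T)
  exact this

/-- The form `F` at a vector with given coordinates. -/
def rank8Coord (f : Finset ℕ → ℤ) : ℤ :=
  f {1, 3, 5, 6} - f {1, 3, 5} - f {3, 5, 6} + f {1, 5} - f {1, 6} + f {3, 5} + f {3, 6} - f {3}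

theorem evalForm_rank8_listVector (r : ℝ) (c : List (ℤ × List ℕ)) :
    evalForm (rescale r rank8Form) (listVector r 7 c) = r ^ 7 * rank8Coord (listCoord c) := by
  rw [evalForm_rescale_listVector, rank8Form]
  simp only [Pi.add_apply, Pi.sub_apply, add_mul, sub_mul, Finset.sum_add_distrib,
    Finset.sum_sub_distrib]
  rw [sum_flagForm_mul (by decide) fun S => (listCoord c S : ℝ),
    sum_flagForm_mul (by decide) fun S => (listCoord c S : ℝ),
    sum_flagForm_mul (by decide) fun S => (listCoord c S : ℝ),
    sum_flagForm_mul (by decide) fun S => (listCoord c S : ℝ),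
    sum_flagForm_mul (by decide) fun S => (listCoord c S : ℝ),
    sum_flagForm_mul (by decide) fun S => (listCoord c S : ℝ),
    sum_flagForm_mul (by decide) fun S => (listCoord c S : ℝ),
    sum_flagForm_mul (by decide) fun S => (listCoord c S : ℝ)]
  simp [rank8Coord]

theorem rescale_apply_mul (r : ℝ) {n : ℕ} (a : FlagForm n) (x : FlagVector n) :
    evalForm (rescale r a) x = ∑ S, a S * (r ^ (n - (S : Finset ℕ).card) * x S) := by
  rw [evalForm]
  exact Finset.sum_congr rfl fun S _ => by rw [rescale]; ring

theorem evalForm_rank8_flagVector (r : ℝ) (P : Type*) [PartialOrder P] [GradeMinOrder ℕ P] :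
    evalForm (rescale r rank8Form) (flagVector 7 P) =
      r ^ 3 * (flagNumber P {1, 3, 5, 6} : ℝ) - r ^ 4 * flagNumber P {1, 3, 5}
      - r ^ 4 * flagNumber P {3, 5, 6} + r ^ 5 * flagNumber P {1, 5}
      - r ^ 5 * flagNumber P {1, 6} + r ^ 5 * flagNumber P {3, 5}
      + r ^ 5 * flagNumber P {3, 6} - r ^ 6 * flagNumber P {3} := by
  rw [rescale_apply_mul, rank8Form]
  simp only [Pi.add_apply, Pi.sub_apply, add_mul, sub_mul, Finset.sum_add_distrib,
    Finset.sum_sub_distrib, flagVector]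
  rw [sum_flagForm_mul (by decide) fun S => (r ^ (7 - S.card) * flagNumber P S : ℝ),
    sum_flagForm_mul (by decide) fun S => (r ^ (7 - S.card) * flagNumber P S : ℝ),
    sum_flagForm_mul (by decide) fun S => (r ^ (7 - S.card) * flagNumber P S : ℝ),
    sum_flagForm_mul (by decide) fun S => (r ^ (7 - S.card) * flagNumber P S : ℝ),
    sum_flagForm_mul (by decide) fun S => (r ^ (7 - S.card) * flagNumber P S : ℝ),
    sum_flagForm_mul (by decide) fun S => (r ^ (7 - S.card) * flagNumber P S : ℝ),
    sum_flagForm_mul (by decide) fun S => (r ^ (7 - S.card) * flagNumber P S : ℝ),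
    sum_flagForm_mul (by decide) fun S => (r ^ (7 - S.card) * flagNumber P S : ℝ)]
  rfl

instance (n : ℕ) (I : Finset (ℕ × ℕ)) : Decidable (IsEvenSystem n I) :=
  inferInstanceAs (Decidable ((∀ p ∈ I, 1 ≤ p.1 ∧ p.2 ≤ n) ∧
    ∀ p ∈ I, ∀ q ∈ I, Even (Finset.Icc (max p.1 q.1) (min p.2 q.2)).card))

theorem rank8_nonneg_of_mem {r : ℕ} (hr : r ≠ 0) {x : FlagVector 7} (hx : x ∈ kEulerianFlagVectors
    ((r : ℝ) / 2) 7) :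
    0 ≤ evalForm (rescale r rank8Form) x := by
  obtain ⟨P, _, _, _, _, hP, hE, rfl⟩ := hx
  have := Fintype.ofFinite P
  have hr' : (r : ℝ) ≠ 0 := by exact_mod_cast hr
  rw [isKEulerian_iff_eulerRel (by positivity)] at hE
  rw [evalForm_rank8_flagVector]
  exact rank8_nonneg_of_isThick hP hE.isThick

theorem systemVector_mem_span {r : ℕ} (hr : r ≠ 0) {L : List (ℕ × ℕ)} (h1 :
    IsEvenSystem 7 L.toFinset)
    (h2 : rank8Coord (listCoord (systemList L)) = 0) :
    listVector r 7 (systemList L) ∈ Submodule.span ℝ {x : FlagVector 7 |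
      x ∈ closedCone (kEulerianFlagVectors ((r : ℝ) / 2) 7) ∧
        evalForm (rescale r rank8Form) x = 0} := by
  refine Submodule.subset_span ⟨?_, ?_⟩
  · rw [← systemVector_eq_listVector]
    exact h1.systemVector_mem_closedCone hr
  · rw [evalForm_rank8_listVector, h2]
    simp

theorem limit_mem_span {r : ℕ} (hr : r ≠ 0) {X : PolyTypes} (h : X.isTypes = true)
    (he : X.isEuler = true) (hn : X.rk (X.m - 1) = 8) {c : List (ℤ × List ℕ)} {D : ℕ}
    (hc : X.hasLimit 7 D c = true) (h2 : rank8Coord (listCoord c) = 0) :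
    listVector r 7 c ∈ Submodule.span ℝ {x : FlagVector 7 |
      x ∈ closedCone (kEulerianFlagVectors ((r : ℝ) / 2) 7) ∧
        evalForm (rescale r rank8Form) x = 0} := by
  refine Submodule.subset_span ⟨PolyTypes.limit_mem_closedCone h he hn hc hr, ?_⟩
  rw [evalForm_rank8_listVector, h2]
  simp

/-- The face together with one further vector spans all `disjointVector`s of even sets. -/
theorem disjointVector_mem_sup {r : ℕ} (hr : r ≠ 0) {M : Submodule ℝ (FlagVector 7)}
    (hM : Submodule.span ℝ {x : FlagVector 7 |
      x ∈ closedCone (kEulerianFlagVectors ((r : ℝ) / 2) 7) ∧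
        evalForm (rescale r rank8Form) x = 0} ≤ M)
    (hu : systemVector r 7 {(4, 5)} ∈ M) : ∀ U ∈ evenSets7, disjointVector r 7 U ∈ M := by
  -- In the quotient by `M` every point of the face gives a linear relation between the 21 classes;
  -- the relations are ordered so that each one isolates a new class.
  set E : Finset ℕ → (FlagVector 7) ⧸ M := fun U => M.mkQ (disjointVector r 7 U) with hE
  have hq : ∀ c, listVector r 7 c ∈ M → (c.map fun p => (p.1 : ℝ) • E p.2.toFinset).sum = 0 := by
    intro c hc
    have h1 := (Submodule.Quotient.mk_eq_zero M).2 hc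
    rw [← Submodule.mkQ_apply, listVector, map_list_sum, List.map_map] at h1
    rw [← h1]
    congr 1
  have hs : ∀ L : List (ℕ × ℕ), IsEvenSystem 7 L.toFinset →
      rank8Coord (listCoord (systemList L)) = 0 →
      ((systemList L).map fun p => (p.1 : ℝ) • E p.2.toFinset).sum = 0 := fun L h1 h2 =>
    hq _ (hM (systemVector_mem_span hr h1 h2))
  have h0 : E ∅ = 0 := by
    simpa [systemList] using hs [] (by decide) (by decide +kernel)
  have h45 : E {4, 5} = 0 := by
    have h1 := hq (systemList [(4, 5)]) (by
      rw [← systemVector_eq_listVector]; exact hu)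
    simpa [systemList, h0, List.range'] using h1
  have h12 : E {1, 2} = 0 := by
    simpa [systemList, h0, List.range'] using hs [(1, 2)] (by decide) (by decide +kernel)
  have h23 : E {2, 3} = 0 := by
    simpa [systemList, h0, List.range'] using hs [(2, 3)] (by decide) (by decide +kernel)
  have h34 : E {3, 4} = 0 := by
    simpa [systemList, h0, List.range'] using hs [(3, 4)] (by decide) (by decide +kernel)
  have h67 : E {6, 7} = 0 := by
    simpa [systemList, h0, List.range'] using hs [(6, 7)] (by decide) (by decide +kernel)
  have h14 : E {1, 2, 3, 4} = 0 := by
    simpa [systemList, h0, List.range'] using hs [(1, 4)] (by decide) (by decide +kernel)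
  have h36 : E {3, 4, 5, 6} = 0 := by
    simpa [systemList, h0, List.range'] using hs [(3, 6)] (by decide) (by decide +kernel)
  have h16 : E {1, 2, 3, 4, 5, 6} = 0 := by
    simpa [systemList, h0, List.range'] using hs [(1, 6)] (by decide) (by decide +kernel)
  have h27 : E {2, 3, 4, 5, 6, 7} = 0 := by
    simpa [systemList, h0, List.range'] using hs [(2, 7)] (by decide) (by decide +kernel)
  have h25 : E {2, 3, 4, 5} = 0 := by
    simpa [systemList, h0, h23, h45, List.range'] using
      hs [(2, 3), (4, 5)] (by decide) (by decide +kernel)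
  have h47 : E {4, 5, 6, 7} = 0 := by
    simpa [systemList, h0, h67, h45, List.range'] using
      hs [(4, 5), (6, 7)] (by decide) (by decide +kernel)
  -- `F` is positive at the system `{[2,3], [6,7]}`, so this class is extracted from a system of
  -- three intervals.
  have h2367 : E {2, 3, 6, 7} = 0 := by
    simpa [systemList, h0, h23, h67, h45, h25, h47, h27, List.range'] using
      hs [(2, 3), (4, 5), (6, 7)] (by decide) (by decide +kernel)
  have h1267 : E {1, 2, 6, 7} = 0 := by
    simpa [systemList, h0, h12, h67, List.range'] using
      hs [(1, 2), (6, 7)] (by decide) (by decide +kernel)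
  have h1467 : E {1, 2, 3, 4, 6, 7} = 0 := by
    simpa [systemList, h0, h14, h67, List.range'] using
      hs [(1, 4), (6, 7)] (by decide) (by decide +kernel)
  have h1247 : E {1, 2, 4, 5, 6, 7} = 0 := by
    simpa [systemList, h0, h12, h47, List.range'] using
      hs [(1, 2), (4, 7)] (by decide) (by decide +kernel)
  -- The system `{[5,6]}` is not on the face, as `F` is positive there; a limit of `typesA` replaces
  -- it. The classes of `{2,3,5,6}`, `{3,4,6,7}` and `{1,2,4,5}` are treated likewise with the other
  -- families.
  have h56 : E {5, 6} = 0 := by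
    simpa [typesALimit, h0, h23, h34, h45, h25, h67, h47] using
      hq _ (hM (limit_mem_span hr typesA_isTypes typesA_isEuler rfl typesA_hasLimit
        (by decide +kernel)))
  have h1256 : E {1, 2, 5, 6} = 0 := by
    simpa [systemList, h0, h12, h56, List.range'] using
      hs [(1, 2), (5, 6)] (by decide) (by decide +kernel)
  have h2356 : E {2, 3, 5, 6} = 0 := by
    simpa [typesBLimit, h0, h23, h36, h45, h25, h56, h67, h47] using
      hq _ (hM (limit_mem_span hr typesB_isTypes typesB_isEuler rfl typesB_hasLimit
        (by decide +kernel)))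
  have h3467 : E {3, 4, 6, 7} = 0 := by
    simpa [typesCLimit, h0, h23, h34, h36, h45, h25, h56, h67, h47] using
      hq _ (hM (limit_mem_span hr typesC_isTypes typesC_isEuler rfl typesC_hasLimit
        (by decide +kernel)))
  have h1245 : E {1, 2, 4, 5} = 0 := by
    simpa [typesDLimit, h0, h12, h23, h14, h45, h25, h67, h1467, h47, h27] using
      hq _ (hM (limit_mem_span hr typesD_isTypes typesD_isEuler rfl typesD_hasLimit
        (by decide +kernel)))
  intro U hU
  refine (Submodule.Quotient.mk_eq_zero M).1 ?_
  change E U = 0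
  simp only [evenSets7, Finset.mem_insert, Finset.mem_singleton] at hU
  rcases hU with rfl | rfl | rfl | rfl | rfl | rfl | rfl | rfl | rfl | rfl | rfl | rfl | rfl | rfl |
    rfl | rfl | rfl | rfl | rfl | rfl | rfl <;> assumption

/-- The flag `L`-vector gives the coefficients for flag vectors, and a subspace of finite dimension
is closed, so the bound extends to the closed cone. -/
theorem mem_span_disjointVector {r : ℕ} (hr : r ≠ 0) {x : FlagVector 7}
    (hx : x ∈ closedCone (kEulerianFlagVectors ((r : ℝ) / 2) 7)) :
    x ∈ Submodule.span ℝ (disjointVector r 7 '' evenSets7) := by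
  set W := Submodule.span ℝ (disjointVector (r : ℝ) 7 '' evenSets7) with hW
  have hr' : (r : ℝ) ≠ 0 := by exact_mod_cast hr
  have h1 : kEulerianFlagVectors ((r : ℝ) / 2) 7 ⊆ W := by
    rintro _ ⟨P, _, _, _, _, hP, hE, rfl⟩
    have := Fintype.ofFinite P
    rw [isKEulerian_iff_eulerRel (by positivity)] at hE
    have h2 : flagVector 7 P = ∑ S ∈ evenSets7, flagL ((r : ℝ) / 2) 7 P S • disjointVector r 7 S :=
        by
      funext U
      rw [flagVector, hE.flagNumber_eq_sum_evenSets hP (by positivity) (Finset.mem_powerset.1 U.2),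
        Finset.sum_apply, mul_div_cancel₀ _ two_ne_zero]
      rfl
    rw [h2]
    exact Submodule.sum_mem _ fun S hS => Submodule.smul_mem _ _
      (Submodule.subset_span ⟨S, hS, rfl⟩)
  have h3 : (PointedCone.hull ℝ (kEulerianFlagVectors ((r : ℝ) / 2) 7) : Set (FlagVector 7)) ⊆ W :=
      by
    intro y hy
    have hy' : y ∈ Submodule.span {c : ℝ // 0 ≤ c} (kEulerianFlagVectors ((r : ℝ) / 2) 7) := hy
    exact Submodule.span_induction (R := {c : ℝ // 0 ≤ c}) (p := fun y _ => y ∈ W) (fun y hy =>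
        h1 hy) W.zero_mem
      (fun x y _ _ hx hy => W.add_mem hx hy) (fun c x _ hx => W.smul_mem (c : ℝ) hx) hy'
  exact closure_minimal h3 W.closed_of_finiteDimensional hx

/-- The span of the cone is the direct sum of the span of the face and the line through `u`, the
limit vector of `{[4,5]}`, at which the form is nonzero. -/
theorem definesFacet_kEulerian {r : ℕ} (hr : r ≠ 0) : DefinesFacet (rescale r rank8Form)
    (closedCone (kEulerianFlagVectors ((r : ℝ) / 2) 7)) := by
  refine ⟨fun x hx => evalForm_nonneg_of_mem_closedCone (fun y hy => rank8_nonneg_of_mem hr hy) hx,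
    ?_⟩
  set C := closedCone (kEulerianFlagVectors ((r : ℝ) / 2) 7) with hC
  set Fs := Submodule.span ℝ {x : FlagVector 7 | x ∈ C ∧ evalForm (rescale r rank8Form) x = 0} with
      hFs
  set u : FlagVector 7 := systemVector r 7 {(4, 5)} with hu
  have huC : u ∈ C := IsEvenSystem.systemVector_mem_closedCone (by decide) hr
  have hsup : Submodule.span ℝ (C : Set (FlagVector 7)) = Fs ⊔ Submodule.span ℝ {u} := by
    apply le_antisymm
    · rw [Submodule.span_le]
      intro x hx
      have h1 := mem_span_disjointVector hr hx
      refine Submodule.span_le.2 ?_ h1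
      rintro _ ⟨U, hU, rfl⟩
      exact disjointVector_mem_sup hr (M := Fs ⊔ Submodule.span ℝ {u}) le_sup_left
        (Submodule.mem_sup_right (Submodule.mem_span_singleton_self u)) U hU
    · refine sup_le (Submodule.span_mono fun x hx => hx.1) (Submodule.span_mono ?_)
      rintro _ rfl
      exact huC
  have hFu : evalForm (rescale r rank8Form) u ≠ 0 := by
    have h1 := systemVector_eq_listVector (r : ℝ) 7 [(4, 5)]
    have h2 : ([(4, 5)] : List (ℕ × ℕ)).toFinset = {(4, 5)} := rfl
    rw [h2] at h1
    rw [hu, h1, evalForm_rank8_listVector,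
      show rank8Coord (listCoord (systemList [(4, 5)])) = 1 by decide +kernel]
    have hr' : (r : ℝ) ≠ 0 := by exact_mod_cast hr
    positivity
  have huF : u ∉ Fs := by
    intro h
    refine hFu ?_
    refine Submodule.span_induction (p := fun y _ => evalForm (rescale r rank8Form) y = 0)
      (fun y hy => hy.2) (evalForm_zero_right _) ?_ ?_ h
    · intro x y _ _ hx hy
      rw [evalForm_add_right, hx, hy, add_zero]
    · intro c x _ hx
      rw [evalForm_smul_right, hx, mul_zero]
  have hdis : Fs ⊓ Submodule.span ℝ {u} = ⊥ := by
    rw [eq_bot_iff]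
    rintro x ⟨hx, hx'⟩
    obtain ⟨c, rfl⟩ := Submodule.mem_span_singleton.1 hx'
    by_cases hc : c = 0
    · simp [hc]
    · refine absurd ?_ huF
      have := Fs.smul_mem c⁻¹ hx
      rwa [smul_smul, inv_mul_cancel₀ hc, one_smul] at this
  have h1 := Submodule.finrank_sup_add_finrank_inf_eq Fs (Submodule.span ℝ {u})
  have hu0 : u ≠ 0 := by
    rintro h0
    rw [h0, evalForm_zero_right] at hFu
    exact hFu rfl
  rw [hdis, finrank_bot, add_zero, finrank_span_singleton hu0] at h1
  rw [hsup, h1]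

/-! ### Non-generation -/

theorem evalForm_rescale_systemVector (r : ℝ) {n : ℕ} (a : FlagForm n) (I : Finset (ℕ × ℕ)) :
    evalForm (rescale r a) (systemVector r n I) =
      r ^ n * ∑ S : RankSet n, a S * if Blocks I S then 1 else 0 := by
  rw [evalForm, Finset.mul_sum]
  refine Finset.sum_congr rfl fun S _ => ?_
  have h1 : (S : Finset ℕ).card ≤ n := by
    simpa using Finset.card_le_card (Finset.mem_powerset.1 S.2)
  rw [systemVector, rescale]
  linear_combination (a S * if Blocks I S then 1 else 0) * pow_sub_mul_pow r h1

/-- Intervals met by `S` impose no condition on `R`. An interval avoiding `S` contains at most one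
element of `T`, so `R` meets it only by containing that element. Hence the admissible `R` are none
at all or those between `D` and `T`, and the alternating sum is 0 or 1. -/
theorem first_sum_nonneg {n : ℕ} {S T : Finset ℕ}
    (hmax : ∀ i j : ℕ, Finset.Icc i j ⊆ Finset.Icc 1 n \ S → (T ∩ Finset.Icc i j).card ≤ 1)
    {I : Finset (ℕ × ℕ)} (hI : ∀ p ∈ I, 1 ≤ p.1 ∧ p.2 ≤ n) :
    0 ≤ ∑ R ∈ T.powerset, (-1 : ℝ) ^ (T \ R).card * if Blocks I (S ∪ R) then 1 else 0 := by
  set J := I.filter fun p => ¬ ∃ i ∈ S, p.1 ≤ i ∧ i ≤ p.2 with hJ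
  by_cases hblock : ∀ p ∈ J, ∃ t ∈ T, p.1 ≤ t ∧ t ≤ p.2
  · set D := T.filter fun t => ∃ p ∈ J, p.1 ≤ t ∧ t ≤ p.2 with hD
    have h1 : ∀ R ∈ T.powerset, (Blocks I (S ∪ R) ↔ D ⊆ R) := by
      intro R hR
      rw [Finset.mem_powerset] at hR
      constructor
      · intro h t ht
        obtain ⟨htT, p, hp, hpt⟩ := Finset.mem_filter.1 ht
        obtain ⟨hpI, hpS⟩ := Finset.mem_filter.1 hp
        obtain ⟨i, hi, hpi⟩ := h p hpI
        have hiR : i ∈ R := (Finset.mem_union.1 hi).resolve_left fun h' => hpS ⟨i, h', hpi⟩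
        have h2 : Finset.Icc p.1 p.2 ⊆ Finset.Icc 1 n \ S := by
          intro j hj
          rw [Finset.mem_Icc] at hj
          have := hI p hpI
          refine Finset.mem_sdiff.2 ⟨Finset.mem_Icc.2 (by omega), fun hjS => hpS ⟨j, hjS, hj⟩⟩
        have h3 := Finset.card_le_one.1 (hmax _ _ h2) t
          (Finset.mem_inter.2 ⟨htT, Finset.mem_Icc.2 hpt⟩) i
          (Finset.mem_inter.2 ⟨hR hiR, Finset.mem_Icc.2 hpi⟩)
        exact h3 ▸ hiR
      · intro h p hp
        by_cases hpS : ∃ i ∈ S, p.1 ≤ i ∧ i ≤ p.2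
        · obtain ⟨i, hi, hpi⟩ := hpS
          exact ⟨i, Finset.mem_union_left _ hi, hpi⟩
        · have hpJ : p ∈ J := Finset.mem_filter.2 ⟨hp, hpS⟩
          obtain ⟨t, ht, hpt⟩ := hblock p hpJ
          exact ⟨t, Finset.mem_union_right _ (h (Finset.mem_filter.2 ⟨ht, p, hpJ, hpt⟩)), hpt⟩
    have h2 : ∑ R ∈ T.powerset, (-1 : ℝ) ^ (T \ R).card * (if Blocks I (S ∪ R) then 1 else 0) =
        (-1) ^ T.card * ∑ R ∈ T.powerset with D ⊆ R, (-1 : ℝ) ^ R.card := by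
      rw [Finset.mul_sum, Finset.sum_filter]
      refine Finset.sum_congr rfl fun R hR => ?_
      have h3 := Finset.mem_powerset.1 hR
      rw [if_congr (h1 R hR) rfl rfl, Finset.card_sdiff_of_subset h3,
        neg_one_pow_sub (Finset.card_le_card h3)]
      split_ifs <;> ring
    rw [h2, sum_interval_neg_one_pow (Finset.filter_subset _ _)]
    split_ifs with h4
    · rw [h4, neg_one_pow_mul_self]
      norm_num
    · simp
  · refine (Finset.sum_eq_zero fun R hR => ?_).ge
    rw [if_neg, mul_zero]
    intro h
    apply hblock
    intro p hp
    obtain ⟨hpI, hpS⟩ := Finset.mem_filter.1 hp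
    obtain ⟨i, hi, hpi⟩ := h p hpI
    have hiR : i ∈ R := (Finset.mem_union.1 hi).resolve_left fun h' => hpS ⟨i, h', hpi⟩
    exact ⟨i, Finset.mem_powerset.1 hR hiR, hpi⟩

theorem sum_first_mul {n : ℕ} {S T : Finset ℕ} (hS : S ⊆ Finset.Icc 1 n) (hT : T ⊆ Finset.Icc 1 n)
    (f : Finset ℕ → ℝ) :
    ∑ U : RankSet n, (∑ R ∈ T.powerset, ((-1 : ℝ) ^ (T \ R).card) • flagForm n (S ∪ R)) U * f U =
      ∑ R ∈ T.powerset, (-1 : ℝ) ^ (T \ R).card * f (S ∪ R) := by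
  simp only [Finset.sum_apply, Finset.sum_mul]
  rw [Finset.sum_comm]
  refine Finset.sum_congr rfl fun R hR => ?_
  have h1 : S ∪ R ⊆ Finset.Icc 1 n :=
    Finset.union_subset hS ((Finset.mem_powerset.1 hR).trans hT)
  simp only [Pi.smul_apply, smul_eq_mul, mul_assoc, ← Finset.mul_sum]
  rw [sum_flagForm_mul h1]

theorem sum_second_mul {n i j l : ℕ} (hi : 1 ≤ i) (hij : i < j) (hjl : j < l) (hl : l ≤ n)
    (f : Finset ℕ → ℝ) :
    ∑ U : RankSet n, (flagForm n {i, l} - flagForm n {i} - flagForm n {l} + flagForm n {j}) U * f U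
        =
      f {i, l} - f {i} - f {l} + f {j} := by
  simp only [Pi.add_apply, Pi.sub_apply, add_mul, sub_mul, Finset.sum_add_distrib,
    Finset.sum_sub_distrib]
  rw [sum_flagForm_mul, sum_flagForm_mul, sum_flagForm_mul, sum_flagForm_mul] <;>
    intro x hx <;> simp only [Finset.mem_insert, Finset.mem_singleton] at hx <;>
    rw [Finset.mem_Icc] <;> omega

/-- Basic forms are nonnegative at the vectors of interval systems. -/
theorem BasicForm.systemVector_nonneg {n : ℕ} {a : FlagForm n} (h : BasicForm n a) {r : ℝ}
    (hr : 0 ≤ r) {I : Finset (ℕ × ℕ)} (hI : ∀ p ∈ I, 1 ≤ p.1 ∧ p.2 ≤ n) :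
    0 ≤ evalForm (rescale r a) (systemVector r n I) := by
  rw [evalForm_rescale_systemVector]
  refine mul_nonneg (by positivity) ?_
  cases h with
  | first S T hS hT hST hmax =>
    rw [sum_first_mul hS hT fun U => if Blocks I U then 1 else 0]
    exact first_sum_nonneg hmax hI
  | second i j l hi hij hjl hl =>
    rw [sum_second_mul hi hij hjl hl fun U => if Blocks I U then 1 else 0]
    have h1 : Blocks I {i} → Blocks I {i, l} := fun h p hp => by
      obtain ⟨x, hx, hpx⟩ := h p hp
      exact ⟨x, by simp only [Finset.mem_singleton] at hx; simp [hx], hpx⟩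
    have h2 : Blocks I {l} → Blocks I {i, l} := fun h p hp => by
      obtain ⟨x, hx, hpx⟩ := h p hp
      exact ⟨x, by simp only [Finset.mem_singleton] at hx; simp [hx], hpx⟩
    -- An interval containing both `i` and `l` also contains `j`, which lies between them.
    have h3 : Blocks I {i} → Blocks I {l} → Blocks I {j} := fun h h' p hp => by
      obtain ⟨x, hx, hpx⟩ := h p hp
      obtain ⟨y, hy, hpy⟩ := h' p hp
      simp only [Finset.mem_singleton] at hx hy
      exact ⟨j, by simp, by omega⟩
    by_cases c1 : Blocks I {i} <;> by_cases c2 : Blocks I {l} <;> by_cases c3 : Blocks I {j} <;>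
      by_cases c4 : Blocks I {i, l} <;>
      first
      | exact absurd (h1 c1) c4
      | exact absurd (h2 c2) c4
      | exact absurd (h3 c1 c2) c3
      | simp [c1, c2, c3, c4]

/-- The members of a system below `m + 1`. -/
def lowerSystem (m : ℕ) (I : Finset (ℕ × ℕ)) : Finset (ℕ × ℕ) := I.filter fun p => p.2 ≤ m

/-- The members of a system above `m + 1`, translated. -/
def upperSystem (m : ℕ) (I : Finset (ℕ × ℕ)) : Finset (ℕ × ℕ) :=
  (I.filter fun p => m + 2 ≤ p.1).image fun p => (p.1 - (m + 1), p.2 - (m + 1))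

theorem IsEvenSystem.lowerSystem {m n : ℕ} {I : Finset (ℕ × ℕ)} (h : IsEvenSystem (m + n + 1) I) :
    IsEvenSystem m (lowerSystem m I) := by
  refine ⟨fun p hp => ?_, fun p hp q hq => ?_⟩
  · rw [EulerianFlag.lowerSystem, Finset.mem_filter] at hp
    exact ⟨(h.1 p hp.1).1, hp.2⟩
  · exact h.2 p (Finset.filter_subset _ _ hp) q (Finset.filter_subset _ _ hq)

theorem IsEvenSystem.upperSystem {m n : ℕ} {I : Finset (ℕ × ℕ)} (h : IsEvenSystem (m + n + 1) I) :
    IsEvenSystem n (upperSystem m I) := by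
  refine ⟨fun p hp => ?_, fun p hp q hq => ?_⟩
  · obtain ⟨p', hp', rfl⟩ := Finset.mem_image.1 hp
    rw [Finset.mem_filter] at hp'
    have := h.1 p' hp'.1
    simp only
    omega
  · obtain ⟨p', hp', rfl⟩ := Finset.mem_image.1 hp
    obtain ⟨q', hq', rfl⟩ := Finset.mem_image.1 hq
    rw [Finset.mem_filter] at hp' hq'
    have h1 := h.2 p' hp'.1 q' hq'.1
    rw [Nat.card_Icc] at h1 ⊢
    convert h1 using 1
    simp only
    omega

/-- Intervals containing `m + 1` are met automatically, and every other one lies entirely below or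
entirely above `m + 1`. -/
theorem blocks_union_iff {m n : ℕ} {I : Finset (ℕ × ℕ)} {S T : Finset ℕ}
    (hS : S ⊆ Finset.Icc 1 m) (hT : T ⊆ Finset.Icc 1 n) :
    Blocks I (S ∪ {m + 1} ∪ T.image (· + (m + 1))) ↔
      Blocks (lowerSystem m I) S ∧ Blocks (upperSystem m I) T := by
  constructor
  · intro h
    refine ⟨fun p hp => ?_, fun p hp => ?_⟩
    · obtain ⟨hpI, hpm⟩ := Finset.mem_filter.1 hp
      obtain ⟨i, hi, hpi⟩ := h p hpI
      simp only [Finset.mem_union, Finset.mem_singleton, Finset.mem_image] at hi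
      rcases hi with (hi | hi) | ⟨j, hj, hji⟩
      · exact ⟨i, hi, hpi⟩
      · omega
      · omega
    · obtain ⟨q, hq, rfl⟩ := Finset.mem_image.1 hp
      obtain ⟨hqI, hqm⟩ := Finset.mem_filter.1 hq
      obtain ⟨i, hi, hqi⟩ := h q hqI
      simp only [Finset.mem_union, Finset.mem_singleton, Finset.mem_image] at hi
      rcases hi with (hi | hi) | ⟨j, hj, hji⟩
      · have := Finset.mem_Icc.1 (hS hi)
        omega
      · omega
      · refine ⟨j, hj, ?_⟩
        simp only
        omega
  · rintro ⟨h1, h2⟩ p hp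
    by_cases c1 : p.2 ≤ m
    · obtain ⟨i, hi, hpi⟩ := h1 p (Finset.mem_filter.2 ⟨hp, c1⟩)
      exact ⟨i, by simp [hi], hpi⟩
    · by_cases c2 : m + 2 ≤ p.1
      · obtain ⟨i, hi, hpi⟩ := h2 _ (Finset.mem_image_of_mem _ (Finset.mem_filter.2 ⟨hp, c2⟩))
        have := Finset.mem_Icc.1 (hT hi)
        simp only at hpi
        refine ⟨i + (m + 1), ?_, by omega⟩
        rw [Finset.mem_union, Finset.mem_image]
        exact Or.inr ⟨i, hi, rfl⟩
      · exact ⟨m + 1, by simp, by omega⟩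

theorem union_image_subset {m n : ℕ} {S T : Finset ℕ}
    (hS : S ⊆ Finset.Icc 1 m) (hT : T ⊆ Finset.Icc 1 n) :
    S ∪ {m + 1} ∪ T.image (· + (m + 1)) ⊆ Finset.Icc 1 (m + n + 1) := by
  intro i hi
  simp only [Finset.mem_union, Finset.mem_singleton, Finset.mem_image] at hi
  rw [Finset.mem_Icc]
  rcases hi with (hi | hi) | ⟨j, hj, hji⟩
  · have := Finset.mem_Icc.1 (hS hi); omega
  · omega
  · have := Finset.mem_Icc.1 (hT hj); omega

theorem card_union_image {m n : ℕ} {S T : Finset ℕ}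
    (hS : S ⊆ Finset.Icc 1 m) (hT : T ⊆ Finset.Icc 1 n) :
    (S ∪ {m + 1} ∪ T.image (· + (m + 1))).card = S.card + 1 + T.card := by
  rw [Finset.card_union_of_disjoint, Finset.card_union_of_disjoint, Finset.card_singleton,
    Finset.card_image_of_injective _ (add_left_injective _)]
  · rw [Finset.disjoint_singleton_right]
    intro h
    have := Finset.mem_Icc.1 (hS h)
    omega
  · rw [Finset.disjoint_left]
    intro i hi hi'
    simp only [Finset.mem_union, Finset.mem_singleton, Finset.mem_image] at hi hi'
    obtain ⟨j, hj, hji⟩ := hi'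
    have := Finset.mem_Icc.1 (hT hj)
    rcases hi with hi | hi
    · have := Finset.mem_Icc.1 (hS hi); omega
    · omega

theorem evalForm_convolution {m n : ℕ} (p : FlagForm m) (q : FlagForm n)
    (x : FlagVector (m + n + 1)) (f : Finset ℕ → ℝ) (hf : ∀ S, x S = f S) :
    evalForm (convolution p q) x = ∑ S : RankSet m, ∑ T : RankSet n, (p S * q T) *
      f ((S : Finset ℕ) ∪ {m + 1} ∪ (T : Finset ℕ).image (· + (m + 1))) := by
  have h1 : evalForm (convolution p q) x = ∑ U, convolution p q U * f U :=
    Finset.sum_congr rfl fun U _ => by rw [hf]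
  rw [h1]
  simp only [convolution, Finset.sum_apply, Finset.sum_mul]
  rw [Finset.sum_comm]
  refine Finset.sum_congr rfl fun S _ => ?_
  rw [Finset.sum_comm]
  refine Finset.sum_congr rfl fun T _ => ?_
  simp only [Pi.smul_apply, smul_eq_mul, mul_assoc, ← Finset.mul_sum]
  rw [sum_flagForm_mul (union_image_subset (Finset.mem_powerset.1 S.2) (Finset.mem_powerset.1 T.2))]

/-- Both the blocking condition and the power of `r` split at `m + 1`, so the double sum is a
product; the extra factor `r` comes from the element `m + 1` itself. -/
theorem evalForm_convolution_systemVector {m n : ℕ} (p : FlagForm m) (q : FlagForm n) (r : ℝ)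
    (I : Finset (ℕ × ℕ)) :
    evalForm (convolution p q) (systemVector r (m + n + 1) I) =
      r * evalForm p (systemVector r m (lowerSystem m I)) *
        evalForm q (systemVector r n (upperSystem m I)) := by
  rw [evalForm_convolution p q (systemVector r _ I) (fun U => r ^ U.card * if Blocks I U then 1 else
      0) fun S => rfl,
    mul_assoc, evalForm, evalForm, Finset.sum_mul_sum, Finset.mul_sum]
  refine Finset.sum_congr rfl fun S _ => ?_
  rw [Finset.mul_sum]
  refine Finset.sum_congr rfl fun T _ => ?_
  have hS := Finset.mem_powerset.1 S.2
  have hT := Finset.mem_powerset.1 T.2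
  rw [card_union_image hS hT, if_congr (blocks_union_iff hS hT) rfl rfl, systemVector, systemVector]
  by_cases h1 : Blocks (lowerSystem m I) S <;> by_cases h2 : Blocks (upperSystem m I) T <;>
    simp only [h1, h2, and_self, and_true, and_false, if_true, if_false] <;> ring

theorem convolution_support {m n : ℕ} (p : FlagForm m) (q : FlagForm n) (U : RankSet (m + n + 1))
    (hU : m + 1 ∉ (U : Finset ℕ)) : convolution p q U = 0 := by
  simp only [convolution, Finset.sum_apply, Pi.smul_apply, smul_eq_mul]
  refine Finset.sum_eq_zero fun S _ => Finset.sum_eq_zero fun T _ => ?_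
  rw [flagForm, if_neg, mul_zero]
  intro h
  rw [h] at hU
  exact hU (by simp)

/-! ### The separating vector -/

/-- Coefficients of a vector on which all generated forms of rank eight are nonnegative, but not
the form of the main theorem. -/
def separatorList : List (ℤ × List ℕ) :=
  [(3, []), (-1, [1, 2]), (-1, [2, 3]), (-1, [4, 5]), (-1, [6, 7]), (1, [2, 3, 4, 5]),
    (-1, [1, 2, 3, 4]), (-1, [2, 3, 4, 5, 6, 7]), (1, [1, 2, 3, 4, 6, 7]), (1, [1, 2, 4, 5, 6, 7])]

/-- Even systems whose vectors sum to the separating vector on the sets containing a given rank. -/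
def separatorSystems : ℕ → List (Finset (ℕ × ℕ))
  | 1 => [{(6, 7)}, {(2, 7)}, {(2, 3), (4, 5)}]
  | 2 => [{(4, 5)}, {(6, 7)}, ∅]
  | 3 => [∅, {(4, 5), (6, 7)}, {(1, 2), (4, 7)}]
  | 4 => [{(1, 2)}, {(2, 3)}, {(6, 7)}]
  | 5 => [{(1, 4), (6, 7)}, {(2, 3)}, {(1, 2)}]
  | 6 => [{(1, 4)}, {(1, 2)}, {(2, 3), (4, 5)}]
  | _ => [{(1, 2)}, {(1, 4)}, {(2, 3), (4, 5)}]

theorem separatorSystems_even : ∀ s ∈ Finset.Icc 1 7, ∀ I ∈ separatorSystems s, IsEvenSystem 7 I :=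
    by
  decide +kernel

/-- The systems have to depend on `s`: one list valid for all `s` would make `F` nonnegative at the
separating vector, since `F` involves nonempty sets only. -/
theorem separator_decomposition : ∀ s ∈ Finset.Icc 1 7, ∀ S ∈ (Finset.Icc 1 7).powerset, s ∈ S →
    listCoord separatorList S =
      ((separatorSystems s).map fun I => if Blocks I S then (1 : ℤ) else 0).sum := by
  decide +kernel

/-- A form supported on sets containing `s` cannot distinguish the separating vector from the
corresponding sum of system vectors. -/
theorem evalForm_separator_nonneg {r : ℝ} {a : FlagForm 7} {s : ℕ} (hs : s ∈ Finset.Icc 1 7)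
    (ha : ∀ S : RankSet 7, s ∉ (S : Finset ℕ) → a S = 0)
    (h : ∀ I, IsEvenSystem 7 I → 0 ≤ evalForm a (systemVector r 7 I)) :
    0 ≤ evalForm a (listVector r 7 separatorList) := by
  have h1 : evalForm a (listVector r 7 separatorList) =
      ((separatorSystems s).map fun I => evalForm a (systemVector r 7 I)).sum := by
    have h2 : ∀ S : RankSet 7, a S * listVector r 7 separatorList S =
        a S * ((separatorSystems s).map fun I => systemVector r 7 I).sum S := by
      intro S
      by_cases hS : s ∈ (S : Finset ℕ)
      · rw [listVector_apply, separator_decomposition s hs S S.2 hS]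
        congr 1
        induction separatorSystems s with
        | nil => simp
        | cons I L ih =>
          simp only [List.map_cons, List.sum_cons, Pi.add_apply, ← ih, systemVector]
          push_cast
          ring
      · rw [ha S hS, zero_mul, zero_mul]
    have h3 : evalForm a (listVector r 7 separatorList) =
        evalForm a ((separatorSystems s).map fun I => systemVector r 7 I).sum :=
      Finset.sum_congr rfl fun S _ => h2 S
    rw [h3]
    clear h2 h3
    induction separatorSystems s with
    | nil => simp [evalForm_zero_right]
    | cons I L ih => simp only [List.map_cons, List.sum_cons, evalForm_add_right, ih]
  rw [h1]
  refine List.sum_nonneg fun x hx => ?_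
  obtain ⟨I, hI, rfl⟩ := List.mem_map.1 hx
  exact h I (separatorSystems_even s hs I hI)

/-- In the first family any `s ∈ S` belongs to all rank sets involved. If `S` is empty, the
condition for `[1,7]` leaves at most one element in `T`; these few forms and those of the second
family are evaluated directly. -/
theorem BasicForm.separator_nonneg {a : FlagForm 7} (h : BasicForm 7 a) {r : ℝ} (hr : 0 ≤ r) :
    0 ≤ evalForm (rescale r a) (listVector r 7 separatorList) := by
  have hsys : ∀ I, IsEvenSystem 7 I → 0 ≤ evalForm (rescale r a) (systemVector r 7 I) :=
    fun I hI => h.systemVector_nonneg hr hI.1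
  cases h with
  | first S T hS hT hST hmax =>
    rcases S.eq_empty_or_nonempty with rfl | ⟨s, hs⟩
    · rw [evalForm_rescale_listVector, sum_first_mul hS hT fun U => (listCoord separatorList U : ℝ)]
      refine mul_nonneg (by positivity) ?_
      have h1 : T.card ≤ 1 := by
        have := hmax 1 7 (by simp)
        rwa [Finset.inter_eq_left.2 hT] at this
      rcases Nat.le_one_iff_eq_zero_or_eq_one.1 h1 with h2 | h2
      · rw [Finset.card_eq_zero] at h2
        subst h2
        simp only [Finset.powerset_empty, Finset.sum_singleton]
        have : 0 ≤ listCoord separatorList ∅ := by decide +kernel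
        simpa using this
      · obtain ⟨t, rfl⟩ := Finset.card_eq_one.1 h2
        have ht : t ∈ Finset.Icc 1 7 := hT (Finset.mem_singleton_self t)
        have h3 : ∀ t ∈ Finset.Icc 1 7, listCoord separatorList ∅ ≤ listCoord separatorList {t} :=
            by
          decide +kernel
        rw [show ({t} : Finset ℕ).powerset = {∅, {t}} from rfl,
          Finset.sum_pair (Finset.singleton_ne_empty t).symm]
        simpa using h3 t ht
    · refine evalForm_separator_nonneg (hS hs) (fun U hU => ?_) hsys
      rw [rescale, Finset.sum_apply, Finset.sum_eq_zero, mul_zero]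
      intro R _
      rw [Pi.smul_apply, flagForm, if_neg, smul_zero]
      intro h
      exact hU (h ▸ Finset.mem_union_left _ hs)
  | second i j l hi hij hjl hl =>
    rw [evalForm_rescale_listVector,
      sum_second_mul hi hij hjl hl fun U => (listCoord separatorList U : ℝ)]
    refine mul_nonneg (by positivity) ?_
    have h1 : ∀ i ∈ Finset.Icc 1 7, ∀ j ∈ Finset.Icc 1 7, ∀ l ∈ Finset.Icc 1 7, i < j → j < l →
        0 ≤ listCoord separatorList {i, l} - listCoord separatorList {i} -
          listCoord separatorList {l} + listCoord separatorList {j} := by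
      decide +kernel
    have h2 := h1 i (Finset.mem_Icc.2 (by omega)) j (Finset.mem_Icc.2 (by omega)) l
      (Finset.mem_Icc.2 (by omega)) hij hjl
    exact_mod_cast h2

theorem disjointVector_mem_span_closedCone {r : ℕ} (hr : r ≠ 0) {U : Finset ℕ}
    (hU : U ∈ evenSets7) : disjointVector r 7 U ∈
      Submodule.span ℝ (closedCone (kEulerianFlagVectors ((r : ℝ) / 2) 7) : Set (FlagVector 7)) :=
          by
  refine disjointVector_mem_sup hr (Submodule.span_mono fun x hx => hx.1) ?_ U hU
  exact Submodule.subset_span (IsEvenSystem.systemVector_mem_closedCone (by decide) hr)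

/-- The first half, over all ranks and all even systems, is what convolution preserves; it supplies
the second half for convolutions of rank eight. Equations vanish on the cone, which contains the
system vectors, and on its linear span, which contains the separating vector. -/
theorem Generated.nonneg {r : ℕ} (hr : r ≠ 0) {n : ℕ} {a : FlagForm n}
    (h : Generated (RescaledBasicForm r) (kEulerianFlagVectors ((r : ℝ) / 2)) n a) :
    (∀ I, IsEvenSystem n I → 0 ≤ evalForm a (systemVector r n I)) ∧
      (n = 7 → 0 ≤ evalForm a (listVector r n separatorList)) := by
  induction h with
  | basic n b hb =>
    obtain ⟨a, ha, rfl⟩ := hb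
    refine ⟨fun I hI => ha.systemVector_nonneg (Nat.cast_nonneg r) hI.1, ?_⟩
    rintro rfl
    exact ha.separator_nonneg (Nat.cast_nonneg r)
  | conv m n p q hp hq ihp ihq =>
    have h1 : ∀ I, IsEvenSystem (m + n + 1) I →
        0 ≤ evalForm (convolution p q) (systemVector r (m + n + 1) I) := fun I hI => by
      rw [evalForm_convolution_systemVector]
      exact mul_nonneg (mul_nonneg (Nat.cast_nonneg r) (ihp.1 _ hI.lowerSystem))
        (ihq.1 _ hI.upperSystem)
    refine ⟨h1, fun h7 => ?_⟩
    have h2 := convolution_support p q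
    have hs : m + 1 ∈ Finset.Icc 1 7 := Finset.mem_Icc.2 (by omega)
    -- The index `m + n + 1` is generalised to a variable so that it can be replaced by 7; the
    -- support condition at `s = m + 1` is all that is retained of the convolution.
    revert h1 h2
    generalize convolution p q = b
    generalize m + n + 1 = N at h7 b
    subst h7
    exact fun h1 h2 => evalForm_separator_nonneg hs h2 h1
  | add n p q hp hq ihp ihq =>
    simp only [evalForm_add_left]
    exact ⟨fun I hI => add_nonneg (ihp.1 I hI) (ihq.1 I hI),
      fun h => add_nonneg (ihp.2 h) (ihq.2 h)⟩
  | smul n c p hc hp ih =>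
    simp only [evalForm_smul_left]
    exact ⟨fun I hI => mul_nonneg hc (ih.1 I hI), fun h => mul_nonneg hc (ih.2 h)⟩
  | equation n e he =>
    refine ⟨fun I hI => (evalForm_eq_zero_of_mem_closedCone he
      (hI.systemVector_mem_closedCone hr)).ge, ?_⟩
    rintro rfl
    have h1 : ∀ U ∈ evenSets7, evalForm e (disjointVector r 7 U) = 0 := by
      intro U hU
      refine Submodule.span_induction (p := fun y _ => evalForm e y = 0)
        (fun y hy => evalForm_eq_zero_of_mem_closedCone he hy) (evalForm_zero_right _) ?_ ?_
        (disjointVector_mem_span_closedCone hr hU)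
      · intro x y _ _ hx hy
        rw [evalForm_add_right, hx, hy, add_zero]
      · intro c x _ hx
        rw [evalForm_smul_right, hx, mul_zero]
    have h2 : ∀ p ∈ separatorList, p.2.toFinset ∈ evenSets7 := by decide +kernel
    rw [listVector]
    generalize separatorList = c at h2
    refine ge_of_eq ?_
    induction c with
    | nil => simp [evalForm_zero_right]
    | cons p c ih =>
      rw [List.map_cons, List.sum_cons, evalForm_add_right, evalForm_smul_right,
        h1 _ (h2 p List.mem_cons_self), mul_zero, zero_add]
      exact ih fun q hq => h2 q (List.mem_cons_of_mem _ hq)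

theorem not_generated_rank8Form {r : ℕ} (hr : r ≠ 0) :
    ¬ Generated (RescaledBasicForm r) (kEulerianFlagVectors ((r : ℝ) / 2)) 7
      (rescale r rank8Form) := by
  intro h
  have h1 := (h.nonneg hr).2 rfl
  rw [evalForm_rank8_listVector,
    show rank8Coord (listCoord separatorList) = -1 by decide +kernel] at h1
  have h2 : (0 : ℝ) < (r : ℝ) ^ 7 := by positivity
  push_cast at h1
  linarith

/-! ### Half-Eulerian posets as the case `r = 1` -/

theorem halfEulerianFlagVectors_eq : halfEulerianFlagVectors = kEulerianFlagVectors (1 / 2) := by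
  funext n
  ext v
  constructor
  · rintro ⟨P, _, _, _, _, hP, hE, h⟩
    have := Fintype.ofFinite P
    exact ⟨P, _, _, _, _, hP, isHalfEulerian_iff.1 hE, h⟩
  · rintro ⟨P, _, _, _, _, hP, hE, h⟩
    have := Fintype.ofFinite P
    exact ⟨P, _, _, _, _, hP, isHalfEulerian_iff.2 hE, h⟩

theorem rescale_one {n : ℕ} (a : FlagForm n) : rescale 1 a = a := by
  funext S
  simp [rescale]

theorem rescaledBasicForm_one : RescaledBasicForm 1 = BasicForm := by
  funext n b
  simp [RescaledBasicForm, rescale_one]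

theorem rank8_of_isKEulerian {r : ℕ} (hr : r ≠ 0) {k : ℝ} (hk : k = (r : ℝ) / 2)
    (P : Type*) [PartialOrder P] [BoundedOrder P] [Finite P] [GradeMinOrder ℕ P]
    (hP : grade ℕ (⊤ : P) = 8) (hE : IsKEulerian k P) :
    0 ≤ (2 * k) ^ 3 * (flagNumber P {1, 3, 5, 6} : ℝ) - (2 * k) ^ 4 * flagNumber P {1, 3, 5}
        - (2 * k) ^ 4 * flagNumber P {3, 5, 6} + (2 * k) ^ 5 * flagNumber P {1, 5}
        - (2 * k) ^ 5 * flagNumber P {1, 6} + (2 * k) ^ 5 * flagNumber P {3, 5}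
        + (2 * k) ^ 5 * flagNumber P {3, 6} - (2 * k) ^ 6 * flagNumber P {3} ∧
      (2 * k) ^ 3 * (flagNumber P {1, 3, 5, 6} : ℝ) - (2 * k) ^ 4 * flagNumber P {1, 3, 5}
        - (2 * k) ^ 4 * flagNumber P {3, 5, 6} + (2 * k) ^ 5 * flagNumber P {1, 5}
        - (2 * k) ^ 5 * flagNumber P {1, 6} + (2 * k) ^ 5 * flagNumber P {3, 5}
        + (2 * k) ^ 5 * flagNumber P {3, 6} - (2 * k) ^ 6 * flagNumber P {3}
        = -((2 * k) ^ 7 * rank8L k P) ∧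
      rank8L k P ≤ 0 := by
  subst hk
  have := Fintype.ofFinite P
  have hr' : (0 : ℝ) < r := by positivity
  rw [isKEulerian_iff_eulerRel (by positivity)] at hE
  have h1 := rank8_nonneg_of_isThick hP hE.isThick
  have h2 := hE.rank8_eq_neg_rank8L hP (by positivity)
  rw [mul_div_cancel₀ _ (two_ne_zero (α := ℝ))] at h2 ⊢
  refine ⟨h1, h2, ?_⟩
  rw [h2] at h1
  have h3 : (0 : ℝ) < (r : ℝ) ^ 7 := by positivity
  by_contra h4
  have := mul_pos h3 (not_le.1 h4)
  linarith

end EulerianFlag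

theorem mainTheorem6 :
    -- half-Eulerian posets: the inequality, in flag numbers and in `L^{1/2}`-vector form
    (∀ (P : Type*) [PartialOrder P] [BoundedOrder P] [Finite P] [GradeMinOrder ℕ P],
      grade ℕ (⊤ : P) = 8 → IsHalfEulerian P →
        0 ≤ (flagNumber P {1, 3, 5, 6} : ℝ) - flagNumber P {1, 3, 5} - flagNumber P {3, 5, 6}
            + flagNumber P {1, 5} - flagNumber P {1, 6} + flagNumber P {3, 5}
            + flagNumber P {3, 6} - flagNumber P {3} ∧
        (flagNumber P {1, 3, 5, 6} : ℝ) - flagNumber P {1, 3, 5} - flagNumber P {3, 5, 6}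
            + flagNumber P {1, 5} - flagNumber P {1, 6} + flagNumber P {3, 5}
            + flagNumber P {3, 6} - flagNumber P {3} = -rank8L (1 / 2) P ∧
        rank8L (1 / 2) P ≤ 0) ∧
    -- it determines a facet
    DefinesFacet rank8Form (closedCone (halfEulerianFlagVectors 7)) ∧
    -- it is not generated by the two basic families
    ¬ Generated BasicForm halfEulerianFlagVectors 7 rank8Form ∧
    -- the same for `k`-Eulerian posets, with each `f_S` replaced by `(2k)^(n-|S|) f_S`
    (∀ k : ℝ, (∃ j : ℕ, 0 < j ∧ k = j / 2) →
      (∀ (P : Type*) [PartialOrder P] [BoundedOrder P] [Finite P] [GradeMinOrder ℕ P],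
        grade ℕ (⊤ : P) = 8 → IsKEulerian k P →
          0 ≤ (2 * k) ^ 3 * (flagNumber P {1, 3, 5, 6} : ℝ) - (2 * k) ^ 4 * flagNumber P {1, 3, 5}
              - (2 * k) ^ 4 * flagNumber P {3, 5, 6} + (2 * k) ^ 5 * flagNumber P {1, 5}
              - (2 * k) ^ 5 * flagNumber P {1, 6} + (2 * k) ^ 5 * flagNumber P {3, 5}
              + (2 * k) ^ 5 * flagNumber P {3, 6} - (2 * k) ^ 6 * flagNumber P {3} ∧
          (2 * k) ^ 3 * (flagNumber P {1, 3, 5, 6} : ℝ) - (2 * k) ^ 4 * flagNumber P {1, 3, 5}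
              - (2 * k) ^ 4 * flagNumber P {3, 5, 6} + (2 * k) ^ 5 * flagNumber P {1, 5}
              - (2 * k) ^ 5 * flagNumber P {1, 6} + (2 * k) ^ 5 * flagNumber P {3, 5}
              + (2 * k) ^ 5 * flagNumber P {3, 6} - (2 * k) ^ 6 * flagNumber P {3}
            = -((2 * k) ^ 7 * rank8L k P) ∧
          rank8L k P ≤ 0) ∧
      DefinesFacet (rescale (2 * k) rank8Form) (closedCone (kEulerianFlagVectors k 7)) ∧
      ¬ Generated (RescaledBasicForm (2 * k)) (kEulerianFlagVectors k) 7
          (rescale (2 * k) rank8Form)) := by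
  have h1 : (1 / 2 : ℝ) = ((1 : ℕ) : ℝ) / 2 := by norm_num
  refine ⟨fun P _ _ _ _ hP hE => ?_, ?_, ?_, ?_⟩
  · have := Fintype.ofFinite P
    have h2 := rank8_of_isKEulerian one_ne_zero h1 P hP (isHalfEulerian_iff.1 hE)
    simpa only [mul_one_div_cancel (two_ne_zero (α := ℝ)), one_pow, one_mul] using h2
  · have h2 := definesFacet_kEulerian one_ne_zero
    rwa [← h1, Nat.cast_one, rescale_one, ← halfEulerianFlagVectors_eq] at h2
  · have h2 := not_generated_rank8Form one_ne_zero
    rwa [← h1, Nat.cast_one, rescale_one, ← halfEulerianFlagVectors_eq, rescaledBasicForm_one] at h2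
  · rintro k ⟨j, hj, hk⟩
    have h2 : 2 * k = j := by rw [hk]; ring
    refine ⟨fun P _ _ _ _ hP hE => rank8_of_isKEulerian hj.ne' hk P hP hE, ?_, ?_⟩
    · rw [h2, hk]
      exact definesFacet_kEulerian hj.ne'
    · rw [h2, hk]
      exact not_generated_rank8Form hj.ne'
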